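/- A graph is a finite undirected multigraph; parallel edges and loops are allowed, and a loop contributes $2$ to the degree of its vertex. An Eulerian graph is a connected graph all of whose vertices have even degree; a graph is $4$-regular if every vertex has degree $4$. An Eulerian tour of a graph $G$ is a closed trail $v_0,e_1,v_1,\dots,e_\ell,v_\ell=v_0$ that travels every edge of $G$ exactly once; the two directions in which a loop can be travelled are distinguished, and two tours are identified if they differ only by the choice of the starting point and by reversal of the whole tour. For a class $\mathcal C$ of graphs, #ET in $\mathcal C$ is the problem of computing, for a given $G\in\mathcal C$, the number of Eulerian tours of $G$. The graph $G$ is given as the list consisting of its number of vertices and of the two ends of each of its edges, all numbers in binary. A counting problem $A$ is polynomial-time Turing reducible to a counting problem $B$ if there are an oracle program (of a random access machine with logarithmic cost, which up to polynomial factors is an oracle Turing machine) and a polynomial $T$ such that, with every oracle that returns the correct number on every encoding of an instance of $B$, the program outputs the correct number for every instance of $A$ at cost at most $T(s)$, where $s$ is the bit length of the encoding of that instance; the bit lengths of the queries and of the answers are included in the cost. **Theorem.** #ET in Eulerian graphs is polynomial-time Turing reducible to #ET in $4$-regular graphs. -/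

import Mathlib

/-! ## Multigraphs and Eulerian tours -/

/-- A finite undirected multigraph; parallel edges and loops are allowed.
The order of the two ends of an edge carries no meaning. -/
structure Multigraph where
  numVerts : ℕ
  numEdges : ℕ
  ends : Fin numEdges → Fin numVerts × Fin numVerts

namespace Multigraph

/-- A dart is an edge with a direction of traversal (equivalently, a half-edge: the one at which
the traversal starts). A loop has two darts. -/
abbrev Dart (G : Multigraph) : Type := Fin G.numEdges × Bool

/-- The vertex at which a dart starts. -/
def src (G : Multigraph) (d : G.Dart) : Fin G.numVerts :=
  if d.2 then (G.ends d.1).2 else (G.ends d.1).1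

/-- The same edge traversed in the opposite direction. -/
def flip (G : Multigraph) (d : G.Dart) : G.Dart := (d.1, !d.2)

/-- The vertex at which a dart ends. -/
def tgt (G : Multigraph) (d : G.Dart) : Fin G.numVerts := G.src (G.flip d)

/-- The degree of a vertex; a loop counts twice. -/
def degree (G : Multigraph) (v : Fin G.numVerts) : ℕ :=
  (Finset.univ.filter fun d : G.Dart => G.src d = v).card

/-- Two vertices are adjacent in the underlying simple graph if they are distinct and joined by
at least one edge. -/
def toSimple (G : Multigraph) : SimpleGraph (Fin G.numVerts) :=
  SimpleGraph.fromRel fun u v => ∃ d : G.Dart, G.src d = u ∧ G.tgt d = v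

/-- Eulerian graphs: connected, with all degrees even. -/
def IsEulerian (G : Multigraph) : Prop :=
  G.toSimple.Connected ∧ ∀ v, Even (G.degree v)

/-- 4-regular graphs. -/
def IsFourRegular (G : Multigraph) : Prop := ∀ v, G.degree v = 4

/-- A directed Eulerian tour without a distinguished starting point: a cyclic sequence of darts,
each ending where the next one starts, that travels every edge exactly once. -/
def IsDirectedTour (G : Multigraph) (c : Cycle G.Dart) : Prop :=
  c.Chain (fun d d' => G.tgt d = G.src d') ∧
    ∀ e : Fin G.numEdges, (c.toMultiset.map Prod.fst).count e = 1

/-- A cyclic sequence of darts travelled backwards. -/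
def reverseTour (G : Multigraph) (c : Cycle G.Dart) : Cycle G.Dart := (c.map G.flip).reverse

theorem reverseTour_reverseTour (G : Multigraph) (c : Cycle G.Dart) :
    G.reverseTour (G.reverseTour c) = c := by
  induction c using Quotient.inductionOn with
  | h l =>
    have h : G.flip ∘ G.flip = id := by
      funext d; simp [flip]
    simp [reverseTour, List.map_reverse, h]

/-- Two directed tours are the same Eulerian tour if they agree up to the direction of travel. -/
def tourSetoid (G : Multigraph) : Setoid {c : Cycle G.Dart // G.IsDirectedTour c} where
  r c c' := c.1 = c'.1 ∨ c.1 = G.reverseTour c'.1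
  iseqv :=
    { refl := fun _ => Or.inl rfl
      symm := by
        rintro c c' (h | h)
        · exact Or.inl h.symm
        · exact Or.inr (by rw [h, reverseTour_reverseTour])
      trans := by
        rintro a b c (h | h) (h' | h')
        · exact Or.inl (h.trans h')
        · exact Or.inr (h.trans h')
        · exact Or.inr (by rw [h, h'])
        · exact Or.inl (by rw [h, h', reverseTour_reverseTour]) }

/-- The number of Eulerian tours, up to the choice of the starting point and the direction. -/
noncomputable def numEulerianTours (G : Multigraph) : ℕ :=
  Nat.card (Quotient G.tourSetoid)

/-- A multigraph as an input: the number of vertices, then the two ends of each edge. -/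
def encode (G : Multigraph) : List ℕ :=
  G.numVerts ::
    (List.ofFn G.ends).flatMap fun e => [(e.1 : ℕ), (e.2 : ℕ)]

theorem encode_injective : Function.Injective encode := by
  have key : ∀ {n : ℕ} (l l' : List (Fin n × Fin n)),
      (l.flatMap fun e => [(e.1 : ℕ), (e.2 : ℕ)]) =
        (l'.flatMap fun e => [(e.1 : ℕ), (e.2 : ℕ)]) → l = l' := by
    intro n l
    induction l with
    | nil => intro l' h; cases l' <;> simp_all
    | cons a l ih =>
      intro l' h
      cases l' with
      | nil => simp at h
      | cons b l' =>
        simp only [List.flatMap_cons, List.cons_append, List.nil_append, List.cons.injEq] at h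
        obtain ⟨h1, h2, h3⟩ := h
        rw [ih l' h3, Prod.ext (Fin.ext h1) (Fin.ext h2)]
  rintro ⟨n, m, f⟩ ⟨n', m', f'⟩ h
  simp only [encode, List.cons.injEq] at h
  obtain ⟨rfl, h⟩ := h
  have h := key _ _ h
  have hm : m = m' := by simpa using congrArg List.length h
  subst hm
  rw [List.ofFn_injective h]

end Multigraph

/-! ## Oracle random access machines with logarithmic cost

Programs work on finitely many arrays of natural numbers. Every operation is charged the bit
lengths of all the addresses and values that it touches, so that polynomial time here is
polynomial time on (oracle) Turing machines. -/

namespace OracleRAM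

/-- The bit length of a word of natural numbers, with one separator after each entry. -/
def wordSize (w : List ℕ) : ℕ := (w.map fun x => Nat.size x + 1).sum

/-- `s A i` is the content of cell `i` of the array `A`. -/
abbrev Store : Type := ℕ → ℕ → ℕ

/-- Overwrite one cell. -/
def Store.set (s : Store) (A i v : ℕ) : Store :=
  Function.update s A (Function.update (s A) i v)

/-- The arithmetic operations (`sub` is truncated at `0`). -/
inductive Op
  | add | sub | mul | div | mod

/-- The value of an arithmetic operation. -/
def Op.eval : Op → ℕ → ℕ → ℕ
  | .add, a, b => a + b
  | .sub, a, b => a - b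
  | .mul, a, b => a * b
  | .div, a, b => a / b
  | .mod, a, b => a % b

/-- Expressions: constants, array access with a computed address, arithmetic. -/
inductive Expr
  | const (c : ℕ)
  | load (A : ℕ) (i : Expr)
  | op (o : Op) (a b : Expr)

/-- The value of an expression. -/
def Expr.eval (s : Store) : Expr → ℕ
  | .const c => c
  | .load A i => s A (i.eval s)
  | .op o a b => o.eval (a.eval s) (b.eval s)

/-- The logarithmic cost of evaluating an expression. -/
def Expr.cost (s : Store) : Expr → ℕ
  | .const c => 1 + Nat.size c
  | .load A i => i.cost s + (1 + Nat.size (i.eval s) + Nat.size (s A (i.eval s)))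
  | .op o a b => a.cost s + b.cost s +
      (1 + Nat.size (a.eval s) + Nat.size (b.eval s) + Nat.size (o.eval (a.eval s) (b.eval s)))

/-- Programs. `assign A i e` is `A[i] := e`; a test succeeds if its value is nonzero;
`query A n B` asks the oracle about the word `A[0], …, A[n-1]` and writes the answer to `B[0]`. -/
inductive Prog
  | skip
  | assign (A : ℕ) (i e : Expr)
  | seq (P Q : Prog)
  | ite (e : Expr) (P Q : Prog)
  | while (e : Expr) (P : Prog)
  | query (A : ℕ) (n : Expr) (B : ℕ)

/-- The word `A[0], …, A[n-1]`. -/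
def Store.word (s : Store) (A n : ℕ) : List ℕ := (List.range n).map (s A)

/-- `Exec O P s s' t`: with oracle `O`, the program `P` started in `s` halts in `s'` at cost `t`. -/
inductive Exec (O : List ℕ → ℕ) : Prog → Store → Store → ℕ → Prop
  | skip (s : Store) : Exec O .skip s s 1
  | assign (s : Store) (A : ℕ) (i e : Expr) :
      Exec O (.assign A i e) s (s.set A (i.eval s) (e.eval s))
        (i.cost s + e.cost s + (1 + Nat.size (i.eval s) + Nat.size (e.eval s)))
  | seq {P Q : Prog} {s s' s'' : Store} {t t' : ℕ} :
      Exec O P s s' t → Exec O Q s' s'' t' → Exec O (.seq P Q) s s'' (t + t' + 1)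
  | ite_true {e : Expr} {P Q : Prog} {s s' : Store} {t : ℕ} :
      e.eval s ≠ 0 → Exec O P s s' t → Exec O (.ite e P Q) s s' (e.cost s + t + 1)
  | ite_false {e : Expr} {P Q : Prog} {s s' : Store} {t : ℕ} :
      e.eval s = 0 → Exec O Q s s' t → Exec O (.ite e P Q) s s' (e.cost s + t + 1)
  | while_true {e : Expr} {P : Prog} {s s' s'' : Store} {t t' : ℕ} :
      e.eval s ≠ 0 → Exec O P s s' t → Exec O (.while e P) s' s'' t' →
        Exec O (.while e P) s s'' (e.cost s + t + t' + 1)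
  | while_false {e : Expr} {P : Prog} {s : Store} :
      e.eval s = 0 → Exec O (.while e P) s s (e.cost s + 1)
  | query (s : Store) (A : ℕ) (n : Expr) (B : ℕ) :
      Exec O (.query A n B) s (s.set B 0 (O (s.word A (n.eval s))))
        (n.cost s + (1 + wordSize (s.word A (n.eval s)) + Nat.size (O (s.word A (n.eval s)))))

/-- The initial store: array `0` holds the input word, `1[0]` its length, all else is `0`. -/
def initStore (w : List ℕ) : Store := fun A i =>
  if A = 0 then w.getD i 0 else if A = 1 ∧ i = 0 then w.length else 0

/-- With oracle `O` and input `w`, the program `P` halts with output `y` (in the cell `0[0]`)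
at cost at most `T`. -/
def Outputs (O : List ℕ → ℕ) (P : Prog) (w : List ℕ) (y T : ℕ) : Prop :=
  ∃ s t, Exec O P (initStore w) s t ∧ s 0 0 = y ∧ t ≤ T

end OracleRAM

/-! ## Counting problems and reductions -/

/-- A counting problem: instances, their encoding as words, and the number to be computed. -/
structure CountingProblem where
  Inst : Type
  encode : Inst → List ℕ
  encode_injective : Function.Injective encode
  count : Inst → ℕ

/-- `A` is polynomial-time Turing reducible to `B`: one program and one polynomial such that, with
any oracle that answers the instances of `B` correctly (and words that encode no instance
arbitrarily), the program solves all instances of `A` in polynomial time. -/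
def CountingProblem.PolyTimeTuringReducible (A B : CountingProblem) : Prop :=
  ∃ (P : OracleRAM.Prog) (T : Polynomial ℕ),
    ∀ O : List ℕ → ℕ, (∀ b : B.Inst, O (B.encode b) = B.count b) →
      ∀ a : A.Inst,
        OracleRAM.Outputs O P (A.encode a) (A.count a)
          (T.eval (OracleRAM.wordSize (A.encode a)))

/-- #ET restricted to a class of graphs: count the Eulerian tours of a given graph of the class. -/
noncomputable def sharpET (C : Multigraph → Prop) : CountingProblem where
  Inst := {G : Multigraph // C G}
  encode G := G.1.encode
  encode_injective := Multigraph.encode_injective.comp Subtype.val_injective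
  count G := G.1.numEulerianTours
/-! Matching the half-edges at every vertex, in all possible ways, decomposes the edges into closed
trails, and the Eulerian tours are the matchings with a single closed trail. Colour the edges with
`N` colours and match only ends of the same colour: a matching with `k` closed trails is counted
`N ^ k` times, or `N ^ (k - 1)` times if the colour of one edge is prescribed. Hence modulo `N` the
number of tours is the number of pairs of a colouring, with one colour prescribed, and a matching
of ends of equal colours: a sum of products of tensors, one for each vertex, which can be
manipulated locally, and knowing it modulo every `N` determines the number of tours.

A vertex of degree `2 * k` is replaced by a gadget that pairs its half-edges one after another. A
new strand with two legs is created, and one of the legs runs through a sequence of ladders past the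
legs that are already there; choosing the numbers of blocks of the ladders properly makes every
pairing occur with the same weight, provided that a block allows only two of the three transitions
between its four ends. A `4`-regular graph allows all three, but a chain of `j + 1` vertices joined
by double edges acts modulo `N` as `2 ^ j` times a block at which the third transition has weight
`κ = j + 1`, since a closed trail that splits off in it contributes a factor `N = 0`. So, up to a
power of `2`, the number of tours of the `4`-regular graph is a polynomial in `κ` of degree at most
the number of blocks. Its value at `κ = 0`, a known multiple of the wanted number, is an alternating
sum of its values at `κ = 1, 2, …`, which the oracle provides. -/

/-! ## Perfect matchings inside the fibres of a map -/

/-- The number of perfect matchings of `n` points. -/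
def perfectMatchings : ℕ → ℕ
  | 0 => 1
  | 1 => 0
  | n + 2 => (n + 1) * perfectMatchings n

theorem perfectMatchings_succ (n : ℕ) :
    perfectMatchings (n + 1) = n * perfectMatchings (n - 1) := by
  cases n <;> simp [perfectMatchings]

section MatchCount

variable {α : Type*} [DecidableEq α]

/-- The number of perfect matchings of a multiset that match only equal elements. -/
def matchCount (s : Multiset α) : ℕ :=
  ∏ y ∈ s.toFinset, perfectMatchings (s.count y)

theorem matchCount_eq_prod {s : Multiset α} {F : Finset α} (h : s.toFinset ⊆ F) :
    matchCount s = ∏ y ∈ F, perfectMatchings (s.count y) := by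
  refine Finset.prod_subset h fun y _ hy => ?_
  rw [Multiset.mem_toFinset] at hy
  rw [Multiset.count_eq_zero_of_notMem hy, perfectMatchings]

@[simp] theorem matchCount_zero : matchCount (0 : Multiset α) = 1 := by
  simp [matchCount]

theorem matchCount_cons (z : α) (s : Multiset α) :
    matchCount (z ::ₘ s) = s.count z * matchCount (s.erase z) := by
  have hz : z ∈ (z ::ₘ s).toFinset := by simp
  have hsub : (s.erase z).toFinset ⊆ (z ::ₘ s).toFinset :=
    Multiset.toFinset_subset.2 fun _ h => Multiset.mem_cons_of_mem (Multiset.mem_of_mem_erase h)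
  rw [matchCount_eq_prod hsub, matchCount, ← Finset.mul_prod_erase _ _ hz,
    ← Finset.mul_prod_erase _ _ hz, ← mul_assoc]
  congr 1
  · simp [perfectMatchings_succ]
  · refine Finset.prod_congr rfl fun y hy => ?_
    have hy : y ≠ z := Finset.ne_of_mem_erase hy
    simp [Multiset.count_cons_of_ne hy, Multiset.count_erase_of_ne hy]

theorem matchCount_add_of_disjoint {s t : Multiset α} (h : Disjoint s t) :
    matchCount (s + t) = matchCount s * matchCount t := by
  have hdisj : Disjoint s.toFinset t.toFinset := Multiset.disjoint_toFinset.2 h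
  rw [matchCount, Multiset.toFinset_add, Finset.prod_union hdisj, matchCount, matchCount]
  congr 1 <;> refine Finset.prod_congr rfl fun y hy => ?_ <;>
    rw [Multiset.mem_toFinset] at hy
  · rw [Multiset.count_add, Multiset.count_eq_zero_of_notMem (Multiset.disjoint_left.1 h hy),
      add_zero]
  · rw [Multiset.count_add, Multiset.count_eq_zero_of_notMem (Multiset.disjoint_right.1 h hy),
      zero_add]

theorem matchCount_map {β : Type*} [DecidableEq β] {f : α → β} (hf : Function.Injective f)
    (s : Multiset α) : matchCount (s.map f) = matchCount s := by
  rw [matchCount, Multiset.toFinset_map, Finset.prod_image hf.injOn, matchCount]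
  simp only [Multiset.count_map_eq_count' f s hf]

theorem matchCount_pair (a b : α) : matchCount (a ::ₘ {b}) = if a = b then 1 else 0 := by
  rw [matchCount_cons]
  by_cases h : a = b <;> simp [h]

theorem matchCount_four (a b c d : α) :
    matchCount {a, b, c, d} = (if a = c ∧ b = d then 1 else 0) +
      (if a = d ∧ b = c then 1 else 0) + (if a = b ∧ c = d then 1 else 0) := by
  simp only [Multiset.insert_eq_cons]
  rw [matchCount_cons]
  by_cases hab : a = b
  · subst hab
    rw [Multiset.erase_cons_head, matchCount_pair]
    by_cases hac : a = c <;> by_cases had : a = d <;> by_cases hcd : c = d <;> simp_all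
  rw [Multiset.erase_cons_tail _ (Ne.symm hab)]
  by_cases hac : a = c
  · subst hac
    rw [Multiset.erase_cons_head, matchCount_pair]
    by_cases hbd : b = d <;> simp_all
  rw [Multiset.erase_cons_tail _ (Ne.symm hac)]
  by_cases had : a = d
  · subst had
    rw [← Multiset.cons_zero a, Multiset.erase_cons_head, Multiset.cons_zero c, matchCount_pair]
    simp_all
  · simp [hab, hac, had]

end MatchCount

section Involutions

theorem apply_swap_eq_of_eq {X Y : Type*} [DecidableEq X] {f : X → Y} {x y : X} (h : f x = f y)
    (z : X) :
    f (Equiv.swap x y z) = f z := by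
  rw [Equiv.swap_apply_def]
  split_ifs with hx hy
  · rw [hx, h]
  · rw [hy, h]
  · rfl

variable {X Y : Type*} [Fintype X] [DecidableEq X] [DecidableEq Y] {f : X → Y} {s : Finset X}
  {τ : Equiv.Perm X} {x y : X}

/-- The involutions with support `s` that preserve `f`, that is, the perfect matchings of `s`
inside the fibres of `f`. -/
def fiberInvolutions (f : X → Y) (s : Finset X) : Finset (Equiv.Perm X) :=
  Finset.univ.filter fun τ => (∀ x, τ (τ x) = x) ∧ (∀ x, τ x ≠ x ↔ x ∈ s) ∧ ∀ x, f (τ x) = f x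

theorem mem_fiberInvolutions :
    τ ∈ fiberInvolutions f s ↔
      (∀ x, τ (τ x) = x) ∧ (∀ x, τ x ≠ x ↔ x ∈ s) ∧ ∀ x, f (τ x) = f x := by
  simp [fiberInvolutions]

theorem fiberInvolutions_empty : fiberInvolutions f ∅ = {1} := by
  ext τ
  rw [mem_fiberInvolutions, Finset.mem_singleton]
  refine ⟨fun ⟨_, h, _⟩ => Equiv.ext fun x => by simpa using h x, ?_⟩
  rintro rfl
  simp

theorem apply_mem_of_mem_fiberInvolutions (hτ : τ ∈ fiberInvolutions f s) (hx : x ∈ s) :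
    τ x ∈ (s.erase x).filter fun y => f x = f y := by
  obtain ⟨hinv, hsupp, hf⟩ := mem_fiberInvolutions.1 hτ
  have hne : τ x ≠ x := (hsupp x).2 hx
  exact Finset.mem_filter.2 ⟨Finset.mem_erase.2
    ⟨hne, (hsupp _).1 (by rw [hinv]; exact hne.symm)⟩, (hf x).symm⟩

theorem mul_swap_mem_fiberInvolutions_erase (hτ : τ ∈ fiberInvolutions f s) (hy : τ x = y) :
    τ * Equiv.swap x y ∈ fiberInvolutions f ((s.erase x).erase y) := by
  obtain ⟨hinv, hsupp, hf⟩ := mem_fiberInvolutions.1 hτ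
  have hx : τ y = x := by rw [← hy, hinv]
  have hcomm : ∀ z, τ (Equiv.swap x y z) = Equiv.swap x y (τ z) := fun z => by
    rw [← Equiv.Perm.mul_apply, Equiv.mul_swap_eq_swap_mul, hx, hy, Equiv.swap_comm,
      Equiv.Perm.mul_apply]
  refine mem_fiberInvolutions.2 ⟨fun z => ?_, fun z => ?_, fun z => ?_⟩
  · simp [hcomm, hinv]
  · have hfix : τ (Equiv.swap x y z) = z ↔ Equiv.swap x y z = τ z := by
      rw [← τ.injective.eq_iff (b := τ z), hinv]
    rw [Equiv.Perm.mul_apply, ne_eq, hfix, Finset.mem_erase, Finset.mem_erase, ← hsupp]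
    rcases eq_or_ne z x with rfl | hzx
    · simp [hy]
    rcases eq_or_ne z y with rfl | hzy
    · simp [hx]
    · rw [Equiv.swap_apply_of_ne_of_ne hzx hzy]
      simp [hzx, hzy, eq_comm]
  · rw [Equiv.Perm.mul_apply, hf, apply_swap_eq_of_eq (f := f) (by rw [← hy, hf])]

theorem mul_swap_mem_fiberInvolutions_insert (hτ : τ ∈ fiberInvolutions f s) (hx : x ∉ s)
    (hy : y ∉ s) (hxy : x ≠ y) (hf : f x = f y) :
    τ * Equiv.swap x y ∈ fiberInvolutions f (insert x (insert y s)) := by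
  obtain ⟨hinv, hsupp, hfτ⟩ := mem_fiberInvolutions.1 hτ
  have hτx : τ x = x := not_not.1 (mt (hsupp x).1 hx)
  have hτy : τ y = y := not_not.1 (mt (hsupp y).1 hy)
  have hcomm : ∀ z, τ (Equiv.swap x y z) = Equiv.swap x y (τ z) := fun z => by
    rw [← Equiv.Perm.mul_apply, Equiv.mul_swap_eq_swap_mul, hτx, hτy, Equiv.Perm.mul_apply]
  refine mem_fiberInvolutions.2 ⟨fun z => ?_, fun z => ?_, fun z => ?_⟩
  · simp [hcomm, hinv]
  · rw [Equiv.Perm.mul_apply, Finset.mem_insert, Finset.mem_insert, ← hsupp]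
    rcases eq_or_ne z x with rfl | hzx
    · simp [hτy, hxy.symm]
    rcases eq_or_ne z y with rfl | hzy
    · simp [hτx, hxy]
    · simp [Equiv.swap_apply_of_ne_of_ne hzx hzy, hzx, hzy]
  · rw [Equiv.Perm.mul_apply, hfτ, apply_swap_eq_of_eq hf]

theorem card_fiberInvolutions_filter (hx : x ∈ s) (hy : y ∈ s) (hxy : x ≠ y) (hf : f x = f y) :
    ((fiberInvolutions f s).filter fun τ => τ x = y).card =
      (fiberInvolutions f ((s.erase x).erase y)).card := by
  refine Finset.card_bij' (fun τ _ => τ * Equiv.swap x y) (fun τ _ => τ * Equiv.swap x y)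
    (fun τ hτ => ?_) (fun τ hτ => Finset.mem_filter.2 ⟨?_, ?_⟩)
    (fun τ _ => by simp [mul_assoc]) fun τ _ => by simp [mul_assoc]
  · obtain ⟨hτ, hy⟩ := Finset.mem_filter.1 hτ
    exact mul_swap_mem_fiberInvolutions_erase hτ hy
  · have := mul_swap_mem_fiberInvolutions_insert (x := x) (y := y) hτ (by simp) (by simp) hxy hf
    rwa [Finset.insert_erase (Finset.mem_erase.2 ⟨hxy.symm, hy⟩), Finset.insert_erase hx] at this
  · have hτy : τ y = y := not_not.1 (mt ((mem_fiberInvolutions.1 hτ).2.1 y).1 (by simp))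
    simp [hτy]

theorem card_fiberInvolutions (f : X → Y) (s : Finset X) :
    (fiberInvolutions f s).card = matchCount (s.val.map f) := by
  induction s using Finset.strongInduction with
  | H s ih =>
  rcases s.eq_empty_or_nonempty with rfl | ⟨x, hx⟩
  · simp [fiberInvolutions_empty]
  have hcount : ((s.erase x).val.map f).count (f x) =
      ((s.erase x).filter fun y => f x = f y).card := Multiset.count_map ..
  rw [← Multiset.cons_erase hx, ← Finset.erase_val, Multiset.map_cons, matchCount_cons, hcount,
    Finset.card_eq_sum_card_fiberwise fun τ hτ => apply_mem_of_mem_fiberInvolutions hτ hx,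
    ← smul_eq_mul]
  refine Finset.sum_eq_card_nsmul fun y hy => ?_
  obtain ⟨hys, hfy⟩ := Finset.mem_filter.1 hy
  obtain ⟨hyx, hy⟩ := Finset.mem_erase.1 hys
  rw [card_fiberInvolutions_filter hx hy hyx.symm hfy,
    ih _ ((Finset.erase_subset _ _).trans_ssubset (Finset.erase_ssubset hx)), Finset.erase_val,
    Multiset.map_erase_of_mem _ _ hys, hfy]

end Involutions

/-! ## Cyclic sequences without repetitions -/

section Cycles

variable {α : Type*} {c : Cycle α} {d : α}

theorem exists_eq_coe_cons_of_mem (h : d ∈ c) :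
    ∃ l : List α, c = ((d :: l : List α) : Cycle α) := by
  induction c using Quotient.inductionOn with
  | h l =>
  obtain ⟨l₁, l₂, rfl⟩ := List.append_of_mem (show d ∈ l from h)
  exact ⟨l₂ ++ l₁, Cycle.coe_eq_coe.2 (by
    rw [← List.cons_append]; exact List.isRotated_append)⟩

theorem coe_eq_periodicOrbit {f : α → α} {l : List α} (hl : l.Nodup)
    (hf : ∀ i (hi : i < l.length), l[i] = f^[i] d) (hd : Function.IsPeriodicPt f l.length d)
    (h0 : 0 < l.length) : (l : Cycle α) = Function.periodicOrbit f d := by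
  have hmin : Function.minimalPeriod f d = l.length := by
    refine (hd.minimalPeriod_le h0).eq_of_not_lt fun hlt => ?_
    have : l[Function.minimalPeriod f d] = l[0] := by
      rw [hf, hf, Function.iterate_minimalPeriod, Function.iterate_zero_apply]
    exact (hd.minimalPeriod_pos h0).ne' (hl.getElem_inj_iff.1 this)
  rw [Function.periodicOrbit_def, hmin]
  congr 1
  exact List.ext_getElem (by simp) fun i hi _ => by simp [hf i hi]

theorem periodicOrbit_congr {f g : α → α} (h : ∀ n, f^[n] d = g^[n] d) :
    Function.periodicOrbit f d = Function.periodicOrbit g d := by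
  have hmin : Function.minimalPeriod f d = Function.minimalPeriod g d :=
    Function.minimalPeriod_eq_minimalPeriod_iff.2 fun n => by
      rw [Function.IsPeriodicPt, Function.IsPeriodicPt, Function.IsFixedPt, Function.IsFixedPt, h]
  rw [Function.periodicOrbit_def, Function.periodicOrbit_def, hmin]
  simp only [h]

section FormPerm

variable [DecidableEq α]

theorem formPerm_apply_mem_iff_mem (hc : c.Nodup) : c.formPerm hc d ∈ c ↔ d ∈ c := by
  induction c using Quotient.inductionOn with
  | h l => exact List.formPerm_mem_iff_mem

theorem eq_periodicOrbit_formPerm (hc : c.Nodup) (hd : d ∈ c) :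
    c = Function.periodicOrbit (c.formPerm hc) d := by
  obtain ⟨l, rfl⟩ := exists_eq_coe_cons_of_mem hd
  have hl := Cycle.nodup_coe_iff.1 hc
  have hpow : ∀ n, ((d :: l).formPerm)^[n] d = (d :: l)[n % (d :: l).length]'(Nat.mod_lt _ (by
      simp)) := fun n => by
    rw [Equiv.Perm.iterate_eq_pow]
    have h := List.formPerm_pow_apply_getElem _ hl n 0 (by simp)
    simp only [Nat.zero_add] at h
    exact h
  change ((d :: l : List α) : Cycle α) = Function.periodicOrbit ((d :: l).formPerm) d
  refine coe_eq_periodicOrbit hl (fun i hi => ?_) ?_ (by simp)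
  · rw [hpow]
    simp only [Nat.mod_eq_of_lt hi]
  · rw [Function.IsPeriodicPt, Function.IsFixedPt, hpow]
    simp

theorem chain_iff_formPerm (r : α → α → Prop) (hc : c.Nodup) :
    c.Chain r ↔ ∀ x ∈ c, r x (c.formPerm hc x) := by
  rcases eq_or_ne c Cycle.nil with rfl | hne
  · simp
  obtain ⟨d, hd⟩ : ∃ d, d ∈ c := by
    induction c using Quotient.inductionOn with
    | h l => exact List.exists_mem_of_ne_nil l fun h => hne (congrArg _ h)
  have hper : d ∈ Function.periodicPts (c.formPerm hc) := by
    by_contra h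
    exact hne ((eq_periodicOrbit_formPerm hc hd).trans
      (Function.periodicOrbit_eq_nil_of_not_periodic_pt h))
  have hmem : ∀ x, x ∈ c ↔ ∃ n, (c.formPerm hc)^[n] d = x := fun x => by
    conv_lhs => rw [eq_periodicOrbit_formPerm hc hd]
    exact Function.mem_periodicOrbit_iff hper
  conv_lhs => rw [eq_periodicOrbit_formPerm hc hd]
  simp only [Function.periodicOrbit_chain' r hper, hmem, Function.iterate_succ_apply',
    forall_exists_index, forall_apply_eq_imp_iff]

end FormPerm

theorem eq_periodicOrbit_of_chain {f : α → α} (hc : c.Nodup) (hd : d ∈ c)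
    (hf : c.Chain fun a b => f a = b) : c = Function.periodicOrbit f d := by
  classical
  rw [chain_iff_formPerm _ hc] at hf
  have hiter : ∀ n, (c.formPerm hc)^[n] d ∈ c ∧ (c.formPerm hc)^[n] d = f^[n] d := by
    intro n
    induction n with
    | zero => exact ⟨hd, rfl⟩
    | succ n ih =>
      rw [Function.iterate_succ_apply', Function.iterate_succ_apply', ← ih.2, hf _ ih.1]
      exact ⟨(formPerm_apply_mem_iff_mem hc).2 ih.1, rfl⟩
  conv_lhs => rw [eq_periodicOrbit_formPerm hc hd]
  exact periodicOrbit_congr fun n => (hiter n).2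

theorem chain_reverse_iff (r : α → α → Prop) (hc : c.Nodup) :
    c.reverse.Chain r ↔ c.Chain fun a b => r b a := by
  classical
  rw [chain_iff_formPerm _ (Cycle.nodup_reverse_iff.2 hc), chain_iff_formPerm _ hc,
    Cycle.formPerm_reverse c hc]
  simp only [Cycle.mem_reverse_iff]
  constructor <;> intro h x hx
  · simpa using h _ ((formPerm_apply_mem_iff_mem hc).2 hx)
  · simpa using h ((c.formPerm hc)⁻¹ x) ((formPerm_apply_mem_iff_mem hc).1 (by simpa using hx))

end Cycles

/-! ## Eulerian tours as transition systems -/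

namespace Multigraph

section Darts

variable (G : Multigraph)

@[simp] theorem flip_flip (d : G.Dart) : G.flip (G.flip d) = d := by simp [flip]

theorem flip_ne (d : G.Dart) : G.flip d ≠ d := fun h => by
  simpa [flip] using congrArg Prod.snd h

theorem eq_or_eq_flip {d d' : G.Dart} (h : d.1 = d'.1) : d = d' ∨ d = G.flip d' := by
  obtain ⟨e, b⟩ := d
  obtain ⟨e', b'⟩ := d'
  obtain rfl : e = e' := h
  cases b <;> cases b' <;> simp [flip]

/-- `Multigraph.flip` as a permutation, to be conjugated by other permutations of the darts. -/
def flipPerm : Equiv.Perm G.Dart := Function.Involutive.toPerm G.flip G.flip_flip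

@[simp] theorem flipPerm_apply (d : G.Dart) : G.flipPerm d = G.flip d := rfl

/-- The transition systems: at each vertex a perfect matching of the half-edges. -/
def transitions : Finset (Equiv.Perm G.Dart) := fiberInvolutions G.src Finset.univ

end Darts

variable {G : Multigraph} {τ : Equiv.Perm G.Dart} {c : Cycle G.Dart} {d : G.Dart}

theorem mem_transitions :
    τ ∈ G.transitions ↔ (∀ d, τ (τ d) = d) ∧ (∀ d, τ d ≠ d) ∧ ∀ d, G.src (τ d) = G.src d := by
  simp [transitions, mem_fiberInvolutions]

/-- Two edges are linked if they follow each other in a circuit of the transition system. -/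
def EdgeLink (τ : Equiv.Perm G.Dart) (e e' : Fin G.numEdges) : Prop :=
  ∃ d : G.Dart, d.1 = e ∧ (τ d).1 = e'

/-- All edges lie on one circuit of the transition system. -/
def SingleCircuit (τ : Equiv.Perm G.Dart) : Prop :=
  ∀ e e', Relation.EqvGen (EdgeLink τ) e e'

/-- The dart that follows `d` on its circuit. -/
def follow (τ : Equiv.Perm G.Dart) (d : G.Dart) : G.Dart := τ (G.flip d)

theorem follow_injective (τ : Equiv.Perm G.Dart) : Function.Injective (follow τ) :=
  τ.injective.comp G.flipPerm.injective

theorem mem_periodicPts_follow (τ : Equiv.Perm G.Dart) (d : G.Dart) :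
    d ∈ Function.periodicPts (follow τ) := (follow_injective τ).mem_periodicPts d

theorem isDirectedTour_iff :
    G.IsDirectedTour c ↔ c.Chain (fun d d' => G.tgt d = G.src d') ∧ c.Nodup ∧
      ∀ d, d ∈ c ↔ G.flip d ∉ c := by
  refine and_congr_right fun _ => ?_
  induction c using Quotient.inductionOn with
  | h l =>
  change (∀ e, Multiset.count e ((l : Multiset G.Dart).map Prod.fst) = 1) ↔
    l.Nodup ∧ ∀ d, d ∈ l ↔ G.flip d ∉ l
  rw [Multiset.map_coe]
  constructor
  · intro h
    have hnodup : (l.map Prod.fst).Nodup :=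
      Multiset.coe_nodup.1 (Multiset.nodup_iff_count_le_one.2 fun e => (h e).le)
    refine ⟨hnodup.of_map _, fun d => ⟨fun hd hd' => ?_, fun hd' => ?_⟩⟩
    · exact G.flip_ne d (List.inj_on_of_nodup_map hnodup hd' hd rfl)
    · have hmem : d.1 ∈ l.map Prod.fst :=
        Multiset.mem_coe.1 (Multiset.count_pos.1 ((h d.1).symm ▸ zero_lt_one))
      obtain ⟨d', hd, he⟩ := List.mem_map.1 hmem
      rcases G.eq_or_eq_flip he with rfl | rfl
      · exact hd
      · exact absurd hd hd'
  · rintro ⟨hnodup, hflip⟩ e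
    refine Multiset.count_eq_one_of_mem (Multiset.coe_nodup.2 (hnodup.map_on ?_)) ?_
    · intro x hx y hy hxy
      refine (G.eq_or_eq_flip hxy).resolve_right ?_
      rintro rfl
      exact (hflip y).1 hy hx
    · by_cases he : (e, false) ∈ l
      · exact Multiset.mem_coe.2 (List.mem_map.2 ⟨_, he, rfl⟩)
      · exact Multiset.mem_coe.2 (List.mem_map.2
          ⟨(e, true), (hflip _).2 he, rfl⟩)

theorem IsDirectedTour.nodup (h : G.IsDirectedTour c) : c.Nodup := (isDirectedTour_iff.1 h).2.1

theorem IsDirectedTour.mem_iff_flip_notMem (h : G.IsDirectedTour c) (d : G.Dart) :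
    d ∈ c ↔ G.flip d ∉ c := (isDirectedTour_iff.1 h).2.2 d

theorem IsDirectedTour.flip_mem_iff_notMem (h : G.IsDirectedTour c) (d : G.Dart) :
    G.flip d ∈ c ↔ d ∉ c := by
  rw [h.mem_iff_flip_notMem, flip_flip]

/-- The transition system of a tour. Since the successor permutation of the tour fixes the darts
that are travelled backwards, conjugating `flip` with it pairs the end of each dart of the tour
with the start of the next one. -/
def IsDirectedTour.transition (h : G.IsDirectedTour c) : Equiv.Perm G.Dart :=
  c.formPerm h.nodup * G.flipPerm * (c.formPerm h.nodup)⁻¹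

theorem IsDirectedTour.transition_formPerm (h : G.IsDirectedTour c) (d : G.Dart) :
    h.transition (c.formPerm h.nodup d) = c.formPerm h.nodup (G.flip d) := by
  simp [transition]

theorem IsDirectedTour.formPerm_flip (h : G.IsDirectedTour c) (hd : d ∈ c) :
    c.formPerm h.nodup (G.flip d) = G.flip d :=
  Cycle.formPerm_eq_self_of_notMem _ _ _ ((h.mem_iff_flip_notMem d).1 hd)

theorem IsDirectedTour.follow_transition (h : G.IsDirectedTour c) (hd : d ∈ c) :
    follow h.transition d = c.formPerm h.nodup d := by
  rw [follow, ← h.formPerm_flip hd, h.transition_formPerm, flip_flip]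

theorem IsDirectedTour.chain_follow_transition (h : G.IsDirectedTour c) :
    c.Chain fun d d' => follow h.transition d = d' :=
  (chain_iff_formPerm _ h.nodup).2 fun _ hd => h.follow_transition hd

theorem IsDirectedTour.src_formPerm_flip (h : G.IsDirectedTour c) (d : G.Dart) :
    G.src (c.formPerm h.nodup (G.flip d)) = G.src (c.formPerm h.nodup d) := by
  have hsucc := (chain_iff_formPerm _ h.nodup).1 h.1
  by_cases hd : d ∈ c
  · rw [h.formPerm_flip hd, ← hsucc d hd, tgt]
  · have hd' := (h.flip_mem_iff_notMem d).2 hd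
    rw [← hsucc _ hd', tgt, flip_flip, Cycle.formPerm_eq_self_of_notMem _ _ _ hd]

theorem IsDirectedTour.transition_mem (h : G.IsDirectedTour c) :
    h.transition ∈ G.transitions := by
  have hsurj : ∀ d, ∃ x, c.formPerm h.nodup x = d := (c.formPerm h.nodup).surjective
  refine mem_transitions.2 ⟨fun d => ?_, fun d => ?_, fun d => ?_⟩ <;>
    obtain ⟨x, rfl⟩ := hsurj d <;> rw [h.transition_formPerm]
  · rw [h.transition_formPerm, flip_flip]
  · exact fun hx => G.flip_ne x ((c.formPerm h.nodup).injective hx)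
  · exact h.src_formPerm_flip x

theorem IsDirectedTour.singleCircuit_transition (h : G.IsDirectedTour c) :
    SingleCircuit h.transition := by
  have hcover : ∀ e, ∃ d ∈ c, d.1 = e := fun e => by
    by_cases he : (e, false) ∈ c
    · exact ⟨_, he, rfl⟩
    · exact ⟨_, (h.flip_mem_iff_notMem _).2 he, rfl⟩
  intro e e'
  obtain ⟨d, hd, rfl⟩ := hcover e
  obtain ⟨d', hd', rfl⟩ := hcover e'
  rw [eq_periodicOrbit_of_chain h.nodup hd h.chain_follow_transition,
    Function.mem_periodicOrbit_iff (mem_periodicPts_follow _ _)] at hd'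
  obtain ⟨n, rfl⟩ := hd'
  clear hd
  induction n with
  | zero => exact Relation.EqvGen.refl _
  | succ n ih =>
    rw [Function.iterate_succ_apply']
    exact ih.trans _ _ _ (Relation.EqvGen.rel _ _ ⟨G.flip _, rfl, rfl⟩)

theorem IsDirectedTour.eq_transition (h : G.IsDirectedTour c) (hτ : τ ∈ G.transitions)
    (hc : c.Chain fun d d' => follow τ d = d') : τ = h.transition := by
  rw [chain_iff_formPerm _ h.nodup] at hc
  ext1 d
  obtain ⟨x, rfl⟩ := (c.formPerm h.nodup).surjective d
  rw [h.transition_formPerm]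
  by_cases hx : x ∈ c
  · rw [h.formPerm_flip hx, ← hc x hx, follow, (mem_transitions.1 hτ).1]
  · rw [← hc _ ((h.flip_mem_iff_notMem x).2 hx), Cycle.formPerm_eq_self_of_notMem _ _ _ hx, follow,
      flip_flip]

theorem mem_reverseTour : d ∈ G.reverseTour c ↔ G.flip d ∈ c := by
  rw [reverseTour, Cycle.mem_reverse_iff, Cycle.mem_map]
  exact ⟨by rintro ⟨x, hx, rfl⟩; simpa using hx, fun h => ⟨_, h, G.flip_flip d⟩⟩

theorem nodup_map_flip (h : c.Nodup) : (c.map G.flip).Nodup := by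
  induction c using Quotient.inductionOn with
  | h l => exact List.Nodup.map G.flipPerm.injective h

theorem nodup_reverseTour (h : c.Nodup) : (G.reverseTour c).Nodup :=
  Cycle.nodup_reverse_iff.2 (nodup_map_flip h)

theorem chain_follow_reverseTour (hτ : τ ∈ G.transitions) (hn : c.Nodup)
    (hc : c.Chain fun d d' => follow τ d = d') :
    (G.reverseTour c).Chain fun d d' => follow τ d = d' := by
  rw [reverseTour, chain_reverse_iff _ (nodup_map_flip hn), Cycle.chain_map]
  refine hc.imp ?_
  rintro d d' rfl
  simp [follow, (mem_transitions.1 hτ).1]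

theorem IsDirectedTour.eq_periodicOrbit_or_reverseTour_eq (h : G.IsDirectedTour c) (d : G.Dart) :
    c = Function.periodicOrbit (follow h.transition) d ∨
      G.reverseTour c = Function.periodicOrbit (follow h.transition) d := by
  have hchain := h.chain_follow_transition
  by_cases hd : d ∈ c
  · exact Or.inl (eq_periodicOrbit_of_chain h.nodup hd hchain)
  · exact Or.inr (eq_periodicOrbit_of_chain (nodup_reverseTour h.nodup)
      (mem_reverseTour.2 ((h.flip_mem_iff_notMem d).2 hd))
      (chain_follow_reverseTour h.transition_mem h.nodup hchain))

theorem iterate_follow_ne_flip (hτ : τ ∈ G.transitions) (n : ℕ) :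
    ∀ d : G.Dart, (follow τ)^[n] d ≠ G.flip d := by
  obtain ⟨hinv, hne, -⟩ := mem_transitions.1 hτ
  induction n using Nat.strong_induction_on with
  | _ n ih =>
  intro d hd
  match n with
  | 0 => exact G.flip_ne d hd.symm
  | 1 => exact hne _ hd
  | n + 2 =>
    refine ih n (by omega) (follow τ d) ?_
    rw [Function.iterate_succ_apply', Function.iterate_succ_apply] at hd
    rw [← G.flip_flip ((follow τ)^[n] (follow τ d)),
      ← hinv (G.flip ((follow τ)^[n] (follow τ d)))]
    exact congrArg (fun x => G.flip (τ x)) hd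

theorem flip_notMem_periodicOrbit (hτ : τ ∈ G.transitions)
    {d₀ : G.Dart} (hd : d ∈ Function.periodicOrbit (follow τ) d₀) :
    G.flip d ∉ Function.periodicOrbit (follow τ) d₀ := by
  have hper := mem_periodicPts_follow τ
  obtain ⟨n, rfl⟩ := (Function.mem_periodicOrbit_iff (hper d₀)).1 hd
  rw [← Function.periodicOrbit_apply_iterate_eq (hper d₀) n,
    Function.mem_periodicOrbit_iff (hper _)]
  rintro ⟨m, hm⟩
  exact iterate_follow_ne_flip hτ m _ hm

theorem eqvGen_iff_of_forall {α : Type*} {r : α → α → Prop} {p : α → Prop}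
    (hp : ∀ a b, r a b → (p a ↔ p b)) {a b : α} (h : Relation.EqvGen r a b) : p a ↔ p b :=
  iff_of_eq (congrArg (Quot.lift p fun a b hab => propext (hp a b hab)) (Quot.eqvGen_sound h))

theorem exists_mem_periodicOrbit_of_edgeLink (hτ : τ ∈ G.transitions) {e e' : Fin G.numEdges}
    (h : EdgeLink τ e e') (he : ∃ x ∈ Function.periodicOrbit (follow τ) d, x.1 = e) :
    ∃ x ∈ Function.periodicOrbit (follow τ) d, x.1 = e' := by
  have hper := mem_periodicPts_follow τ
  obtain ⟨z, rfl, rfl⟩ := h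
  obtain ⟨x, hx, hxz⟩ := he
  rcases G.eq_or_eq_flip hxz.symm with rfl | rfl
  · rw [← Function.periodicOrbit_apply_eq (hper d)] at hx
    obtain ⟨n, rfl⟩ := (Function.mem_periodicOrbit_iff (hper _)).1 hx
    refine ⟨(follow τ)^[n] d, Function.iterate_mem_periodicOrbit (hper d) n, ?_⟩
    rw [← Function.iterate_succ_apply, Function.iterate_succ_apply', follow,
      (mem_transitions.1 hτ).1]
    rfl
  · obtain ⟨n, rfl⟩ := (Function.mem_periodicOrbit_iff (hper d)).1 hx
    refine ⟨_, Function.iterate_mem_periodicOrbit (hper d) (n + 1), ?_⟩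
    rw [Function.iterate_succ_apply', follow]

theorem isDirectedTour_periodicOrbit (hτ : τ ∈ G.transitions) (hs : SingleCircuit τ)
    (d : G.Dart) : G.IsDirectedTour (Function.periodicOrbit (follow τ) d) := by
  obtain ⟨hinv, -, hsrc⟩ := mem_transitions.1 hτ
  have hper := mem_periodicPts_follow τ
  have hcover : ∀ e, ∃ x ∈ Function.periodicOrbit (follow τ) d, x.1 = e := by
    have hlink : ∀ e e', EdgeLink τ e e' → ((∃ x ∈ Function.periodicOrbit (follow τ) d, x.1 = e) ↔
        ∃ x ∈ Function.periodicOrbit (follow τ) d, x.1 = e') := by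
      rintro e e' ⟨z, hz, hz'⟩
      exact ⟨exists_mem_periodicOrbit_of_edgeLink hτ ⟨z, hz, hz'⟩,
        exists_mem_periodicOrbit_of_edgeLink hτ ⟨τ z, hz', by rw [hinv, hz]⟩⟩
    exact fun e => (eqvGen_iff_of_forall hlink (hs d.1 e)).1
      ⟨d, Function.self_mem_periodicOrbit (hper d), rfl⟩
  refine isDirectedTour_iff.2 ⟨?_, Function.nodup_periodicOrbit, fun x =>
    ⟨flip_notMem_periodicOrbit hτ, fun hx => ?_⟩⟩
  · rw [Function.periodicOrbit_chain' _ (hper d)]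
    intro n
    rw [Function.iterate_succ_apply', follow, hsrc, tgt]
  · obtain ⟨y, hy, hyx⟩ := hcover x.1
    rcases G.eq_or_eq_flip hyx with rfl | rfl
    · exact hy
    · exact absurd hy hx

theorem IsDirectedTour.tourSetoid_iff {c' : Cycle G.Dart} (h : G.IsDirectedTour c)
    (h' : G.IsDirectedTour c') (d : G.Dart) :
    G.tourSetoid ⟨c, h⟩ ⟨c', h'⟩ ↔ h.transition = h'.transition := by
  constructor
  · rintro (hc | hc)
    · obtain rfl : c = c' := hc
      rfl
    · obtain rfl : c = G.reverseTour c' := hc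
      exact (h.eq_transition h'.transition_mem
        (chain_follow_reverseTour h'.transition_mem h'.nodup h'.chain_follow_transition)).symm
  · intro ht
    change c = c' ∨ c = G.reverseTour c'
    have hc := h.eq_periodicOrbit_or_reverseTour_eq d
    rw [ht] at hc
    rcases hc with hc | hc <;> rcases h'.eq_periodicOrbit_or_reverseTour_eq d with hc' | hc'
    · exact Or.inl (hc.trans hc'.symm)
    · exact Or.inr (hc.trans hc'.symm)
    · exact Or.inr (by rw [hc', ← hc, reverseTour_reverseTour])
    · exact Or.inl (by
        rw [← reverseTour_reverseTour G c, hc, ← hc', reverseTour_reverseTour])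

open Classical in
theorem numEulerianTours_eq_card_transitions (e₀ : Fin G.numEdges) :
    G.numEulerianTours = (G.transitions.filter SingleCircuit).card := by
  let F : Quotient G.tourSetoid → (G.transitions.filter SingleCircuit : Finset _) :=
    Quotient.lift (fun c => ⟨c.2.transition, Finset.mem_filter.2
      ⟨c.2.transition_mem, c.2.singleCircuit_transition⟩⟩)
      fun c c' h => Subtype.ext ((c.2.tourSetoid_iff c'.2 (e₀, false)).1 h)
  have hinj : Function.Injective F := fun q q' => Quotient.inductionOn₂ q q' fun c c' h =>
    Quotient.sound ((c.2.tourSetoid_iff c'.2 (e₀, false)).2 (congrArg Subtype.val h))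
  have hsurj : Function.Surjective F := by
    rintro ⟨τ, hτ⟩
    obtain ⟨hτ, hs⟩ := Finset.mem_filter.1 hτ
    have htour := isDirectedTour_periodicOrbit hτ hs (e₀, false)
    refine ⟨Quotient.mk _ ⟨_, htour⟩, Subtype.ext (htour.eq_transition hτ ?_).symm⟩
    rw [Function.periodicOrbit_chain' _ (mem_periodicPts_follow τ _)]
    exact fun n => (Function.iterate_succ_apply' ..).symm
  rw [numEulerianTours, Nat.card_eq_of_bijective F ⟨hinj, hsurj⟩, Nat.card_eq_fintype_card,
    Fintype.card_coe]

theorem numEulerianTours_of_numEdges_eq_zero (hE : G.numEdges = 0) : G.numEulerianTours = 1 := by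
  have : IsEmpty (Fin G.numEdges) := hE ▸ Fin.isEmpty
  have hnil : ∀ c : Cycle G.Dart, c = Cycle.nil := fun c => by
    induction c using Quotient.inductionOn with
    | h l =>
      cases l with
      | nil => rfl
      | cons d _ => exact isEmptyElim d.1
  have : Unique (Quotient G.tourSetoid) :=
    { default := Quotient.mk _ ⟨Cycle.nil, Cycle.Chain.nil _, isEmptyElim⟩
      uniq := fun q => Quotient.inductionOn q fun c =>
        congrArg _ (Subtype.ext (hnil c.1)) }
  exact Nat.card_unique

theorem numEulerianTours_le_factorial (G : Multigraph) :
    G.numEulerianTours ≤ (G.numEdges * 2).factorial := by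
  classical
  rcases isEmpty_or_nonempty (Fin G.numEdges) with h | ⟨⟨e₀⟩⟩
  · have hE : G.numEdges = 0 := by_contra fun hE => h.false ⟨0, Nat.pos_of_ne_zero hE⟩
    rw [numEulerianTours_of_numEdges_eq_zero hE]
    exact Nat.factorial_pos _
  · rw [numEulerianTours_eq_card_transitions e₀]
    refine (Finset.card_le_univ _).trans ?_
    rw [Fintype.card_perm]
    simp

end Multigraph

/-! ## Counting tours by edge colourings -/

section RootedColorings

variable {E X : Type*} [Fintype E] [Fintype X]

open Classical in
theorem card_rooted_invariant_functions (r : E → E → Prop) [Fintype (Quot r)]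
    (e₀ : E) (x₀ : X) :
    (Finset.univ.filter fun col : E → X => col e₀ = x₀ ∧ ∀ a b, r a b → col b = col a).card =
      Fintype.card X ^ (Fintype.card (Quot r) - 1) := by
  rw [← Finset.card_univ (α := X), ← Fintype.card_filter_piFinset_const_eq_of_mem Finset.univ
    (Quot.mk r e₀) (Finset.mem_univ x₀), Fintype.piFinset_univ]
  symm
  refine Finset.card_bij (fun g _ => g ∘ Quot.mk r) (fun g hg => ?_) (fun g _ g' _ h => ?_)
    fun col hcol => ?_
  · exact Finset.mem_filter.2 ⟨Finset.mem_univ _, (Finset.mem_filter.1 hg).2,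
      fun a b h => congrArg g (Quot.sound h).symm⟩
  · exact Quot.mk_surjective.injective_comp_right h
  · obtain ⟨-, h₀, hr⟩ := Finset.mem_filter.1 hcol
    exact ⟨Quot.lift col fun a b h => (hr a b h).symm,
      Finset.mem_filter.2 ⟨Finset.mem_univ _, h₀⟩, rfl⟩

open Classical in
theorem cast_card_rooted_invariant_functions {R : Type*} [CommSemiring R]
    (hX : (Fintype.card X : R) = 0) (r : E → E → Prop) [Decidable (∀ a b, Relation.EqvGen r a b)]
    (e₀ : E) (x₀ : X) :
    ((Finset.univ.filter fun col : E → X =>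
      col e₀ = x₀ ∧ ∀ a b, r a b → col b = col a).card : R) =
      if ∀ a b, Relation.EqvGen r a b then 1 else 0 := by
  have hiff : (∀ a b, Relation.EqvGen r a b) ↔ Subsingleton (Quot r) :=
    ⟨fun h => ⟨fun p q => Quot.induction_on₂ p q fun a b => Quot.eqvGen_sound (h a b)⟩,
      fun _ a b => Quot.eqvGen_exact (Subsingleton.elim (Quot.mk r a) (Quot.mk r b))⟩
  have : Fintype (Quot r) := Fintype.ofFinite _
  rw [card_rooted_invariant_functions, Nat.cast_pow, hX, zero_pow_eq]
  refine if_congr ?_ rfl rfl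
  rw [hiff, ← Fintype.card_le_one_iff_subsingleton, Nat.sub_eq_zero_iff_le]

end RootedColorings

namespace Multigraph

variable {G : Multigraph} {N : ℕ} [NeZero N] {R : Type*} [CommSemiring R]

theorem fiberInvolutions_src_coloring {C : Type*} [DecidableEq C] (col : Fin G.numEdges → C) :
    fiberInvolutions (fun d : G.Dart => ((G.src d : ℕ), col d.1)) Finset.univ =
      G.transitions.filter fun τ => ∀ d : G.Dart, col (τ d).1 = col d.1 := by
  ext τ
  simp only [mem_fiberInvolutions, Finset.mem_filter, transitions, Prod.mk.injEq, Fin.val_inj,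
    forall_and, and_assoc]

theorem forall_edgeLink_iff {C : Type*} {τ : Equiv.Perm G.Dart} {col : Fin G.numEdges → C} :
    (∀ e e', EdgeLink τ e e' → col e' = col e) ↔ ∀ d : G.Dart, col (τ d).1 = col d.1 :=
  ⟨fun h d => h _ _ ⟨d, rfl, rfl⟩, by rintro h _ _ ⟨d, rfl, rfl⟩; exact h d⟩

theorem cast_numEulerianTours (hN : (N : R) = 0) (e₀ : Fin G.numEdges) :
    (G.numEulerianTours : R) = ∑ col : Fin G.numEdges → Fin N with col e₀ = 0,
      (matchCount ((Finset.univ : Finset G.Dart).val.map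
        fun d => ((G.src d : ℕ), col d.1)) : R) := by
  classical
  have hcount : ∀ τ : Equiv.Perm G.Dart,
      ∑ col : Fin G.numEdges → Fin N with col e₀ = 0,
        (if ∀ d : G.Dart, col (τ d).1 = col d.1 then 1 else 0 : R) =
          if SingleCircuit τ then 1 else 0 := fun τ => by
    have h := cast_card_rooted_invariant_functions (X := Fin N) (by simpa using hN)
      (EdgeLink τ) e₀ 0
    simp only [forall_edgeLink_iff] at h
    rw [Finset.sum_boole, Finset.filter_filter]
    convert h
    exact Iff.rfl
  simp only [← card_fiberInvolutions, fiberInvolutions_src_coloring]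
  rw [numEulerianTours_eq_card_transitions e₀, ← Finset.sum_boole]
  simp only [← Finset.sum_boole, ← hcount]
  exact Finset.sum_comm

end Multigraph
/-! ## Partition functions of coloured multigraphs with legs -/

section Partition

variable {N : ℕ} (R : Type*) [CommSemiring R]

/-- The sum over the colourings of the edges `es` of the number of matchings, at each vertex, of
the incident ends of equal colour; `ℓ` lists the coloured legs. -/
def partFn : List (ℕ × ℕ) → Multiset (ℕ × Fin N) → R
  | [], ℓ => (matchCount ℓ : R)
  | e :: es, ℓ => ∑ a, partFn es ((e.1, a) ::ₘ (e.2, a) ::ₘ ℓ)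

theorem partFn_append_cons (es fs : List (ℕ × ℕ)) (ℓ : Multiset (ℕ × Fin N)) (e : ℕ × ℕ) :
    partFn R (es ++ e :: fs) ℓ = ∑ a, partFn R (es ++ fs) ((e.1, a) ::ₘ (e.2, a) ::ₘ ℓ) := by
  induction es generalizing ℓ with
  | nil => rfl
  | cons f es ih =>
    simp only [List.cons_append, partFn, ih]
    rw [Finset.sum_comm]
    refine Finset.sum_congr rfl fun a _ => Finset.sum_congr rfl fun b _ => ?_
    congr 1
    simp only [← Multiset.singleton_add]
    abel

theorem partFn_concat (es : List (ℕ × ℕ)) (ℓ : Multiset (ℕ × Fin N)) (e : ℕ × ℕ) :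
    partFn R (es ++ [e]) ℓ = ∑ a, partFn R es ((e.1, a) ::ₘ (e.2, a) ::ₘ ℓ) := by
  rw [partFn_append_cons, List.append_nil]

/-- The legs that arise by cutting coloured edges. -/
def cutLegs {m : ℕ} (g : Fin m → ℕ × ℕ) (col : Fin m → Fin N) : Multiset (ℕ × Fin N) :=
  ∑ i, {((g i).1, col i), ((g i).2, col i)}

theorem partFn_ofFn {m : ℕ} (g : Fin m → ℕ × ℕ) (ℓ : Multiset (ℕ × Fin N)) :
    partFn R (List.ofFn g) ℓ = ∑ col : Fin m → Fin N, (matchCount (cutLegs g col + ℓ) : R) := by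
  induction m generalizing ℓ with
  | zero => simp [partFn, cutLegs]
  | succ m ih =>
    rw [List.ofFn_succ, partFn]
    simp only [ih]
    rw [← (Fin.consEquiv fun _ => Fin N).sum_comp, Fintype.sum_prod_type]
    refine Finset.sum_congr rfl fun a _ => Finset.sum_congr rfl fun col _ => ?_
    congr 2
    simp only [cutLegs, Fin.sum_univ_succ, Fin.consEquiv_apply, Fin.cons_zero, Fin.cons_succ,
      Multiset.insert_eq_cons, ← Multiset.singleton_add]
    abel

theorem map_univ_prod_bool {ι α : Type*} [Fintype ι] (f : ι × Bool → α) :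
    (Finset.univ : Finset (ι × Bool)).val.map f = ∑ i, {f (i, false), f (i, true)} := by
  rw [← Multiset.sum_map_singleton (Multiset.map f _), Multiset.map_map]
  change ∑ d : ι × Bool, ({f d} : Multiset α) = _
  rw [Fintype.sum_prod_type]
  refine Finset.sum_congr rfl fun i _ => ?_
  rw [Fintype.sum_bool, add_comm]
  rfl

end Partition

section Below

/-- Both ends of every edge are smaller than `n`, so `n` is a fresh vertex. -/
def EdgesBelow (n : ℕ) (es : List (ℕ × ℕ)) : Prop := ∀ e ∈ es, e.1 < n ∧ e.2 < n

/-- Every leg is attached to a vertex smaller than `n`, so `n` is a fresh vertex. -/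
def LegsBelow {α : Type*} (n : ℕ) (ℓ : Multiset (ℕ × α)) : Prop := ∀ x ∈ ℓ, x.1 < n

@[simp] theorem edgesBelow_nil (n : ℕ) : EdgesBelow n [] := by simp [EdgesBelow]

@[simp] theorem edgesBelow_cons {n : ℕ} {e : ℕ × ℕ} {es : List (ℕ × ℕ)} :
    EdgesBelow n (e :: es) ↔ (e.1 < n ∧ e.2 < n) ∧ EdgesBelow n es := List.forall_mem_cons

@[simp] theorem edgesBelow_append {n : ℕ} {es fs : List (ℕ × ℕ)} :
    EdgesBelow n (es ++ fs) ↔ EdgesBelow n es ∧ EdgesBelow n fs := List.forall_mem_append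

theorem EdgesBelow.mono {m n : ℕ} {es : List (ℕ × ℕ)} (h : EdgesBelow m es) (hmn : m ≤ n) :
    EdgesBelow n es := fun e he => (h e he).imp hmn.trans_lt' hmn.trans_lt'

@[simp] theorem legsBelow_cons {α : Type*} {n : ℕ} {x : ℕ × α} {ℓ : Multiset (ℕ × α)} :
    LegsBelow n (x ::ₘ ℓ) ↔ x.1 < n ∧ LegsBelow n ℓ := Multiset.forall_mem_cons

theorem LegsBelow.mono {α : Type*} {m n : ℕ} {ℓ : Multiset (ℕ × α)} (h : LegsBelow m ℓ)
    (hmn : m ≤ n) : LegsBelow n ℓ := fun x hx => (h x hx).trans_le hmn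

end Below
/-! ## The chain and ladder gadgets -/

section Tensors

variable {N : ℕ} {R : Type*} [CommSemiring R]

/-- The identity tensor. -/
def delta (R : Type*) [CommSemiring R] (a b : Fin N) : R := if a = b then 1 else 0

theorem delta_comm (a b : Fin N) : delta R a b = delta R b a := by
  simp only [delta, eq_comm]

@[simp] theorem delta_self (a : Fin N) : delta R a a = 1 := by simp [delta]

theorem sum_delta_mul (a : Fin N) (f : Fin N → R) : ∑ x, delta R a x * f x = f a := by
  simp [delta]

theorem sum_delta_mul' (a : Fin N) (f : Fin N → R) : ∑ x, delta R x a * f x = f a := by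
  simp [delta]

theorem sum_const_eq_zero (hN : (N : R) = 0) (r : R) : ∑ _x : Fin N, r = 0 := by
  simp [hN]

/-- The tensor of a vertex of degree `4` at which the three transitions have the weights `1`, `1`
and `κ`. -/
def boxTensor (κ : R) (a b c d : Fin N) : R :=
  delta R a c * delta R b d + delta R a d * delta R b c + κ * (delta R a b * delta R c d)

/-- `w` boxes in a row, each attached to the next one with a twist. -/
def ladderTensor (κ : R) : ℕ → Fin N → Fin N → Fin N → Fin N → R
  | 0, a, c, d, b => delta R a d * delta R b c
  | w + 1, a, c, d, b => ∑ x, ∑ y, ladderTensor κ w a c x y * boxTensor κ x b y d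

theorem sum_boxTensor_mul_boxTensor_one (hN : (N : R) = 0) (κ : R) (a b c d : Fin N) :
    ∑ x, ∑ y, boxTensor κ a b x y * boxTensor 1 x y c d = 2 * boxTensor (κ + 1) a b c d := by
  have hexpand : ∀ x y, boxTensor κ a b x y * boxTensor 1 x y c d =
      delta R a x * (delta R b y * boxTensor 1 x y c d) +
      delta R b x * (delta R a y * boxTensor 1 x y c d) +
      κ * delta R a b * (delta R x y * boxTensor 1 x y c d) := fun x y => by
    rw [boxTensor]; ring
  have hdiag : ∀ x : Fin N, boxTensor 1 x x c d =
      2 * (delta R x c * delta R x d) + delta R c d := fun x => by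
    rw [boxTensor, delta_self]; ring
  simp only [hexpand, hdiag, Finset.sum_add_distrib, ← Finset.mul_sum, sum_delta_mul,
    sum_delta_mul', sum_const_eq_zero hN]
  simp only [boxTensor, delta_comm b a]
  ring

theorem ladderTensor_one (κ : R) (a c d b : Fin N) :
    ladderTensor κ 1 a c d b = boxTensor κ a b c d := by
  simp only [ladderTensor, mul_assoc, ← Finset.mul_sum, sum_delta_mul, sum_delta_mul']

theorem ladderTensor_zero (hN : (N : R) = 0) (w : ℕ) (a c d b : Fin N) :
    ladderTensor (0 : R) w a c d b =
      delta R a d * delta R b c + w * (delta R a c * delta R b d) := by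
  induction w generalizing d b with
  | zero => simp [ladderTensor]
  | succ w ih =>
    have hexpand : ∀ x y, ladderTensor (0 : R) w a c x y * boxTensor 0 x b y d =
        delta R a x * (delta R y c * boxTensor 0 x b y d) +
        w * delta R a c * (delta R y x * boxTensor 0 x b y d) := fun x y => by
      rw [ih]; ring
    have hdiag : ∀ x : Fin N, boxTensor (0 : R) x b x d =
        delta R b d + delta R x d * delta R b x := fun x => by
      rw [boxTensor, delta_self]; ring
    rw [ladderTensor]
    simp only [hexpand, hdiag, Finset.sum_add_distrib, ← Finset.mul_sum, sum_delta_mul,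
      sum_delta_mul', sum_const_eq_zero hN]
    simp only [boxTensor]
    push_cast
    ring

theorem exists_polynomial_ladderTensor (w : ℕ) (a c d b : Fin N) :
    ∃ p : Polynomial R, p.natDegree ≤ w ∧ ∀ κ, ladderTensor κ w a c d b = p.eval κ := by
  induction w generalizing d b with
  | zero =>
    exact ⟨Polynomial.C (delta R a d * delta R b c), (Polynomial.natDegree_C _).le,
      fun κ => by simp [ladderTensor]⟩
  | succ w ih =>
    choose p hp hp' using ih
    let box (x y : Fin N) : Polynomial R :=
      Polynomial.C (delta R x b * delta R y d) * Polynomial.X +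
        Polynomial.C (delta R x y * delta R b d + delta R x d * delta R b y)
    refine ⟨∑ x, ∑ y, p x y * box x y, ?_, fun κ => ?_⟩
    · exact Polynomial.natDegree_sum_le_of_forall_le _ _ fun x _ =>
        Polynomial.natDegree_sum_le_of_forall_le _ _ fun y _ =>
          Polynomial.natDegree_mul_le_of_le (hp x y) Polynomial.natDegree_linear_le
    · have hbox : ∀ x y, boxTensor κ x b y d = (box x y).eval κ := fun x y => by
        simp only [box, boxTensor, Polynomial.eval_add, Polynomial.eval_mul, Polynomial.eval_C,
          Polynomial.eval_X]
        ring
      simp only [ladderTensor, Polynomial.eval_finsetSum, Polynomial.eval_mul, ← hp', hbox]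

theorem matchCount_four_cons (n : ℕ) (a b c d : Fin N) {ℓ : Multiset (ℕ × Fin N)}
    (hℓ : LegsBelow n ℓ) :
    (matchCount ((n, a) ::ₘ (n, b) ::ₘ (n, c) ::ₘ (n, d) ::ₘ ℓ) : R) =
      boxTensor 1 a b c d * matchCount ℓ := by
  have hdisj : Disjoint (({a, b, c, d} : Multiset (Fin N)).map (Prod.mk n)) ℓ :=
    Multiset.disjoint_left.2 fun {x} hx hx' => by
      obtain ⟨y, -, rfl⟩ := Multiset.mem_map.1 hx
      exact lt_irrefl _ (hℓ _ hx')
  have h := matchCount_add_of_disjoint hdisj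
  rw [matchCount_map (Prod.mk_right_injective n), matchCount_four] at h
  simp only [Multiset.insert_eq_cons, Multiset.map_cons, Multiset.map_singleton,
    Multiset.cons_add, Multiset.singleton_add] at h
  rw [h]
  simp only [boxTensor, delta, ite_zero_mul_ite_zero, mul_one, one_mul]
  push_cast
  rfl

theorem partFn_four_legs {n : ℕ} (a b c d : Fin N) {es : List (ℕ × ℕ)}
    {ℓ : Multiset (ℕ × Fin N)} (hes : EdgesBelow n es) (hℓ : LegsBelow n ℓ) :
    partFn R es ((n, a) ::ₘ (n, b) ::ₘ (n, c) ::ₘ (n, d) ::ₘ ℓ) =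
      boxTensor 1 a b c d * partFn R es ℓ := by
  induction es generalizing ℓ with
  | nil => exact matchCount_four_cons n a b c d hℓ
  | cons e es ih =>
    obtain ⟨he, hes⟩ := edgesBelow_cons.1 hes
    rw [partFn, partFn, Finset.mul_sum]
    refine Finset.sum_congr rfl fun x _ => ?_
    rw [← ih hes (legsBelow_cons.2 ⟨he.1, legsBelow_cons.2 ⟨he.2, hℓ⟩⟩)]
    congr 1
    simp only [← Multiset.singleton_add]
    abel

/-- Double edges between the consecutive vertices `n, …, n + j`. -/
def chainEdges (n : ℕ) : ℕ → List (ℕ × ℕ)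
  | 0 => []
  | j + 1 => chainEdges n j ++ [(n + j, n + j + 1), (n + j, n + j + 1)]

theorem edgesBelow_chainEdges (n j : ℕ) : EdgesBelow (n + j + 1) (chainEdges n j) := by
  induction j with
  | zero => exact edgesBelow_nil _
  | succ j ih =>
    simp [chainEdges, ih.mono, add_assoc]

theorem partFn_chainEdges_succ {n j : ℕ} (c d : Fin N) {es : List (ℕ × ℕ)}
    {ℓ : Multiset (ℕ × Fin N)} (hes : EdgesBelow n es) (hℓ : LegsBelow (n + j + 1) ℓ) :
    partFn R (es ++ chainEdges n (j + 1)) ((n + j + 1, c) ::ₘ (n + j + 1, d) ::ₘ ℓ) =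
      ∑ x, ∑ y, boxTensor 1 x y c d *
        partFn R (es ++ chainEdges n j) ((n + j, x) ::ₘ (n + j, y) ::ₘ ℓ) := by
  have hes' : EdgesBelow (n + j + 1) (es ++ chainEdges n j) :=
    edgesBelow_append.2 ⟨hes.mono (by omega), edgesBelow_chainEdges n j⟩
  rw [chainEdges, ← List.append_assoc, partFn_append_cons]
  simp only [partFn_concat]
  refine Finset.sum_congr rfl fun x _ => Finset.sum_congr rfl fun y _ => ?_
  rw [← partFn_four_legs x y c d hes' (by simp [hℓ])]
  congr 1
  simp only [← Multiset.singleton_add]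
  abel

theorem partFn_chainEdges (hN : (N : R) = 0) {n : ℕ} (j : ℕ) (a b c d : Fin N)
    {es : List (ℕ × ℕ)} {ℓ : Multiset (ℕ × Fin N)} (hes : EdgesBelow n es) (hℓ : LegsBelow n ℓ) :
    partFn R (es ++ chainEdges n j) ((n + j, c) ::ₘ (n + j, d) ::ₘ (n, a) ::ₘ (n, b) ::ₘ ℓ) =
      2 ^ j * boxTensor ((j : R) + 1) a b c d * partFn R es ℓ := by
  induction j generalizing c d with
  | zero =>
    simp only [chainEdges, List.append_nil, Nat.cast_zero, zero_add, pow_zero, one_mul, add_zero]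
    rw [← partFn_four_legs a b c d hes hℓ]
    congr 1
    simp only [← Multiset.singleton_add]
    abel
  | succ j ih =>
    have hℓ' : LegsBelow (n + j + 1) ((n, a) ::ₘ (n, b) ::ₘ ℓ) := by
      simp [hℓ.mono, add_assoc]
    rw [← add_assoc n j 1, partFn_chainEdges_succ c d hes hℓ']
    simp only [ih]
    calc ∑ x, ∑ y, boxTensor 1 x y c d *
          (2 ^ j * boxTensor ((j : R) + 1) a b x y * partFn R es ℓ) =
        2 ^ j * partFn R es ℓ *
          ∑ x, ∑ y, boxTensor ((j : R) + 1) a b x y * boxTensor 1 x y c d := by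
          simp only [Finset.mul_sum]
          refine Finset.sum_congr rfl fun x _ => Finset.sum_congr rfl fun y _ => by ring
      _ = 2 ^ (j + 1) * boxTensor (((j + 1 : ℕ) : R) + 1) a b c d * partFn R es ℓ := by
          rw [sum_boxTensor_mul_boxTensor_one hN]
          push_cast
          ring

end Tensors
/-! ## Building a 4-regular graph -/

/-- A graph under construction: its edges, its number of vertices, and the vertex `own x` to which
the leg `x` is attached. -/
structure Builder where
  es : List (ℕ × ℕ)
  nv : ℕ
  own : ℕ → ℕ

/-- A ladder under construction on the leg `p`; the next block is attached to `y₁` and `y₂`. -/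
structure LadderState extends Builder where
  y₁ : ℕ
  y₂ : ℕ

/-- Add one block, a chain of `j + 1` vertices; `i` is the number of blocks already there. -/
def LadderState.addBlock (j p i : ℕ) (L : LadderState) : LadderState where
  es := L.es ++ (L.y₂, L.nv) :: ((if i = 0 then [] else [(L.y₁, L.nv + j)]) ++ chainEdges L.nv j)
  nv := L.nv + j + 1
  own := if i = 0 then Function.update L.own p (L.nv + j) else L.own
  y₁ := L.nv
  y₂ := L.nv + j

/-- The ladder with the given number of blocks. -/
def Builder.blocks (j p : ℕ) (B : Builder) : ℕ → LadderState
  | 0 => ⟨B, 0, B.own p⟩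
  | i + 1 => (B.blocks j p i).addBlock j p i

/-- `fresh p q` starts a new strand with legs `p` and `q`; `ladder w p q` lets the legs `p` and
`q` pass each other through a ladder with `w` blocks. -/
inductive Instr
  | fresh (p q : ℕ)
  | ladder (w p q : ℕ)

/-- The effect of an instruction, with `j + 1` vertices in each block. -/
def Builder.step (j : ℕ) (B : Builder) : Instr → Builder
  | .fresh p q =>
    ⟨B.es ++ [(B.nv, B.nv)], B.nv + 1, Function.update (Function.update B.own p B.nv) q B.nv⟩
  | .ladder w p q =>
    let L := B.blocks j p w
    ⟨L.es ++ [(L.y₁, L.own q)], L.nv, Function.update L.own q L.y₂⟩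

/-- The builder after a list of instructions. -/
def build (j : ℕ) (l : List Instr) : Builder := l.foldl (Builder.step j) ⟨[], 0, fun _ => 0⟩

/-- The number of blocks of an instruction. -/
def Instr.boxes : Instr → ℕ
  | .fresh _ _ => 0
  | .ladder w _ _ => w

/-- The contribution of an instruction to the normalizing constant. -/
def Instr.norm : Instr → ℕ
  | .fresh _ _ => 2
  | .ladder w _ _ => w

/-- The number of blocks in a list of instructions. -/
def numBoxes (l : List Instr) : ℕ := (l.map Instr.boxes).sum

/-- The normalizing constant of a list of instructions. -/
def normConst (l : List Instr) : ℕ := (l.map Instr.norm).prod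

@[simp] theorem numBoxes_nil : numBoxes [] = 0 := rfl
@[simp] theorem normConst_nil : normConst [] = 1 := rfl
@[simp] theorem build_nil (j : ℕ) : build j [] = ⟨[], 0, fun _ => 0⟩ := rfl

@[simp] theorem numBoxes_append (l l' : List Instr) :
    numBoxes (l ++ l') = numBoxes l + numBoxes l' := by simp [numBoxes]

@[simp] theorem numBoxes_singleton (i : Instr) : numBoxes [i] = i.boxes := by simp [numBoxes]

@[simp] theorem normConst_singleton (i : Instr) : normConst [i] = i.norm := by simp [normConst]

@[simp] theorem normConst_append (l l' : List Instr) :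
    normConst (l ++ l') = normConst l * normConst l' := by simp [normConst]

theorem build_concat (j : ℕ) (l : List Instr) (i : Instr) :
    build j (l ++ [i]) = (build j l).step j i := by simp [build]

/-- Lists of instructions that only use legs that are present and only create legs that are not;
the finite set consists of the legs present at the end. -/
inductive ValidCode : List Instr → Finset ℕ → Prop
  | nil : ValidCode [] ∅
  | fresh {l A p q} : ValidCode l A → p ≠ q → p ∉ A → q ∉ A →
      ValidCode (l ++ [.fresh p q]) (insert p (insert q A))
  | ladder {l A w p q} : ValidCode l A → 0 < w → p ≠ q → p ∈ A → q ∈ A →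
      ValidCode (l ++ [.ladder w p q]) A

/-- The multiset of the ends of a list of edges. -/
def edgeEnds (es : List (ℕ × ℕ)) : Multiset ℕ := (es.map fun e => {e.1, e.2}).sum

@[simp] theorem edgeEnds_nil : edgeEnds [] = 0 := rfl

@[simp] theorem edgeEnds_cons (e : ℕ × ℕ) (es : List (ℕ × ℕ)) :
    edgeEnds (e :: es) = {e.1, e.2} + edgeEnds es := by simp [edgeEnds]

@[simp] theorem edgeEnds_append (es fs : List (ℕ × ℕ)) :
    edgeEnds (es ++ fs) = edgeEnds es + edgeEnds fs := by simp [edgeEnds]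

theorem mem_edgeEnds {es : List (ℕ × ℕ)} {e : ℕ × ℕ} (he : e ∈ es) :
    e.1 ∈ edgeEnds es ∧ e.2 ∈ edgeEnds es := by
  induction es with
  | nil => simp at he
  | cons f es ih =>
    rcases List.mem_cons.1 he with rfl | he
    · simp
    · have := ih he; simp [this]

theorem update_update_of_ne {α β : Type*} [DecidableEq α] (f : α → β) {p q x : α} (a b : β)
    (hp : x ≠ p) (hq : x ≠ q) : Function.update (Function.update f p a) q b x = f x := by
  rw [Function.update_of_ne hq, Function.update_of_ne hp]

theorem map_val_insert_insert {α β : Type*} [DecidableEq α] {A : Finset α} {p q : α}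
    (hpq : p ≠ q) (hp : p ∉ A) (hq : q ∉ A) {f g : α → β}
    (hfg : ∀ x, x ≠ p → x ≠ q → f x = g x) :
    (insert p (insert q A)).val.map f = f p ::ₘ f q ::ₘ A.val.map g := by
  rw [Finset.insert_val_of_notMem (by simp [hpq, hp]), Finset.insert_val_of_notMem hq,
    Multiset.map_cons, Multiset.map_cons]
  congr 2
  exact Multiset.map_congr rfl fun x hx =>
    hfg x (ne_of_mem_of_not_mem hx hp) (ne_of_mem_of_not_mem hx hq)

theorem map_val_eq_cons_cons_erase {α β : Type*} [DecidableEq α] {A : Finset α} {p q : α}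
    (hpq : p ≠ q) (hp : p ∈ A) (hq : q ∈ A) {f g : α → β}
    (hfg : ∀ x, x ≠ p → x ≠ q → f x = g x) :
    A.val.map f = f p ::ₘ f q ::ₘ ((A.erase p).erase q).val.map g := by
  conv_lhs =>
    rw [← Finset.insert_erase hp, ← Finset.insert_erase (Finset.mem_erase.2 ⟨hpq.symm, hq⟩)]
  exact map_val_insert_insert hpq (by simp) (by simp) hfg

/-- Every vertex has exactly four ends of edges and legs. -/
def Builder.Saturated (B : Builder) (A : Finset ℕ) : Prop :=
  edgeEnds B.es + A.val.map B.own = 4 • Multiset.range B.nv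

theorem four_nsmul_range_succ (n : ℕ) :
    4 • Multiset.range (n + 1) = {n} + {n} + {n} + {n} + 4 • Multiset.range n := by
  rw [Multiset.range_succ, ← Multiset.singleton_add]
  abel

theorem edgeEnds_chainEdges (n j : ℕ) :
    edgeEnds (chainEdges n j) + ({n} + {n} + {n + j} + {n + j}) + 4 • Multiset.range n =
      4 • Multiset.range (n + j + 1) := by
  induction j with
  | zero =>
    rw [chainEdges, edgeEnds_nil, Nat.add_zero, four_nsmul_range_succ, zero_add]
  | succ j ih =>
    rw [← Nat.add_assoc, four_nsmul_range_succ, ← ih, chainEdges]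
    simp only [edgeEnds_append, edgeEnds_cons, edgeEnds_nil, Multiset.insert_eq_cons,
      ← Multiset.singleton_add]
    abel

theorem Builder.Saturated.edgesBelow {B : Builder} {A : Finset ℕ} (h : B.Saturated A) :
    EdgesBelow B.nv B.es := by
  have hlt : ∀ x ∈ edgeEnds B.es, x < B.nv := fun x hx =>
    Multiset.mem_range.1 (Multiset.mem_of_mem_nsmul (h ▸ Multiset.mem_add.2 (Or.inl hx)))
  exact fun e he => ⟨hlt _ (mem_edgeEnds he).1, hlt _ (mem_edgeEnds he).2⟩

theorem Builder.Saturated.own_lt {B : Builder} {A : Finset ℕ} (h : B.Saturated A) {x : ℕ}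
    (hx : x ∈ A) : B.own x < B.nv :=
  Multiset.mem_range.1 (Multiset.mem_of_mem_nsmul
    (h ▸ Multiset.mem_add.2 (Or.inr (Multiset.mem_map_of_mem _ hx))))

namespace Builder

variable (j p : ℕ) (B : Builder)

theorem nv_blocks (i : ℕ) : (B.blocks j p i).nv = B.nv + i * (j + 1) := by
  induction i with
  | zero => simp [blocks]
  | succ i ih => simp only [blocks, LadderState.addBlock, ih]; ring

theorem own_blocks (i : ℕ) :
    (B.blocks j p (i + 1)).own = Function.update B.own p (B.nv + j) := by
  induction i with
  | zero => simp [blocks, LadderState.addBlock]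
  | succ i ih =>
    rw [blocks, LadderState.addBlock]
    simpa using ih

theorem edgeEnds_blocks (i : ℕ) {S : Multiset ℕ}
    (hS : edgeEnds B.es + ({B.own p} + S) = 4 • Multiset.range B.nv) :
    edgeEnds (B.blocks j p (i + 1)).es + ({(B.blocks j p (i + 1)).y₁} +
      ({(B.blocks j p (i + 1)).y₂} + ({B.nv + j} + S))) =
        4 • Multiset.range (B.blocks j p (i + 1)).nv := by
  induction i with
  | zero =>
    simp only [blocks, LadderState.addBlock, if_true, List.nil_append]
    rw [← edgeEnds_chainEdges, ← hS]
    simp only [edgeEnds_append, edgeEnds_cons, Multiset.insert_eq_cons, ← Multiset.singleton_add]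
    abel
  | succ i ih =>
    rw [blocks, LadderState.addBlock]
    simp only
    rw [← edgeEnds_chainEdges, ← ih]
    simp only [edgeEnds_append, edgeEnds_cons, Multiset.insert_eq_cons, ← Multiset.singleton_add,
      if_neg (Nat.succ_ne_zero i), edgeEnds_nil]
    abel

variable {j p B}

theorem saturated_fresh {A : Finset ℕ} {p q : ℕ} (h : B.Saturated A) (hpq : p ≠ q) (hp : p ∉ A)
    (hq : q ∉ A) : (B.step j (.fresh p q)).Saturated (insert p (insert q A)) := by
  rw [Saturated] at h ⊢
  simp only [step]
  rw [map_val_insert_insert hpq hp hq fun x => update_update_of_ne B.own _ _, four_nsmul_range_succ,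
    ← h, Function.update_of_ne hpq, Function.update_self, Function.update_self]
  simp only [edgeEnds_append, edgeEnds_cons, Multiset.insert_eq_cons, ← Multiset.singleton_add,
    edgeEnds_nil]
  abel

theorem saturated_ladder {A : Finset ℕ} {w p q : ℕ} (h : B.Saturated A) (hw : 0 < w) (hpq : p ≠ q)
    (hp : p ∈ A) (hq : q ∈ A) : (B.step j (.ladder w p q)).Saturated A := by
  obtain ⟨i, rfl⟩ := Nat.exists_eq_add_one.2 hw
  rw [Saturated, map_val_eq_cons_cons_erase hpq hp hq fun _ _ _ => rfl,
    ← Multiset.singleton_add] at h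
  simp only [Saturated, step, own_blocks]
  rw [map_val_eq_cons_cons_erase hpq hp hq fun x => update_update_of_ne B.own _ _,
    ← edgeEnds_blocks j p B i h, Function.update_of_ne hpq, Function.update_self,
    Function.update_self, Function.update_of_ne hpq.symm]
  simp only [edgeEnds_append, edgeEnds_cons, Multiset.insert_eq_cons, ← Multiset.singleton_add,
    edgeEnds_nil]
  abel

end Builder

theorem ValidCode.saturated {l : List Instr} {A : Finset ℕ} (h : ValidCode l A) (j : ℕ) :
    (build j l).Saturated A := by
  induction h with
  | nil => simp [Builder.Saturated]
  | fresh _ h1 h2 h3 ih =>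
    rw [build_concat]
    exact Builder.saturated_fresh ih h1 h2 h3
  | ladder _ h1 h2 h3 h4 ih =>
    rw [build_concat]
    exact Builder.saturated_ladder ih h1 h2 h3 h4
/-! ## The tensor of a builder -/

section Semantics

variable {N : ℕ} {R : Type*} [CommSemiring R]

/-- The coloured legs. -/
def legs (A : Finset ℕ) (own : ℕ → ℕ) (c : ℕ → Fin N) : Multiset (ℕ × Fin N) :=
  A.val.map fun x => (own x, c x)

/-- The effect of an instruction on a tensor, with weight `κ` for the unwanted transition. -/
def Instr.act (κ : R) (F : (ℕ → Fin N) → R) : Instr → (ℕ → Fin N) → R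
  | .fresh p q => fun c => 2 * delta R (c p) (c q) * F c
  | .ladder w p q => fun c => ∑ a, ∑ b, ladderTensor κ w a (c p) (c q) b *
      F (Function.update (Function.update c p a) q b)

/-- The tensor of a list of instructions. -/
def codeTensor (κ : R) (l : List Instr) : (ℕ → Fin N) → R :=
  l.foldl (Instr.act κ) fun _ => 1

theorem codeTensor_concat (κ : R) (l : List Instr) (i : Instr) :
    (codeTensor κ (l ++ [i]) : (ℕ → Fin N) → R) = Instr.act κ (codeTensor κ l) i := by
  simp [codeTensor]

theorem Builder.Saturated.legsBelow {B : Builder} {A : Finset ℕ} (h : B.Saturated A)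
    (c : ℕ → Fin N) : LegsBelow B.nv (legs A B.own c) := fun _ hx => by
  obtain ⟨y, hy, rfl⟩ := Multiset.mem_map.1 hx
  exact h.own_lt hy

namespace LadderState

variable {j : ℕ} {L : LadderState}

theorem edgesBelow_addBlock (p i : ℕ) (hes : EdgesBelow L.nv L.es) (h₁ : L.y₁ < L.nv)
    (h₂ : L.y₂ < L.nv) : EdgesBelow (L.addBlock j p i).nv (L.addBlock j p i).es := by
  simp only [addBlock, edgesBelow_append, edgesBelow_cons]
  refine ⟨hes.mono (by omega), ⟨by omega, by omega⟩, ?_, edgesBelow_chainEdges _ _⟩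
  split_ifs
  · exact edgesBelow_nil _
  · simp only [edgesBelow_cons, edgesBelow_nil, and_true]
    omega

theorem partFn_addBlock_zero (hN : (N : R) = 0) (p : ℕ) (b c d : Fin N) {ℓ : Multiset (ℕ × Fin N)}
    (hes : EdgesBelow L.nv L.es) (h₂ : L.y₂ < L.nv) (hℓ : LegsBelow L.nv ℓ) :
    partFn R (L.addBlock j p 0).es ((L.nv, b) ::ₘ (L.nv + j, d) ::ₘ (L.nv + j, c) ::ₘ ℓ) =
      2 ^ j * ∑ a, boxTensor ((j : R) + 1) a b c d * partFn R L.es ((L.y₂, a) ::ₘ ℓ) := by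
  simp only [addBlock, if_true, List.nil_append]
  rw [partFn_append_cons, Finset.mul_sum]
  refine Finset.sum_congr rfl fun a _ => ?_
  rw [← mul_assoc, ← partFn_chainEdges hN j a b c d hes (legsBelow_cons.2 ⟨h₂, hℓ⟩)]
  congr 1
  simp only [← Multiset.singleton_add]
  abel

theorem partFn_addBlock (hN : (N : R) = 0) {i : ℕ} (hi : i ≠ 0) (p : ℕ) (b d : Fin N)
    {ℓ : Multiset (ℕ × Fin N)} (hes : EdgesBelow L.nv L.es) (h₁ : L.y₁ < L.nv) (h₂ : L.y₂ < L.nv)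
    (hℓ : LegsBelow L.nv ℓ) :
    partFn R (L.addBlock j p i).es ((L.nv, b) ::ₘ (L.nv + j, d) ::ₘ ℓ) =
      2 ^ j * ∑ x, ∑ y, boxTensor ((j : R) + 1) x b y d *
        partFn R L.es ((L.y₁, y) ::ₘ (L.y₂, x) ::ₘ ℓ) := by
  simp only [addBlock, if_neg hi, List.cons_append, List.nil_append]
  simp only [partFn_append_cons, Finset.mul_sum]
  refine Finset.sum_congr rfl fun x _ => Finset.sum_congr rfl fun y _ => ?_
  rw [← mul_assoc, ← partFn_chainEdges hN j x b y d hes (by simp [h₁, h₂, hℓ])]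
  congr 1
  simp only [← Multiset.singleton_add]
  abel

end LadderState

namespace Builder

variable {B : Builder} {p : ℕ} (j : ℕ)

theorem blocks_below (hes : EdgesBelow B.nv B.es) (hp : B.own p < B.nv) (i : ℕ) :
    EdgesBelow (B.blocks j p i).nv (B.blocks j p i).es ∧
      (B.blocks j p i).y₁ < (B.blocks j p i).nv ∧ (B.blocks j p i).y₂ < (B.blocks j p i).nv := by
  induction i with
  | zero => exact ⟨hes, by simp only [blocks]; omega, hp⟩
  | succ i ih =>
    refine ⟨LadderState.edgesBelow_addBlock p i ih.1 ih.2.1 ih.2.2, ?_⟩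
    simp only [blocks, LadderState.addBlock]
    omega

theorem partFn_blocks (hN : (N : R) = 0) (hes : EdgesBelow B.nv B.es) (hp : B.own p < B.nv)
    (i : ℕ) (b c d : Fin N) {ℓ : Multiset (ℕ × Fin N)} (hℓ : LegsBelow B.nv ℓ) :
    partFn R (B.blocks j p (i + 1)).es (((B.blocks j p (i + 1)).y₁, b) ::ₘ
        ((B.blocks j p (i + 1)).y₂, d) ::ₘ (B.nv + j, c) ::ₘ ℓ) =
      2 ^ (j * (i + 1)) * ∑ a, ladderTensor ((j : R) + 1) (i + 1) a c d b *
        partFn R B.es ((B.own p, a) ::ₘ ℓ) := by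
  induction i generalizing b d with
  | zero =>
    simp only [zero_add, mul_one, ladderTensor_one]
    exact LadderState.partFn_addBlock_zero (L := B.blocks j p 0) hN p b c d hes hp hℓ
  | succ i ih =>
    obtain ⟨hes', h₁, h₂⟩ := blocks_below j hes hp (i + 1)
    have hle : B.nv + j < (B.blocks j p (i + 1)).nv := by
      rw [nv_blocks, add_mul, one_mul]
      omega
    refine (LadderState.partFn_addBlock hN (Nat.succ_ne_zero i) p b d hes' h₁ h₂
      (legsBelow_cons.2 ⟨hle, hℓ.mono (by omega)⟩)).trans ?_
    calc 2 ^ j * ∑ x, ∑ y, boxTensor ((j : R) + 1) x b y d * partFn R (B.blocks j p (i + 1)).es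
            (((B.blocks j p (i + 1)).y₁, y) ::ₘ ((B.blocks j p (i + 1)).y₂, x) ::ₘ
              (B.nv + j, c) ::ₘ ℓ) =
        ∑ x, ∑ y, ∑ a, 2 ^ (j * (i + 2)) * (ladderTensor ((j : R) + 1) (i + 1) a c x y *
          boxTensor ((j : R) + 1) x b y d * partFn R B.es ((B.own p, a) ::ₘ ℓ)) := by
          simp only [ih, Finset.mul_sum]
          refine Finset.sum_congr rfl fun x _ => Finset.sum_congr rfl fun y _ =>
            Finset.sum_congr rfl fun a _ => by ring
      _ = 2 ^ (j * (i + 2)) * ∑ a, ladderTensor ((j : R) + 1) (i + 2) a c d b *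
            partFn R B.es ((B.own p, a) ::ₘ ℓ) := by
          rw [Finset.sum_congr rfl fun x _ => Finset.sum_comm, Finset.sum_comm, Finset.mul_sum]
          simp only [ladderTensor, Finset.mul_sum, Finset.sum_mul]

end Builder

theorem partFn_step_fresh (hN : (N : R) = 0) {j p q : ℕ} {B : Builder} {A : Finset ℕ}
    (h : B.Saturated A) (hpq : p ≠ q) (hp : p ∉ A) (hq : q ∉ A) (c : ℕ → Fin N) :
    partFn R (B.step j (.fresh p q)).es
        (legs (insert p (insert q A)) (B.step j (.fresh p q)).own c) =
      2 * delta R (c p) (c q) * partFn R B.es (legs A B.own c) := by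
  have hlegs : legs (insert p (insert q A)) (B.step j (.fresh p q)).own c =
      (B.nv, c p) ::ₘ (B.nv, c q) ::ₘ legs A B.own c := by
    simp only [legs, Builder.step]
    rw [map_val_insert_insert (g := fun x => (B.own x, c x)) hpq hp hq fun x hp hq => by
      rw [update_update_of_ne B.own _ _ hp hq], Function.update_of_ne hpq, Function.update_self,
      Function.update_self]
  rw [hlegs]
  simp only [Builder.step, partFn_concat, partFn_four_legs _ _ _ _ h.edgesBelow (h.legsBelow c)]
  rw [← Finset.sum_mul]
  congr 1
  simp only [boxTensor, Finset.sum_add_distrib, sum_delta_mul', delta_self, one_mul,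
    sum_const_eq_zero hN]
  rw [delta_comm (c q) (c p)]
  ring

theorem partFn_step_ladder (hN : (N : R) = 0) {j w p q : ℕ} {B : Builder} {A : Finset ℕ}
    (h : B.Saturated A) (hw : 0 < w) (hpq : p ≠ q) (hp : p ∈ A) (hq : q ∈ A) (c : ℕ → Fin N) :
    partFn R (B.step j (.ladder w p q)).es (legs A (B.step j (.ladder w p q)).own c) =
      2 ^ (j * w) * ∑ a, ∑ b, ladderTensor ((j : R) + 1) w a (c p) (c q) b *
        partFn R B.es (legs A B.own (Function.update (Function.update c p a) q b)) := by
  obtain ⟨i, rfl⟩ := Nat.exists_eq_add_one.2 hw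
  let ℓ : Multiset (ℕ × Fin N) := ((A.erase p).erase q).val.map fun x => (B.own x, c x)
  have hlegs_after : legs A (B.step j (.ladder (i + 1) p q)).own c =
      (B.nv + j, c p) ::ₘ ((B.blocks j p (i + 1)).y₂, c q) ::ₘ ℓ := by
    simp only [legs, Builder.step, Builder.own_blocks]
    rw [map_val_eq_cons_cons_erase (g := fun x => (B.own x, c x)) hpq hp hq fun x hp hq => by
      rw [update_update_of_ne B.own _ _ hp hq], Function.update_of_ne hpq, Function.update_self,
      Function.update_self]
  have hlegs_before (a b) : legs A B.own (Function.update (Function.update c p a) q b) =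
      (B.own p, a) ::ₘ (B.own q, b) ::ₘ ℓ := by
    rw [legs, map_val_eq_cons_cons_erase (g := fun x => (B.own x, c x)) hpq hp hq fun x hp hq => by
      rw [update_update_of_ne c _ _ hp hq], Function.update_of_ne hpq, Function.update_self,
      Function.update_self]
  have hℓ (b) : LegsBelow B.nv ((B.own q, b) ::ₘ ℓ) :=
    (legsBelow_cons.1 (hlegs_before (c p) b ▸ h.legsBelow _)).2
  have hown : (B.blocks j p (i + 1)).own q = B.own q := by
    rw [Builder.own_blocks, Function.update_of_ne hpq.symm]
  rw [hlegs_after]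
  simp only [hlegs_before, Builder.step, partFn_concat, hown]
  rw [Finset.sum_comm, Finset.mul_sum]
  refine Finset.sum_congr rfl fun b _ => ?_
  rw [← Builder.partFn_blocks j hN h.edgesBelow (h.own_lt hp) i b (c p) (c q) (hℓ b)]
  congr 1
  simp only [← Multiset.singleton_add]
  abel

theorem ValidCode.partFn_eq (hN : (N : R) = 0) {l : List Instr} {A : Finset ℕ}
    (h : ValidCode l A) (j : ℕ) (c : ℕ → Fin N) :
    partFn R (build j l).es (legs A (build j l).own c) =
      2 ^ (j * numBoxes l) * codeTensor ((j : R) + 1) l c := by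
  induction h generalizing c with
  | nil => simp [partFn, legs, matchCount_zero, codeTensor]
  | fresh h' hpq hp hq ih =>
    rw [build_concat, partFn_step_fresh hN (h'.saturated j) hpq hp hq, ih, codeTensor_concat,
      numBoxes_append, numBoxes_singleton]
    simp only [Instr.act, Instr.boxes, add_zero]
    ring
  | ladder h' hw hpq hp hq ih =>
    rw [build_concat, partFn_step_ladder hN (h'.saturated j) hw hpq hp hq, codeTensor_concat,
      numBoxes_append, numBoxes_singleton]
    simp only [ih, Instr.act, Instr.boxes, Finset.mul_sum]
    refine Finset.sum_congr rfl fun a _ => Finset.sum_congr rfl fun b _ => ?_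
    ring

theorem exists_polynomial_codeTensor (l : List Instr) (c : ℕ → Fin N) :
    ∃ p : Polynomial R, p.natDegree ≤ numBoxes l ∧ ∀ κ, codeTensor κ l c = p.eval κ := by
  induction l using List.reverseRecOn generalizing c with
  | nil => exact ⟨1, by simp, fun κ => by simp [codeTensor]⟩
  | append_singleton l i ih =>
    choose P hP hP' using ih
    cases i with
    | fresh p q =>
      refine ⟨Polynomial.C (2 * delta R (c p) (c q)) * P c, ?_, fun κ => ?_⟩
      · exact (Polynomial.natDegree_C_mul_le _ _).trans ((hP c).trans (by simp))
      · simp only [codeTensor_concat, Instr.act, Polynomial.eval_mul, Polynomial.eval_C, hP']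
    | ladder w p q =>
      choose Q hQ hQ' using fun a b => exists_polynomial_ladderTensor (R := R) w a (c p) (c q) b
      refine ⟨∑ a, ∑ b, Q a b * P (Function.update (Function.update c p a) q b), ?_, fun κ => ?_⟩
      · refine Polynomial.natDegree_sum_le_of_forall_le _ _ fun x _ =>
          Polynomial.natDegree_sum_le_of_forall_le _ _ fun y _ => ?_
        rw [numBoxes_append, numBoxes_singleton, add_comm]
        exact Polynomial.natDegree_mul_le_of_le (hQ x y) (hP _)
      · simp only [codeTensor_concat, Instr.act, Polynomial.eval_finsetSum, Polynomial.eval_mul,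
          hP', hQ']

theorem codeTensor_zero_ladder (hN : (N : R) = 0) (l : List Instr) (w p q : ℕ)
    (c : ℕ → Fin N) :
    codeTensor (0 : R) (l ++ [.ladder w p q]) c = w * codeTensor 0 l c +
      codeTensor 0 l (Function.update (Function.update c p (c q)) q (c p)) := by
  rw [codeTensor_concat]
  simp only [Instr.act, ladderTensor_zero hN, add_mul, mul_assoc, Finset.sum_add_distrib,
    ← Finset.mul_sum, sum_delta_mul']
  rw [add_comm]
  simp

end Semantics
/-! ## The code of a graph -/

section Code

variable (inp : ℕ → ℕ)

/-- The number of darts `p < i` at the vertex `v`, where `inp p` is the vertex of the dart `p`. -/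
def countBefore (v i : ℕ) : ℕ := Nat.count (fun p => inp p = v) i

/-- The last dart `p < i` at the vertex `v`; it is `0` if there is none. -/
def lastBefore (v : ℕ) : ℕ → ℕ
  | 0 => 0
  | i + 1 => if inp i = v then i else lastBefore v i

/-- The ladders between `q` and the darts `p < i` at the vertex `v`. -/
def ladders (v m q : ℕ) : ℕ → List Instr
  | 0 => []
  | i + 1 => if inp i = v then ladders v m q i ++ [.ladder (m - countBefore inp v i) i q]
      else ladders v m q i

/-- The instructions that attach the dart `q` and the dart before it at the same vertex, if an odd
number of darts at this vertex precede `q`. -/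
def dartCode (q : ℕ) : List Instr :=
  if countBefore inp (inp q) q % 2 = 1 then
    .fresh (lastBefore inp (inp q) q) q ::
      ladders inp (inp q) (countBefore inp (inp q) q - 1) q (lastBefore inp (inp q) q)
  else []

/-- The instructions for the darts before `q`. -/
def code : ℕ → List Instr
  | 0 => []
  | q + 1 => code q ++ dartCode inp q

/-- The legs attached by the code for the darts before `q`. -/
def attached (q : ℕ) : Finset ℕ :=
  (Finset.range q).filter fun p =>
    ¬ (countBefore inp (inp p) q % 2 = 1 ∧ p = lastBefore inp (inp p) q)

variable {inp} {v p q i : ℕ}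

@[simp] theorem countBefore_zero : countBefore inp v 0 = 0 := rfl

theorem countBefore_succ :
    countBefore inp v (i + 1) = countBefore inp v i + if inp i = v then 1 else 0 :=
  Nat.count_succ _ _

theorem countBefore_le (v i : ℕ) : countBefore inp v i ≤ i := Nat.count_le _

theorem countBefore_lt_countBefore {z : ℕ} (hp : p < z) (hv : inp p = v) :
    countBefore inp v p < countBefore inp v z := Nat.count_strict_mono hv hp

theorem lastBefore_le (v i : ℕ) : lastBefore inp v i ≤ i := by
  induction i with
  | zero => rfl
  | succ i ih => simp only [lastBefore]; split_ifs <;> omega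

theorem le_lastBefore (hp : p < i) (hv : inp p = v) : p ≤ lastBefore inp v i := by
  induction i with
  | zero => omega
  | succ i ih => grind [lastBefore]

theorem lastBefore_lt (h : 0 < countBefore inp v i) : lastBefore inp v i < i := by
  induction i with
  | zero => simp at h
  | succ i ih => grind [lastBefore, countBefore_succ]

theorem apply_lastBefore (h : 0 < countBefore inp v i) : inp (lastBefore inp v i) = v := by
  induction i with
  | zero => simp at h
  | succ i ih => grind [lastBefore, countBefore_succ]

theorem countBefore_lastBefore (h : 0 < countBefore inp v i) :
    countBefore inp v (lastBefore inp v i) + 1 = countBefore inp v i := by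
  induction i with
  | zero => simp at h
  | succ i ih => grind [lastBefore, countBefore_succ]

theorem mem_attached_iff : p ∈ attached inp q ↔
    p < q ∧ ¬ (countBefore inp (inp p) q % 2 = 1 ∧ p = lastBefore inp (inp p) q) := by
  simp only [attached, Finset.mem_filter, Finset.mem_range]

theorem notMem_attached : q ∉ attached inp q := by simp [attached]

theorem mem_attached_of_lt_lastBefore (h : p < lastBefore inp (inp p) q) :
    p ∈ attached inp q :=
  mem_attached_iff.2 ⟨h.trans_le (lastBefore_le _ _), fun hp => h.ne hp.2⟩

theorem lastBefore_notMem_attached (h : countBefore inp (inp q) q % 2 = 1) :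
    lastBefore inp (inp q) q ∉ attached inp q := fun hz => by
  have hpos : 0 < countBefore inp (inp q) q := by omega
  rw [mem_attached_iff, apply_lastBefore hpos] at hz
  exact hz.2 ⟨h, rfl⟩

theorem attached_succ_of_even (h : ¬ countBefore inp (inp q) q % 2 = 1) :
    attached inp (q + 1) = attached inp q := by
  ext p
  grind [mem_attached_iff, countBefore_succ, lastBefore]

theorem attached_succ_of_odd (h : countBefore inp (inp q) q % 2 = 1) :
    attached inp (q + 1) =
      insert (lastBefore inp (inp q) q) (insert q (attached inp q)) := by
  have hpos : 0 < countBefore inp (inp q) q := by omega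
  have hlt := lastBefore_lt hpos
  have hz := apply_lastBefore hpos
  ext p
  grind [mem_attached_iff, countBefore_succ, lastBefore]

theorem mem_attached_and_apply_eq_iff (h : countBefore inp (inp q) q % 2 = 1) :
    p ∈ attached inp q ∧ inp p = inp q ↔ p < lastBefore inp (inp q) q ∧ inp p = inp q := by
  refine and_congr_left fun hv => ⟨fun hp => ?_, fun hp => ?_⟩
  · refine lt_of_le_of_ne (le_lastBefore (mem_attached_iff.1 hp).1 hv) ?_
    rintro rfl
    exact lastBefore_notMem_attached h hp
  · exact mem_attached_of_lt_lastBefore (hv ▸ hp)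

theorem validCode_ladders {m z : ℕ} {l : List Instr} {A : Finset ℕ} (hl : ValidCode l A)
    (hq : q ∈ A) (hqz : z ≤ q) (hA : ∀ p < z, inp p = v → p ∈ A) (hm : countBefore inp v z ≤ m)
    (hi : i ≤ z) : ValidCode (l ++ ladders inp v m q i) A := by
  induction i with
  | zero => simpa [ladders] using hl
  | succ i ih =>
    rw [ladders]
    split_ifs with hv
    · rw [← List.append_assoc]
      have hlt := countBefore_lt_countBefore hi hv
      exact (ih (by omega)).ladder (by omega) (by omega) (hA i hi hv) hq
    · exact ih (by omega)

theorem validCode_code (q : ℕ) : ValidCode (code inp q) (attached inp q) := by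
  induction q with
  | zero => exact ValidCode.nil
  | succ q ih =>
    rw [code, dartCode]
    split_ifs with h
    · have hpos : 0 < countBefore inp (inp q) q := by omega
      have hz := lastBefore_lt hpos
      have hcount := countBefore_lastBefore hpos
      rw [attached_succ_of_odd h, ← List.singleton_append, ← List.append_assoc]
      refine validCode_ladders (ih.fresh hz.ne (lastBefore_notMem_attached h) notMem_attached)
        (by simp) hz.le (fun p hp hv => ?_) (by omega) le_rfl
      exact Finset.mem_insert_of_mem (Finset.mem_insert_of_mem
        ((mem_attached_and_apply_eq_iff h).2 ⟨hp, hv⟩).1)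
    · rw [attached_succ_of_even h, List.append_nil]
      exact ih

theorem normConst_ladders (v m q i : ℕ) :
    normConst (ladders inp v m q i) = m.descFactorial (countBefore inp v i) := by
  induction i with
  | zero => simp [ladders]
  | succ i ih =>
    rw [ladders, countBefore_succ]
    split_ifs
    · rw [normConst_append, normConst_singleton, ih, Nat.descFactorial_succ, mul_comm]
      rfl
    · exact ih

section Tensor

variable {N : ℕ} {own : ℕ → ℕ} {A : Finset ℕ} (c : ℕ → Fin N)

theorem legs_update_of_notMem (hq : q ∉ A) (a : Fin N) :
    legs A own (Function.update c q a) = legs A own c :=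
  Multiset.map_congr rfl fun x hx => by rw [Function.update_of_ne (ne_of_mem_of_not_mem hx hq)]

theorem legs_update_update (hp : p ∈ A) (hi : i ∈ A) (hpi : p ≠ i) (hown : own p = own i)
    (a : Fin N) : legs A own (Function.update (Function.update c i a) p (c i)) =
      legs A own (Function.update c p a) := by
  have hrest (a b : Fin N) (x : ℕ) (hxp : x ≠ p) (hxi : x ≠ i) :
      (own x, Function.update (Function.update c i a) p b x) = (own x, c x) := by
    rw [update_update_of_ne c a b hxi hxp]
  have hsplit := map_val_eq_cons_cons_erase hpi hp hi (hrest a (c i))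
  have hsplit' := map_val_eq_cons_cons_erase hpi hp hi (hrest (c i) a)
  rw [Function.update_eq_self] at hsplit'
  rw [legs, legs, hsplit, hsplit', Function.update_self, Function.update_self,
    Function.update_of_ne hpi.symm, Function.update_of_ne hpi.symm, Function.update_self, hown,
    Multiset.cons_swap]

theorem legs_erase_insert (hp : p ∈ A) (hq : q ∉ A) (hown : own p = own q) :
    legs ((insert q A).erase p) own c = legs A own (Function.update c p (c q)) := by
  have hqp : q ≠ p := (ne_of_mem_of_not_mem hp hq).symm
  rw [Finset.erase_insert_of_ne hqp, ← Finset.insert_erase hp, legs, legs,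
    Finset.insert_val_of_notMem (by simp [hq]), Finset.insert_val_of_notMem (by simp),
    Multiset.map_cons, Multiset.map_cons, Function.update_self, hown,
    Finset.erase_insert (by simp)]
  congr 1
  exact (legs_update_of_notMem c (by simp) (c q)).symm

theorem matchCount_legs_insert {z : ℕ} (hz : z ∉ A) :
    matchCount (legs (insert z A) own c) =
      ∑ p ∈ A with own p = own z ∧ c p = c z, matchCount (legs (A.erase p) own c) := by
  have herase : ∀ p ∈ A.filter fun p => own p = own z ∧ c p = c z,
      matchCount (legs (A.erase p) own c) = matchCount ((legs A own c).erase (own z, c z)) := by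
    intro p hp
    obtain ⟨hpA, hown, hc⟩ := Finset.mem_filter.1 hp
    rw [legs, legs, Finset.erase_val, Multiset.map_erase_of_mem _ _ hpA, hown, hc]
  rw [Finset.sum_congr rfl herase, Finset.sum_const, smul_eq_mul, legs,
    Finset.insert_val_of_notMem hz, Multiset.map_cons, matchCount_cons, Multiset.count_map]
  congr 1
  rw [Finset.card_def, Finset.filter_val]
  simp only [Prod.mk.injEq, eq_comm]

variable {R : Type*} [CommSemiring R]

theorem matchCount_legs_insert_insert {z : ℕ} (hz : z ∉ A) (hq : q ∉ A) (hzq : z ≠ q)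
    (hown : own z = own q) :
    (matchCount (legs (insert z (insert q A)) own c) : R) =
      delta R (c z) (c q) * matchCount (legs A own c) +
        ∑ p ∈ A with own p = own q, delta R (c z) (c p) *
          (matchCount (legs A own (Function.update c p (c q))) : R) := by
  rw [matchCount_legs_insert c (by simp [hz, hzq]), Finset.sum_filter, Finset.sum_insert hq,
    Finset.erase_insert hq, Finset.sum_filter]
  push_cast
  congr 1
  · simp [hown, delta, eq_comm]
  · refine Finset.sum_congr rfl fun p hp => ?_
    by_cases hp' : own p = own q
    · rw [legs_erase_insert c hp hq hp']
      simp [hown, hp', delta, eq_comm]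
    · simp [hown, hp']

/-- The contribution of the matchings that pair the leg `z` with one of the darts `p < i` at the
vertex of `q`, which leaves the colour of `q` in the place of `p`. -/
def pairingSum (R : Type*) [CommSemiring R] (inp : ℕ → ℕ) (A : Finset ℕ) (z q i : ℕ)
    (c : ℕ → Fin N) : R :=
  ∑ p ∈ Finset.range i with inp p = inp q, delta R (c z) (c p) *
    (matchCount (legs A inp (Function.update c p (c q))) : R)

theorem pairingSum_succ (z q i : ℕ) :
    pairingSum R inp A z q (i + 1) c = pairingSum R inp A z q i c +
      if inp i = inp q then delta R (c z) (c i) *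
        (matchCount (legs A inp (Function.update c i (c q))) : R) else 0 := by
  simp only [pairingSum, Finset.sum_filter, Finset.sum_range_succ]

theorem pairingSum_eq_zero (z : ℕ) (h : countBefore inp (inp q) i = 0) :
    pairingSum R inp A z q i c = 0 := by
  rw [countBefore, Nat.count_eq_card_filter_range, Finset.card_eq_zero] at h
  rw [pairingSum, h, Finset.sum_empty]

theorem descFactorial_mul_pairingSum {m : ℕ} (z : ℕ) (h : countBefore inp (inp q) i ≤ m) :
    ((m - countBefore inp (inp q) i + 1 : ℕ) : R) *
        (m.descFactorial (countBefore inp (inp q) i - 1) * pairingSum R inp A z q i c) =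
      m.descFactorial (countBefore inp (inp q) i) * pairingSum R inp A z q i c := by
  rcases Nat.eq_zero_or_pos (countBefore inp (inp q) i) with h0 | hpos
  · simp [pairingSum_eq_zero c z h0]
  · obtain ⟨r, hr⟩ := Nat.exists_eq_add_one.2 hpos
    rw [hr] at h ⊢
    rw [Nat.add_sub_cancel, Nat.descFactorial_succ, Nat.cast_mul,
      ← mul_assoc, show m - (r + 1) + 1 = m - r by omega]

theorem pairingSum_swap {z : ℕ} (hq : q ∉ A) (hzq : z < q) (hA : ∀ p < z, inp p = inp q → p ∈ A)
    (hiz : i < z) (hi : inp i = inp q) :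
    pairingSum R inp A z q i (Function.update (Function.update c i (c q)) q (c i)) =
      pairingSum R inp A z q i c := by
  refine Finset.sum_congr rfl fun p hp => ?_
  obtain ⟨hpi, hp⟩ := Finset.mem_filter.1 hp
  rw [Finset.mem_range] at hpi
  rw [update_update_of_ne c _ _ hiz.ne' hzq.ne,
    update_update_of_ne c _ _ hpi.ne (hpi.trans (hiz.trans hzq)).ne, Function.update_self,
    Function.update_comm (hpi.trans (hiz.trans hzq)).ne', legs_update_of_notMem _ hq,
    legs_update_update c (hA p (hpi.trans hiz) hp) (hA i hiz hi) hpi.ne (hp.trans hi.symm)]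

theorem codeTensor_ladders (hN : (N : R) = 0) {m z : ℕ} {l : List Instr} {K : R} (hq : q ∉ A)
    (hzq : z < q) (hA : ∀ p < z, inp p = inp q → p ∈ A) (hm : countBefore inp (inp q) z ≤ m)
    (hl : ∀ c : ℕ → Fin N, codeTensor (0 : R) l c =
      K * (delta R (c z) (c q) * matchCount (legs A inp c)))
    (hi : i ≤ z) :
    codeTensor (0 : R) (l ++ ladders inp (inp q) m q i) c =
      K * (m.descFactorial (countBefore inp (inp q) i) *
          (delta R (c z) (c q) * matchCount (legs A inp c)) +
        m.descFactorial (countBefore inp (inp q) i - 1) * pairingSum R inp A z q i c) := by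
  induction i generalizing c with
  | zero => simp [ladders, hl, pairingSum]
  | succ i ih =>
    rw [ladders, countBefore_succ, pairingSum_succ]
    split_ifs with hv
    · have hr := (countBefore_lt_countBefore hi hv).trans_le hm
      have hX := descFactorial_mul_pairingSum (R := R) (A := A) c z hr.le
      rw [← List.append_assoc, codeTensor_zero_ladder hN, ih c (by omega), ih _ (by omega),
        pairingSum_swap c hq hzq hA hi hv, update_update_of_ne c _ _ (by omega) hzq.ne,
        Function.update_self, legs_update_of_notMem _ hq, Nat.add_sub_cancel,
        Nat.descFactorial_succ, mul_add _ (pairingSum R inp A z q i c), ← hX]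
      push_cast
      ring
    · simpa using ih c (by omega)

theorem codeTensor_code (hN : (N : R) = 0) (q : ℕ) :
    codeTensor (0 : R) (code inp q) c =
      normConst (code inp q) * matchCount (legs (attached inp q) inp c) := by
  induction q generalizing c with
  | zero => simp [code, codeTensor, attached, legs]
  | succ q ih =>
    rw [code, dartCode]
    split_ifs with h
    · have hpos : 0 < countBefore inp (inp q) q := by omega
      have hcount := countBefore_lastBefore hpos
      have hA := fun p => mem_attached_and_apply_eq_iff (p := p) h
      set z := lastBefore inp (inp q) q
      have hz : z < q := lastBefore_lt hpos
      have hfresh (c : ℕ → Fin N) : codeTensor (0 : R) (code inp q ++ [.fresh z q]) c =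
          (normConst (code inp q) * 2) *
            (delta R (c z) (c q) * matchCount (legs (attached inp q) inp c)) := by
        rw [codeTensor_concat]
        simp only [Instr.act, ih]
        ring
      have hm : countBefore inp (inp q) q - 1 = countBefore inp (inp q) z := by omega
      have hX := descFactorial_mul_pairingSum (R := R) (A := attached inp q) c z hm.ge
      rw [attached_succ_of_odd h, ← List.singleton_append, ← List.append_assoc,
        codeTensor_ladders c hN notMem_attached hz (fun p hp hv => ((hA p).2 ⟨hp, hv⟩).1) hm.ge
          hfresh le_rfl,
        matchCount_legs_insert_insert c (lastBefore_notMem_attached h) notMem_attached hz.ne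
          (apply_lastBefore hpos)]
      have hsum : ∑ p ∈ attached inp q with inp p = inp q, delta R (c z) (c p) *
          (matchCount (legs (attached inp q) inp (Function.update c p (c q))) : R) =
          pairingSum R inp (attached inp q) z q z c :=
        Finset.sum_congr (by ext p; simp [hA]) fun _ _ => rfl
      rw [hm, Nat.sub_self, zero_add, Nat.cast_one, one_mul] at hX
      rw [hsum, hm, normConst_append, normConst_append, normConst_singleton, normConst_ladders, hX]
      simp only [Instr.norm]
      push_cast
      ring
    · rw [attached_succ_of_even h, List.append_nil]
      exact ih c

end Tensor

end Code
/-! ## The 4-regular graphs that simulate an Eulerian graph -/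

/-- The word that lists the ends of the edges. -/
def flatEdges (es : List (ℕ × ℕ)) : List ℕ := es.flatMap fun e => [e.1, e.2]

@[simp] theorem flatEdges_nil : flatEdges [] = [] := rfl

@[simp] theorem flatEdges_cons (e : ℕ × ℕ) (es : List (ℕ × ℕ)) :
    flatEdges (e :: es) = e.1 :: e.2 :: flatEdges es := rfl

@[simp] theorem flatEdges_append (es fs : List (ℕ × ℕ)) :
    flatEdges (es ++ fs) = flatEdges es ++ flatEdges fs := by simp [flatEdges]

@[simp] theorem length_flatEdges (es : List (ℕ × ℕ)) :
    (flatEdges es).length = 2 * es.length := by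
  induction es with
  | nil => rfl
  | cons e es ih => simp [ih, mul_add]

theorem getD_flatEdges_ofFn {m : ℕ} (g : Fin m → ℕ × ℕ) (i : Fin m) :
    (flatEdges (List.ofFn g)).getD (2 * i) 0 = (g i).1 ∧
      (flatEdges (List.ofFn g)).getD (2 * i + 1) 0 = (g i).2 := by
  induction m with
  | zero => exact i.elim0
  | succ m ih =>
    rw [List.ofFn_succ, flatEdges_cons]
    refine Fin.cases (by simp) (fun i => ?_) i
    simpa [mul_add] using ih (fun i => g i.succ) i

theorem map_range_two_mul {α : Type*} (m : ℕ) (f : ℕ → α) :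
    (Finset.range (2 * m)).val.map f = ∑ i : Fin m, {f (2 * i), f (2 * i + 1)} := by
  induction m with
  | zero => simp
  | succ m ih =>
    rw [Fin.sum_univ_castSucc, mul_add, mul_one, Finset.range_val, Multiset.range_succ,
      Multiset.range_succ, Multiset.map_cons, Multiset.map_cons, ← Finset.range_val, ih]
    simp only [Fin.val_castSucc, Fin.val_last, Multiset.insert_eq_cons, ← Multiset.singleton_add]
    abel

namespace Multigraph

variable (G : Multigraph)

theorem encode_eq_flatEdges : G.encode = G.numVerts ::
    flatEdges (List.ofFn fun i => (((G.ends i).1 : ℕ), ((G.ends i).2 : ℕ))) := by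
  rw [encode, flatEdges, List.flatMap_def, List.flatMap_def, List.map_ofFn, List.map_ofFn]
  rfl

/-- The vertex of the dart number `x` (the darts of the edge `e` have the numbers `2 * e` and
`2 * e + 1`), as it appears in the encoding. -/
def dartVertex (x : ℕ) : ℕ := G.encode.getD (x + 1) 0

theorem dartVertex_edge (e : Fin G.numEdges) :
    G.dartVertex (2 * e) = (G.ends e).1 ∧ G.dartVertex (2 * e + 1) = (G.ends e).2 := by
  rw [dartVertex, dartVertex, encode_eq_flatEdges, List.getD_cons_succ, List.getD_cons_succ]
  exact getD_flatEdges_ofFn _ e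

theorem map_src_val : (Finset.univ : Finset G.Dart).val.map (fun d => (G.src d : ℕ)) =
    ∑ i, {((G.ends i).1 : ℕ), ((G.ends i).2 : ℕ)} := by
  rw [map_univ_prod_bool]
  simp [src]

theorem degree_eq_count (v : Fin G.numVerts) : G.degree v = Multiset.count (v : ℕ)
    ((Finset.univ : Finset G.Dart).val.map fun d => (G.src d : ℕ)) := by
  rw [Multiset.count_map, degree, Finset.card_def, Finset.filter_val]
  simp only [Fin.ext_iff, eq_comm]

theorem map_dartVertex_range : (Finset.range (2 * G.numEdges)).val.map G.dartVertex =
    (Finset.univ : Finset G.Dart).val.map fun d => (G.src d : ℕ) := by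
  rw [map_range_two_mul, map_src_val]
  exact Finset.sum_congr rfl fun e _ => by
    rw [(G.dartVertex_edge e).1, (G.dartVertex_edge e).2]

theorem degree_eq_countBefore (v : Fin G.numVerts) :
    G.degree v = countBefore G.dartVertex v (2 * G.numEdges) := by
  rw [degree_eq_count, ← map_dartVertex_range, Multiset.count_map, countBefore,
    Nat.count_eq_card_filter_range, Finset.card_def, Finset.filter_val]
  simp only [eq_comm]

theorem attached_eq_range (hG : ∀ v, Even (G.degree v)) :
    attached G.dartVertex (2 * G.numEdges) = Finset.range (2 * G.numEdges) := by
  refine Finset.filter_true_of_mem fun p hp => ?_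
  rintro ⟨hodd, -⟩
  have hmem : G.dartVertex p ∈ (Finset.univ : Finset G.Dart).val.map fun d => (G.src d : ℕ) := by
    rw [← map_dartVertex_range]
    exact Multiset.mem_map_of_mem _ hp
  obtain ⟨d, -, hd⟩ := Multiset.mem_map.1 hmem
  rw [← hd, ← degree_eq_countBefore] at hodd
  exact Nat.not_even_iff.2 hodd (hG _)

end Multigraph

/-- Join the legs `2 * e` and `2 * e + 1` for `e < m`. -/
def Builder.close (B : Builder) (m : ℕ) (h : B.Saturated (Finset.range (2 * m))) : Multigraph where
  numVerts := B.nv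
  numEdges := B.es.length + m
  ends := Fin.append
    (fun i => (⟨(B.es.get i).1, (h.edgesBelow _ (List.get_mem _ i)).1⟩,
      ⟨(B.es.get i).2, (h.edgesBelow _ (List.get_mem _ i)).2⟩))
    (fun e => (⟨B.own (2 * e), h.own_lt (Finset.mem_range.2 (by omega))⟩,
      ⟨B.own (2 * e + 1), h.own_lt (Finset.mem_range.2 (by omega))⟩))

/-- The edges that join the legs `2 * e` and `2 * e + 1` for `e < m`. -/
def closingEdges (own : ℕ → ℕ) (m : ℕ) : List (ℕ × ℕ) :=
  List.ofFn fun e : Fin m => (own (2 * e), own (2 * e + 1))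

theorem sum_get_eq_edgeEnds (es : List (ℕ × ℕ)) :
    ∑ i : Fin es.length, ({(es.get i).1, (es.get i).2} : Multiset ℕ) = edgeEnds es := by
  rw [edgeEnds, ← List.sum_ofFn]
  conv_rhs => rw [← List.ofFn_get es, List.map_ofFn]
  rfl

namespace Builder

variable {B : Builder} {m : ℕ} (h : B.Saturated (Finset.range (2 * m)))

theorem ends_close : (fun i => ((((B.close m h).ends i).1 : ℕ),
      (((B.close m h).ends i).2 : ℕ))) =
    Fin.append B.es.get fun e : Fin m => (B.own (2 * e), B.own (2 * e + 1)) := by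
  funext i
  refine Fin.addCases (fun i => ?_) (fun i => ?_) i <;> simp [close]

theorem encode_close : (B.close m h).encode =
    B.nv :: flatEdges (B.es ++ closingEdges B.own m) := by
  rw [Multigraph.encode_eq_flatEdges, ends_close]
  congr 2
  refine (List.ofFn_fin_append _ _).trans ?_
  rw [List.ofFn_get, closingEdges]

theorem isFourRegular_close : (B.close m h).IsFourRegular := by
  intro v
  have hsum : ∑ i, ({(((B.close m h).ends i).1 : ℕ), (((B.close m h).ends i).2 : ℕ)} :
      Multiset ℕ) = edgeEnds B.es + (Finset.range (2 * m)).val.map B.own := by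
    rw [map_range_two_mul, ← sum_get_eq_edgeEnds]
    refine (Fin.sum_univ_add (fun i => ({(((B.close m h).ends i).1 : ℕ),
      (((B.close m h).ends i).2 : ℕ)} : Multiset ℕ))).trans ?_
    simp [close]
  have hv : (v : ℕ) < B.nv := v.2
  rw [Multigraph.degree_eq_count, Multigraph.map_src_val, hsum, h, Multiset.count_nsmul,
    Multiset.count_eq_one_of_mem (Multiset.nodup_range _) (Multiset.mem_range.2 hv)]

end Builder

section Close

variable {N m : ℕ}

theorem cutLegs_append {a b : ℕ} (g : Fin a → ℕ × ℕ) (g' : Fin b → ℕ × ℕ) (col : Fin a → Fin N)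
    (col' : Fin b → Fin N) :
    cutLegs (Fin.append g g') (Fin.append col col') = cutLegs g col + cutLegs g' col' := by
  simp [cutLegs, Fin.sum_univ_add]

variable [NeZero N]

/-- The colours of the darts, given the colours of the edges. -/
def dartColor (col : Fin m → Fin N) (x : ℕ) : Fin N :=
  if hx : x / 2 < m then col ⟨x / 2, hx⟩ else 0

theorem cutLegs_eq_legs (own : ℕ → ℕ) (col : Fin m → Fin N) :
    cutLegs (fun e : Fin m => (own (2 * e), own (2 * e + 1))) col =
      legs (Finset.range (2 * m)) own (dartColor col) := by
  rw [legs, map_range_two_mul, cutLegs]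
  refine Finset.sum_congr rfl fun e _ => ?_
  have heven : dartColor col (2 * e) = col e := by simp [dartColor]
  have hodd : dartColor col (2 * e + 1) = col e := by
    simp [dartColor, show (2 * (e : ℕ) + 1) / 2 = e by omega]
  rw [heven, hodd]

variable {R : Type*} [CommSemiring R]

namespace Multigraph

variable {G : Multigraph}

theorem cast_numEulerianTours_eq_cutLegs (hN : (N : R) = 0) (e₀ : Fin G.numEdges) :
    (G.numEulerianTours : R) = ∑ col : Fin G.numEdges → Fin N with col e₀ = 0,
      (matchCount (cutLegs (fun i => (((G.ends i).1 : ℕ), ((G.ends i).2 : ℕ))) col) : R) := by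
  rw [cast_numEulerianTours hN e₀]
  refine Finset.sum_congr rfl fun col _ => ?_
  rw [map_univ_prod_bool]
  simp [src, cutLegs]

theorem cast_numEulerianTours_eq_legs (hN : (N : R) = 0) (e₀ : Fin G.numEdges) :
    (G.numEulerianTours : R) = ∑ col : Fin G.numEdges → Fin N with col e₀ = 0,
      (matchCount (legs (Finset.range (2 * G.numEdges)) G.dartVertex (dartColor col)) : R) := by
  have hends : (fun i => (((G.ends i).1 : ℕ), ((G.ends i).2 : ℕ))) =
      fun e : Fin G.numEdges => (G.dartVertex (2 * e), G.dartVertex (2 * e + 1)) := by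
    funext e
    rw [(G.dartVertex_edge e).1, (G.dartVertex_edge e).2]
  rw [cast_numEulerianTours_eq_cutLegs hN e₀, hends]
  simp only [cutLegs_eq_legs]

end Multigraph

theorem Builder.cast_numEulerianTours_close {B : Builder}
    (h : B.Saturated (Finset.range (2 * m))) (hN : (N : R) = 0) (e₀ : Fin m) :
    ((B.close m h).numEulerianTours : R) = ∑ col : Fin m → Fin N with col e₀ = 0,
      partFn R B.es (legs (Finset.range (2 * m)) B.own (dartColor col)) := by
  rw [Multigraph.cast_numEulerianTours_eq_cutLegs hN (Fin.natAdd B.es.length e₀), ends_close,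
    Finset.sum_filter, Finset.sum_filter]
  refine ((Fin.appendEquiv B.es.length m).sum_comp _).symm.trans ?_
  rw [Fintype.sum_prod_type_right]
  refine Finset.sum_congr rfl fun col' _ => ?_
  conv_rhs => rw [← List.ofFn_get B.es, partFn_ofFn]
  simp only [Fin.appendEquiv, Equiv.coe_fn_mk, Fin.append_right]
  split_ifs
  · refine Finset.sum_congr rfl fun col _ => ?_
    rw [← cutLegs_eq_legs, ← cutLegs_append]
    rfl
  · simp

end Close

theorem sum_neg_one_pow_mul_choose_mul_eval {R : Type*} [CommRing R] {P : Polynomial R} {n : ℕ}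
    (hP : P.natDegree < n) :
    ∑ k ∈ Finset.range (n + 1), (-1) ^ k * (n.choose k : R) * P.eval (k : R) = 0 := by
  have h := congrFun (Polynomial.fwdDiff_iter_eq_zero_of_degree_lt hP) 0
  rw [fwdDiff_iter_eq_sum_shift, Pi.zero_apply] at h
  rw [← mul_zero ((-1) ^ n), ← h, Finset.mul_sum]
  refine Finset.sum_congr rfl fun k hk => ?_
  have hsign : (-1 : R) ^ n * (-1) ^ (n - k) = (-1) ^ k := by
    obtain ⟨d, rfl⟩ := Nat.exists_eq_add_of_le (Nat.lt_succ_iff.1 (Finset.mem_range.1 hk))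
    rw [Nat.add_sub_cancel_left, pow_add, mul_assoc, ← mul_pow, neg_one_mul, neg_neg, one_pow,
      mul_one]
  rw [← hsign, zsmul_eq_mul, zero_add, nsmul_one]
  push_cast
  ring

theorem sum_choose_succ_mul_eval_succ {R : Type*} [CommRing R] {P : Polynomial R} {n : ℕ}
    (hP : P.natDegree ≤ n) :
    ∑ j ∈ Finset.range (n + 1), (-1) ^ j * ((n + 1).choose (j + 1) : R) * P.eval ((j : R) + 1) =
      P.eval 0 := by
  have h := sum_neg_one_pow_mul_choose_mul_eval (Nat.lt_succ_of_le hP)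
  rw [Finset.sum_range_succ'] at h
  simp only [pow_succ, mul_neg, mul_one, neg_mul, Finset.sum_neg_distrib, pow_zero,
    Nat.choose_zero_right, zero_add, one_mul, Nat.cast_zero, Nat.cast_succ] at h
  exact neg_add_eq_zero.1 h

theorem eq_of_forall_intCast_zmod_eq {x y : ℤ}
    (h : ∀ N : ℕ, NeZero N → (x : ZMod N) = (y : ZMod N)) : x = y := by
  have hdvd := h ((y - x).natAbs + 1) ⟨by omega⟩
  rw [ZMod.intCast_eq_intCast_iff_dvd_sub] at hdvd
  have := Int.eq_zero_of_dvd_of_natAbs_lt_natAbs hdvd (by omega)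
  omega

namespace Multigraph

variable (G : Multigraph)

/-- The instructions for the graph `G`. -/
def instrs : List Instr := code G.dartVertex (2 * G.numEdges)

variable {G}

theorem validCode_instrs (hG : ∀ v, Even (G.degree v)) :
    ValidCode G.instrs (Finset.range (2 * G.numEdges)) := by
  rw [← G.attached_eq_range hG]
  exact validCode_code _

variable (hG : ∀ v, Even (G.degree v))

/-- The 4-regular graph with `j + 1` vertices in each block. -/
def fourRegular (j : ℕ) : Multigraph :=
  (build j G.instrs).close G.numEdges ((validCode_instrs hG).saturated j)

theorem exists_polynomial_fourRegular (hE : 0 < G.numEdges) {N : ℕ} [NeZero N] {R : Type*}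
    [CommSemiring R] (hN : (N : R) = 0) :
    ∃ Q : Polynomial R, Q.natDegree ≤ numBoxes G.instrs ∧
      Q.eval 0 = normConst G.instrs * G.numEulerianTours ∧
      ∀ j : ℕ, ((fourRegular hG j).numEulerianTours : R) =
        2 ^ (j * numBoxes G.instrs) * Q.eval ((j : R) + 1) := by
  choose P hdeg heval using fun c : ℕ → Fin N =>
    exists_polynomial_codeTensor (R := R) G.instrs c
  refine ⟨∑ col : Fin G.numEdges → Fin N with col ⟨0, hE⟩ = 0, P (dartColor col),
    Polynomial.natDegree_sum_le_of_forall_le _ _ fun col _ => hdeg _, ?_, fun j => ?_⟩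
  · rw [Polynomial.eval_finsetSum, cast_numEulerianTours_eq_legs hN ⟨0, hE⟩, Finset.mul_sum]
    refine Finset.sum_congr rfl fun col _ => ?_
    rw [← heval, instrs, codeTensor_code _ hN, G.attached_eq_range hG]
  · rw [fourRegular, Builder.cast_numEulerianTours_close _ hN ⟨0, hE⟩, Polynomial.eval_finsetSum,
      Finset.mul_sum]
    refine Finset.sum_congr rfl fun col _ => ?_
    rw [(validCode_instrs hG).partFn_eq hN, heval]

theorem cast_sum_fourRegular (hE : 0 < G.numEdges) {N : ℕ} [NeZero N] {R : Type*} [CommRing R]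
    (hN : (N : R) = 0) :
    ∑ j ∈ Finset.range (numBoxes G.instrs + 1), (-1) ^ j *
        ((numBoxes G.instrs + 1).choose (j + 1) : R) *
          (2 ^ ((numBoxes G.instrs - j) * numBoxes G.instrs) *
            ((fourRegular hG j).numEulerianTours : R)) =
      2 ^ (numBoxes G.instrs * numBoxes G.instrs) * (normConst G.instrs * G.numEulerianTours) := by
  obtain ⟨Q, hdeg, hzero, hj⟩ := exists_polynomial_fourRegular hG hE hN
  rw [← hzero, ← sum_choose_succ_mul_eval_succ hdeg, Finset.mul_sum]
  refine Finset.sum_congr rfl fun j hjD => ?_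
  have hjD : j ≤ numBoxes G.instrs := Nat.lt_succ_iff.1 (Finset.mem_range.1 hjD)
  rw [hj, ← mul_assoc (2 ^ _), ← pow_add, ← add_mul, Nat.sub_add_cancel hjD]
  ring

theorem sum_fourRegular :
    ∑ j ∈ Finset.range (numBoxes G.instrs + 1), (-1) ^ j *
        ((numBoxes G.instrs + 1).choose (j + 1) : ℤ) *
          (2 ^ ((numBoxes G.instrs - j) * numBoxes G.instrs) *
            ((fourRegular hG j).numEulerianTours : ℤ)) =
      2 ^ (numBoxes G.instrs * numBoxes G.instrs) * (normConst G.instrs * G.numEulerianTours) := by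
  rcases Nat.eq_zero_or_pos G.numEdges with hE | hE
  · have hinstrs : G.instrs = [] := by rw [instrs, hE]; rfl
    have hempty : (fourRegular hG 0).numEdges = 0 := by
      simp [fourRegular, Builder.close, hinstrs, hE]
    simp [hinstrs, numEulerianTours_of_numEdges_eq_zero hE,
      numEulerianTours_of_numEdges_eq_zero hempty]
  · refine eq_of_forall_intCast_zmod_eq fun N _ => ?_
    push_cast
    exact cast_sum_fourRegular hG hE (ZMod.natCast_self N)

end Multigraph
/-! ## A program logic for oracle random access machines -/

namespace OracleRAM

theorem size_add_le {m n b : ℕ} (hm : Nat.size m ≤ b) (hn : Nat.size n ≤ b) :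
    Nat.size (m + n) ≤ b + 1 := by
  rw [Nat.size_le] at *
  rw [pow_succ]
  omega

theorem size_mul_le (m n : ℕ) : Nat.size (m * n) ≤ Nat.size m + Nat.size n := by
  rw [Nat.size_le, pow_add]
  exact Nat.mul_lt_mul'' (Nat.lt_size_self m) (Nat.lt_size_self n)

theorem size_le_self (n : ℕ) : Nat.size n ≤ n :=
  Nat.size_le.2 Nat.lt_two_pow_self

theorem Store.set_of_ne (s : Store) {A B : ℕ} (h : B ≠ A) (i v : ℕ) : s.set A i v B = s B := by
  simp [Store.set, h]

@[simp] theorem Store.set_same (s : Store) (A i v : ℕ) :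
    s.set A i v A = Function.update (s A) i v := by
  simp [Store.set]

/-- All cells of the store have bit length at most `b`. -/
def Store.Bounded (s : Store) (b : ℕ) : Prop := ∀ A i, Nat.size (s A i) ≤ b

theorem Store.Bounded.mono {s : Store} {b b' : ℕ} (h : s.Bounded b) (hb : b ≤ b') :
    s.Bounded b' := fun A i => (h A i).trans hb

theorem Store.Bounded.set {s : Store} {b : ℕ} (h : s.Bounded b) (A i : ℕ) {v : ℕ}
    (hv : Nat.size v ≤ b) : (s.set A i v).Bounded b := by
  intro B k
  by_cases hB : B = A
  · subst hB
    rw [Store.set_same]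
    rcases eq_or_ne k i with rfl | hk
    · simpa using hv
    · rw [Function.update_of_ne hk]
      exact h _ _
  · rw [Store.set_of_ne s hB]
    exact h _ _

/-- A bound for the growth of the bit length, and for the cost, in the evaluation of an
expression. Only a product can more than double a number, hence its extra term. -/
def Expr.weight (s : Store) : Expr → ℕ
  | .const c => Nat.size c + 1
  | .load _ i => i.weight s + 3
  | .op .mul a b => a.weight s + b.weight s + 4 + Nat.size (b.eval s)
  | .op _ a b => a.weight s + b.weight s + 4

theorem Op.size_eval_le {o : Op} {x y b : ℕ} (hx : Nat.size x ≤ b) (hy : Nat.size y ≤ b)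
    (ho : o ≠ .mul) : Nat.size (o.eval x y) ≤ b + 1 := by
  cases o with
  | add => exact size_add_le hx hy
  | sub => exact ((Nat.size_le_size (Nat.sub_le x y)).trans hx).trans (Nat.le_succ b)
  | mul => exact absurd rfl ho
  | div => exact ((Nat.size_le_size (Nat.div_le_self x y)).trans hx).trans (Nat.le_succ b)
  | mod => exact ((Nat.size_le_size (Nat.mod_le x y)).trans hx).trans (Nat.le_succ b)

theorem Expr.weight_add_weight_add_four_le (s : Store) (o : Op) (a c : Expr) :
    a.weight s + c.weight s + 4 ≤ (Expr.op o a c).weight s := by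
  cases o <;> simp [weight]

theorem Expr.size_eval_le {s : Store} {b : ℕ} (h : s.Bounded b) (e : Expr) :
    Nat.size (e.eval s) ≤ b + e.weight s := by
  induction e with
  | const c =>
    simp only [eval, weight]
    omega
  | load A i => exact (h A _).trans (Nat.le_add_right _ _)
  | op o a c iha ihc =>
    rcases eq_or_ne o .mul with rfl | ho
    · have := size_mul_le (a.eval s) (c.eval s)
      simp only [eval, Op.eval, weight]
      omega
    · have := weight_add_weight_add_four_le s o a c
      exact (Op.size_eval_le (iha.trans (by omega)) (ihc.trans (by omega)) ho).trans
        (by omega : b + (a.weight s + c.weight s) + 1 ≤ _)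

theorem Expr.cost_le {s : Store} {b : ℕ} (h : s.Bounded b) (e : Expr) :
    e.cost s ≤ e.weight s * (b + e.weight s) := by
  induction e with
  | const c =>
    simp only [cost, weight]
    nlinarith [Nat.zero_le (b * (Nat.size c + 1))]
  | load A i ih =>
    simp only [cost, weight]
    nlinarith [size_eval_le h i, h A (i.eval s)]
  | op o a c iha ihc =>
    have hw := weight_add_weight_add_four_le s o a c
    have hsize := size_eval_le h (.op o a c)
    have hsa := size_eval_le h a
    have hsc := size_eval_le h c
    set w := (Expr.op o a c).weight s
    have ha := iha.trans (Nat.mul_le_mul_left _ (by omega : _ ≤ b + w))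
    have hc := ihc.trans (Nat.mul_le_mul_left _ (by omega : _ ≤ b + w))
    refine le_trans ?_ (Nat.mul_le_mul_right (b + w) hw)
    simp only [eval] at hsize
    simp only [cost, add_mul]
    omega

/-- The arrays to which a program may write. -/
def Prog.writes : Prog → List ℕ
  | .skip => []
  | .assign A _ _ => [A]
  | .seq P Q => P.writes ++ Q.writes
  | .ite _ P Q => P.writes ++ Q.writes
  | .while _ P => P.writes
  | .query _ _ B => [B]

theorem Exec.frame {O : List ℕ → ℕ} {P : Prog} {s s' : Store} {t : ℕ} (h : Exec O P s s' t)
    {A : ℕ} (hA : A ∉ P.writes) : s' A = s A := by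
  induction h with
  | skip => rfl
  | assign s B i e => exact Store.set_of_ne _ (by simpa [Prog.writes] using hA) _ _
  | seq _ _ ih1 ih2 =>
    simp only [Prog.writes, List.mem_append, not_or] at hA
    rw [ih2 hA.2, ih1 hA.1]
  | ite_true _ _ ih =>
    simp only [Prog.writes, List.mem_append, not_or] at hA
    exact ih hA.1
  | ite_false _ _ ih =>
    simp only [Prog.writes, List.mem_append, not_or] at hA
    exact ih hA.2
  | while_true _ _ _ ih1 ih2 => rw [ih2 hA, ih1 hA]
  | while_false => rfl
  | query s B n C => exact Store.set_of_ne _ (by simpa [Prog.writes] using hA) _ _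

/-- The program `P` leads from `s` to `s'` in at most `T` weighted steps; such a run increases the
bit lengths in the store by at most `T` and has cost at most `T * (b + T)`, where `b` bounds
the bit lengths in `s`. This form of the bound makes `T` additive under composition. -/
def Runs (O : List ℕ → ℕ) (P : Prog) (s s' : Store) (T : ℕ) : Prop :=
  ∃ t, Exec O P s s' t ∧ ∀ b, s.Bounded b → s'.Bounded (b + T) ∧ t ≤ T * (b + T)

section Rules

variable {O : List ℕ → ℕ}

theorem Runs.frame {P : Prog} {s s' : Store} {T A : ℕ} (h : Runs O P s s' T)
    (hA : A ∉ P.writes) : s' A = s A := by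
  obtain ⟨t, h, -⟩ := h
  exact h.frame hA

theorem Runs.mono {P : Prog} {s s' : Store} {T T' : ℕ} (h : Runs O P s s' T) (hT : T ≤ T') :
    Runs O P s s' T' := by
  obtain ⟨t, h, hb⟩ := h
  refine ⟨t, h, fun b hs => ⟨(hb b hs).1.mono (by omega), (hb b hs).2.trans ?_⟩⟩
  gcongr

theorem runs_skip (s : Store) : Runs O .skip s s 1 :=
  ⟨1, Exec.skip s, fun b hs => ⟨hs.mono (by omega), by omega⟩⟩

theorem runs_assign (s : Store) (A : ℕ) (i e : Expr) :
    Runs O (.assign A i e) s (s.set A (i.eval s) (e.eval s)) (i.weight s + e.weight s + 3) := by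
  refine ⟨_, Exec.assign s A i e, fun b hs => ?_⟩
  have hsi := Expr.size_eval_le hs i
  have hse := Expr.size_eval_le hs e
  refine ⟨(hs.mono (by omega)).set _ _ (by omega), ?_⟩
  set B := b + (i.weight s + e.weight s + 3)
  have hci := (Expr.cost_le hs i).trans (Nat.mul_le_mul_left _ (by omega : _ ≤ B))
  have hce := (Expr.cost_le hs e).trans (Nat.mul_le_mul_left _ (by omega : _ ≤ B))
  simp only [add_mul]
  omega

theorem Runs.seq {P Q : Prog} {s s' s'' : Store} {T T' : ℕ} (h : Runs O P s s' T)
    (h' : Runs O Q s' s'' T') : Runs O (.seq P Q) s s'' (T + T' + 1) := by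
  obtain ⟨t, h, hb⟩ := h
  obtain ⟨t', h', hb'⟩ := h'
  refine ⟨_, h.seq h', fun b hs => ?_⟩
  obtain ⟨hs', ht⟩ := hb b hs
  obtain ⟨hs'', ht'⟩ := hb' _ hs'
  refine ⟨hs''.mono (by omega), ?_⟩
  set B := b + (T + T' + 1)
  have hB := ht.trans (Nat.mul_le_mul_left _ (by omega : _ ≤ B))
  have hB' := ht'.trans (Nat.mul_le_mul_left _ (by omega : _ ≤ B))
  simp only [add_mul]
  omega

theorem Expr.cost_add_le {s : Store} {b t T : ℕ} (hs : s.Bounded b) (e : Expr)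
    (ht : t ≤ T * (b + T)) :
    e.cost s + t + 1 ≤ (e.weight s + T + 1) * (b + (e.weight s + T + 1)) := by
  set B := b + (e.weight s + T + 1)
  have he := (cost_le hs e).trans (Nat.mul_le_mul_left _ (by omega : _ ≤ B))
  have hB := ht.trans (Nat.mul_le_mul_left _ (by omega : _ ≤ B))
  simp only [add_mul]
  omega

theorem Runs.ite_true {e : Expr} {P Q : Prog} {s s' : Store} {T : ℕ} (he : e.eval s ≠ 0)
    (h : Runs O P s s' T) : Runs O (.ite e P Q) s s' (e.weight s + T + 1) := by
  obtain ⟨t, h, hb⟩ := h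
  exact ⟨_, Exec.ite_true he h, fun b hs =>
    ⟨(hb b hs).1.mono (by omega), Expr.cost_add_le hs e (hb b hs).2⟩⟩

theorem Runs.ite_false {e : Expr} {P Q : Prog} {s s' : Store} {T : ℕ} (he : e.eval s = 0)
    (h : Runs O Q s s' T) : Runs O (.ite e P Q) s s' (e.weight s + T + 1) := by
  obtain ⟨t, h, hb⟩ := h
  exact ⟨_, Exec.ite_false he h, fun b hs =>
    ⟨(hb b hs).1.mono (by omega), Expr.cost_add_le hs e (hb b hs).2⟩⟩

theorem Runs.while_true {e : Expr} {P : Prog} {s s' s'' : Store} {T T' : ℕ} (he : e.eval s ≠ 0)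
    (h : Runs O P s s' T) (h' : Runs O (.while e P) s' s'' T') :
    Runs O (.while e P) s s'' (e.weight s + T + T' + 1) := by
  obtain ⟨t, h, hb⟩ := h
  obtain ⟨t', h', hb'⟩ := h'
  refine ⟨_, Exec.while_true he h h', fun b hs => ?_⟩
  obtain ⟨hs', ht⟩ := hb b hs
  obtain ⟨hs'', ht'⟩ := hb' _ hs'
  refine ⟨hs''.mono (by omega), ?_⟩
  set B := b + (e.weight s + T + T' + 1)
  have hc := (Expr.cost_le hs e).trans (Nat.mul_le_mul_left _ (by omega : _ ≤ B))
  have hB := ht.trans (Nat.mul_le_mul_left _ (by omega : _ ≤ B))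
  have hB' := ht'.trans (Nat.mul_le_mul_left _ (by omega : _ ≤ B))
  simp only [add_mul]
  omega

theorem Runs.while_false {e : Expr} {P : Prog} {s : Store} (he : e.eval s = 0) :
    Runs O (.while e P) s s (e.weight s + 1) :=
  ⟨_, Exec.while_false he, fun _ hs =>
    ⟨hs.mono (by omega), Expr.cost_add_le (t := 0) (T := 0) hs e (Nat.zero_le _)⟩⟩

theorem wordSize_word_le {s : Store} {b : ℕ} (hs : s.Bounded b) (A n : ℕ) :
    wordSize (s.word A n) ≤ n * (b + 1) := by
  rw [wordSize, Store.word, List.map_map]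
  refine (List.sum_le_card_nsmul _ (b + 1) ?_).trans (by simp)
  intro x hx
  obtain ⟨i, -, rfl⟩ := List.mem_map.1 hx
  exact Nat.succ_le_succ (hs A i)

theorem runs_query (s : Store) (A : ℕ) (n : Expr) (B : ℕ) :
    Runs O (.query A n B) s (s.set B 0 (O (s.word A (n.eval s))))
      (n.weight s + n.eval s + Nat.size (O (s.word A (n.eval s))) + 2) := by
  refine ⟨_, Exec.query s A n B, fun b hs => ?_⟩
  refine ⟨(hs.mono (by omega)).set _ _ (by omega), ?_⟩
  set answer := O (s.word A (n.eval s))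
  set C := b + (n.weight s + n.eval s + Nat.size answer + 2)
  have hcost := (Expr.cost_le hs n).trans (Nat.mul_le_mul_left _ (by omega : _ ≤ C))
  have hword := (wordSize_word_le hs A (n.eval s)).trans
    (Nat.mul_le_mul_left _ (by omega : _ ≤ C))
  have hsize := Nat.le_mul_of_pos_right (Nat.size answer) (by omega : 0 < C)
  simp only [add_mul]
  omega

end Rules

/-- The cell `A[0]`, used as a variable. -/
abbrev var (A : ℕ) : Expr := .load A (.const 0)

/-- The assignment `A[0] := e`. -/
abbrev setVar (A : ℕ) (e : Expr) : Prog := .assign A (.const 0) e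

/-- The loop that runs `P` while `r < n`, incrementing the variable `r` after each round. -/
def Prog.countUp (r n : ℕ) (P : Prog) : Prog :=
  .while (.op .sub (var n) (var r)) (.seq P (setVar r (.op .add (var r) (.const 1))))

/-- Repeat `P` for `r = 0, …, e - 1`; the variable `n` holds the bound. -/
def Prog.rep (r n : ℕ) (e : Expr) (P : Prog) : Prog :=
  .seq (setVar n e) (.seq (setVar r (.const 0)) (.countUp r n P))

section Loops

variable {O : List ℕ → ℕ} {r n : ℕ} {P : Prog}

theorem runs_countUp (hrn : r ≠ n) (hr : r ∉ P.writes) (hn : n ∉ P.writes) {m T : ℕ}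
    (Inv : ℕ → Store → Prop)
    (hstep : ∀ i < m, ∀ s, Inv i s → s r 0 = i →
      ∃ s', Runs O P s s' T ∧ Inv (i + 1) (s'.set r 0 (i + 1)))
    (k : ℕ) : ∀ i, i + k = m → ∀ s, Inv i s → s r 0 = i → s n 0 = m →
      ∃ s', Runs O (.countUp r n P) s s' (k * (T + 28) + 13) ∧ Inv m s' := by
  induction k with
  | zero =>
    rintro i rfl s hs hi hm
    refine ⟨s, (Runs.while_false ?_).mono ?_, hs⟩
    · simp [Expr.eval, Op.eval, hi, hm]
    · simp [Expr.weight]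
  | succ k ih =>
    intro i hik s hs hi hm
    obtain ⟨s', hrun, hinv⟩ := hstep i (by omega) s hs hi
    have hi' : s' r 0 = i := by rw [hrun.frame hr, hi]
    have hm' : s' n 0 = m := by rw [hrun.frame hn, hm]
    have hinc := runs_assign (O := O) s' r (.const 0) (.op .add (var r) (.const 1))
    simp only [Expr.eval, Op.eval, hi'] at hinc
    obtain ⟨s'', hrun', hinv'⟩ := ih (i + 1) (by omega) _ hinv (by simp)
      (by rw [Store.set_of_ne _ hrn.symm, hm'])
    refine ⟨s'', (Runs.while_true ?_ (hrun.seq hinc) hrun').mono ?_, hinv'⟩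
    · simp only [Expr.eval, Op.eval, hi, hm]
      omega
    · simp [Expr.weight, add_mul]
      omega

theorem runs_rep (hrn : r ≠ n) (hr : r ∉ P.writes) (hn : n ∉ P.writes) {e : Expr} {s : Store}
    {m T : ℕ} (hm : e.eval s = m) (Inv : ℕ → Store → Prop)
    (h0 : Inv 0 ((s.set n 0 m).set r 0 0))
    (hstep : ∀ i < m, ∀ s₁, Inv i s₁ → s₁ r 0 = i →
      (∀ A, A ≠ r → A ≠ n → A ∉ P.writes → s₁ A = s A) →
      ∃ s', Runs O P s₁ s' T ∧ Inv (i + 1) (s'.set r 0 (i + 1))) :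
    ∃ s', Runs O (.rep r n e P) s s' (e.weight s + m * (T + 28) + 24) ∧ Inv m s' := by
  obtain ⟨s', hrun, hinv, -⟩ := runs_countUp (O := O) hrn hr hn (T := T)
    (fun i s₁ => Inv i s₁ ∧ ∀ A, A ≠ r → A ≠ n → A ∉ P.writes → s₁ A = s A)
    (fun i hi s₁ hs₁ hir => by
      obtain ⟨s', hrun, hinv⟩ := hstep i hi s₁ hs₁.1 hir hs₁.2
      exact ⟨s', hrun, hinv, fun A hAr hAn hA => by
        rw [Store.set_of_ne _ hAr, hrun.frame hA, hs₁.2 A hAr hAn hA]⟩)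
    m 0 (Nat.zero_add m) ((s.set n 0 m).set r 0 0)
    ⟨h0, fun A hAr hAn _ => by rw [Store.set_of_ne _ hAr, Store.set_of_ne _ hAn]⟩ (by simp)
    (by rw [Store.set_of_ne _ hrn.symm]; simp)
  have hbound := runs_assign (O := O) s n (.const 0) e
  simp only [hm, Expr.eval] at hbound
  have hstart := runs_assign (O := O) (s.set n 0 m) r (.const 0) (.const 0)
  simp only [Expr.eval] at hstart
  refine ⟨s', (hbound.seq (hstart.seq hrun)).mono ?_, hinv⟩
  simp [Expr.weight]
  omega

end Loops

end OracleRAM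

/-! ## Writing the 4-regular graph -/

local notation:30 P:31 ";;" Q:30 => OracleRAM.Prog.seq P Q
local notation:65 a:65 "+ₑ" b:66 => OracleRAM.Expr.op OracleRAM.Op.add a b
local notation:65 a:65 "-ₑ" b:66 => OracleRAM.Expr.op OracleRAM.Op.sub a b
local notation:70 a:70 "*ₑ" b:71 => OracleRAM.Expr.op OracleRAM.Op.mul a b
local notation:70 a:70 "/ₑ" b:71 => OracleRAM.Expr.op OracleRAM.Op.div a b
local notation:70 a:70 "%ₑ" b:71 => OracleRAM.Expr.op OracleRAM.Op.mod a b

namespace OracleRAM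

/-! The arrays of the program. `input`, `word` (the graph being built) and `own` (the current
vertex of each leg) are used as arrays, the others as variables. -/

namespace Reg

@[simp] abbrev input : ℕ := 0
@[simp] abbrev inputLength : ℕ := 1
@[simp] abbrev word : ℕ := 2
@[simp] abbrev own : ℕ := 3
@[simp] abbrev wordLength : ℕ := 4
@[simp] abbrev vertices : ℕ := 5
@[simp] abbrev norm : ℕ := 6
@[simp] abbrev boxes : ℕ := 7
@[simp] abbrev chainLength : ℕ := 8
@[simp] abbrev binomial : ℕ := 9
@[simp] abbrev positive : ℕ := 10
@[simp] abbrev negative : ℕ := 11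
@[simp] abbrev answer : ℕ := 12
@[simp] abbrev dart : ℕ := 13
@[simp] abbrev dartBound : ℕ := 14
@[simp] abbrev leg : ℕ := 15
@[simp] abbrev legBound : ℕ := 16
@[simp] abbrev count : ℕ := 17
@[simp] abbrev last : ℕ := 18
@[simp] abbrev width : ℕ := 19
@[simp] abbrev block : ℕ := 20
@[simp] abbrev blockBound : ℕ := 21
@[simp] abbrev link : ℕ := 22
@[simp] abbrev linkBound : ℕ := 23
@[simp] abbrev y₁ : ℕ := 24
@[simp] abbrev y₂ : ℕ := 25
@[simp] abbrev power : ℕ := 26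
@[simp] abbrev powerBound : ℕ := 27
@[simp] abbrev termBound : ℕ := 28
@[simp] abbrev edge : ℕ := 29
@[simp] abbrev edgeBound : ℕ := 30

end Reg

section Assignments

variable {O : List ℕ → ℕ}

theorem size_two : Nat.size 2 = 2 := by decide

theorem runs_setVar {s : Store} (A : ℕ) {e : Expr} {v : ℕ} (he : e.eval s = v) :
    Runs O (setVar A e) s (s.set A 0 v) (e.weight s + 4) := by
  have := runs_assign (O := O) s A (.const 0) e
  rw [he] at this
  refine this.mono ?_
  simp [Expr.weight]
  omega

theorem runs_setArr {s : Store} (A : ℕ) {i e : Expr} {k v : ℕ} (hi : i.eval s = k)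
    (he : e.eval s = v) :
    Runs O (.assign A i e) s (s.set A k v) (i.weight s + e.weight s + 3) := by
  have := runs_assign (O := O) s A i e
  rwa [hi, he] at this

end Assignments

section Edges

variable {O : List ℕ → ℕ} {es : List (ℕ × ℕ)} {s s' : Store}

/-- The array `word` holds the edges `es`, after a cell that is reserved for the number of
vertices. -/
def HoldsEdges (es : List (ℕ × ℕ)) (s : Store) : Prop :=
  s Reg.wordLength 0 = 2 * es.length + 1 ∧
    (List.range (2 * es.length)).map (fun i => s Reg.word (i + 1)) = flatEdges es

theorem HoldsEdges.congr (h : HoldsEdges es s) (hword : s' Reg.word = s Reg.word)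
    (hlength : s' Reg.wordLength = s Reg.wordLength) : HoldsEdges es s' := by
  rwa [HoldsEdges, hword, hlength]

theorem HoldsEdges.word_eq (h : HoldsEdges es s) :
    s.word Reg.word (s Reg.wordLength 0) = s Reg.word 0 :: flatEdges es := by
  rw [Store.word, h.1, List.range_succ_eq_map, List.map_cons, List.map_map, ← h.2]
  rfl

theorem HoldsEdges.concat (h : HoldsEdges es s) (u v : ℕ) :
    HoldsEdges (es ++ [(u, v)]) (((s.set Reg.word (2 * es.length + 1) u).set
      Reg.word (2 * es.length + 2) v).set Reg.wordLength 0 (2 * es.length + 3)) := by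
  refine ⟨by simp; ring, ?_⟩
  rw [List.length_append, List.length_singleton, flatEdges_append, mul_add, mul_one,
    List.range_succ, List.range_succ, List.append_assoc, List.map_append, ← h.2]
  congr 1
  · refine List.map_congr_left fun i hi => ?_
    have := List.mem_range.1 hi
    rw [Store.set_of_ne _ (by decide), Store.set_same, Function.update_of_ne (by omega),
      Store.set_same, Function.update_of_ne (by omega)]
  · simp [Store.set_of_ne _ (show Reg.word ≠ Reg.wordLength by decide)]

/-- Append the edge `{x, y}`. -/
def edgeProg (x y : Expr) : Prog :=
  .assign Reg.word (var Reg.wordLength) x ;;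
  .assign Reg.word (var Reg.wordLength +ₑ .const 1) y ;;
  setVar Reg.wordLength (var Reg.wordLength +ₑ .const 2)

theorem runs_edgeProg {x y : Expr} {u v : ℕ} (h : HoldsEdges es s)
    (hxy : ∀ s' : Store, (∀ A, A ≠ Reg.word → A ≠ Reg.wordLength → s' A = s A) →
      x.eval s' = u ∧ y.eval s' = v ∧ x.weight s' ≤ 30 ∧ y.weight s' ≤ 30) :
    ∃ s', Runs O (edgeProg x y) s s' 100 ∧ HoldsEdges (es ++ [(u, v)]) s' := by
  have hlength := h.1
  obtain ⟨hx, -, hwx, -⟩ := hxy s fun _ _ _ => rfl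
  set s₁ := s.set Reg.word (2 * es.length + 1) u
  have hs₁ : ∀ A, A ≠ Reg.word → s₁ A = s A := fun A hA => Store.set_of_ne _ hA _ _
  obtain ⟨-, hy, -, hwy⟩ := hxy s₁ fun A hA _ => hs₁ A hA
  have hfirst : Runs O (.assign Reg.word (var Reg.wordLength) x) s s₁ 37 := by
    refine (runs_setArr _ (by simpa [Expr.eval] using hlength) hx).mono ?_
    simp [Expr.weight]
    omega
  have hsecond : Runs O (.assign Reg.word (var Reg.wordLength +ₑ .const 1) y) s₁
      (s₁.set Reg.word (2 * es.length + 2) v) 43 := by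
    refine (runs_setArr _ (by simp [Expr.eval, Op.eval, hs₁, hlength]) hy).mono ?_
    simp [Expr.weight]
    omega
  have hincr := runs_setVar (O := O) (s := s₁.set Reg.word (2 * es.length + 2) v) Reg.wordLength
    (e := var Reg.wordLength +ₑ .const 2) (v := 2 * es.length + 3)
    (by simp [Expr.eval, Op.eval, Store.set_of_ne, hs₁, hlength])
  refine ⟨_, (hfirst.seq (hsecond.seq hincr)).mono ?_, h.concat u v⟩
  simp [Expr.weight, size_two]

/-- Append one double edge of a chain. -/
def linkProg : Prog :=
  edgeProg (var Reg.vertices) (var Reg.vertices +ₑ .const 1) ;;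
  edgeProg (var Reg.vertices) (var Reg.vertices +ₑ .const 1) ;;
  setVar Reg.vertices (var Reg.vertices +ₑ .const 1)

theorem runs_linkProg {n : ℕ} (h : HoldsEdges es s) (hn : s Reg.vertices 0 = n) :
    ∃ s', Runs O linkProg s s' 216 ∧ HoldsEdges (es ++ [(n, n + 1), (n, n + 1)]) s' ∧
      s' Reg.vertices 0 = n + 1 := by
  obtain ⟨s₁, hr₁, he₁⟩ := runs_edgeProg (O := O) (x := var Reg.vertices)
    (y := var Reg.vertices +ₑ .const 1) (u := n) (v := n + 1) h
    (fun s' hs' => by simp [Expr.eval, Op.eval, Expr.weight, hs' Reg.vertices, hn])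
  have hn₁ : s₁ Reg.vertices 0 = n := by rw [hr₁.frame (by decide), hn]
  obtain ⟨s₂, hr₂, he₂⟩ := runs_edgeProg (O := O) (x := var Reg.vertices)
    (y := var Reg.vertices +ₑ .const 1) (u := n) (v := n + 1) he₁
    (fun s' hs' => by simp [Expr.eval, Op.eval, Expr.weight, hs' Reg.vertices, hn₁])
  have hn₂ : s₂ Reg.vertices 0 = n := by rw [hr₂.frame (by decide), hn₁]
  have hincr := runs_setVar (O := O) (s := s₂) Reg.vertices (e := var Reg.vertices +ₑ .const 1)
    (v := n + 1) (by simp [Expr.eval, Op.eval, hn₂])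
  refine ⟨_, (hr₁.seq (hr₂.seq hincr)).mono (by simp [Expr.weight]), ?_, by simp⟩
  rw [List.append_assoc] at he₂
  exact he₂.congr rfl rfl

/-- Append a chain of double edges. -/
def chainProg : Prog := .rep Reg.link Reg.linkBound (var Reg.chainLength) linkProg

theorem runs_chainProg {n j : ℕ} (h : HoldsEdges es s) (hn : s Reg.vertices 0 = n)
    (hj : s Reg.chainLength 0 = j) :
    ∃ s', Runs O chainProg s s' (244 * j + 28) ∧ HoldsEdges (es ++ chainEdges n j) s' ∧
      s' Reg.vertices 0 = n + j := by
  obtain ⟨s', hr, he, hn'⟩ := runs_rep (O := O) (r := Reg.link) (n := Reg.linkBound)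
    (e := var Reg.chainLength) (P := linkProg) (by decide) (by decide) (by decide)
    (s := s) (m := j) (T := 216) (by simpa [Expr.eval] using hj)
    (fun i s => HoldsEdges (es ++ chainEdges n i) s ∧ s Reg.vertices 0 = n + i)
    ⟨by rw [chainEdges, List.append_nil]; exact h.congr rfl rfl, hn⟩ (by
      rintro i - s₁ ⟨he, hn⟩ - -
      obtain ⟨s', hr, he', hn'⟩ := runs_linkProg (O := O) he hn
      refine ⟨s', hr, ?_, hn'⟩
      rw [chainEdges, ← List.append_assoc]
      exact he'.congr rfl rfl)
  refine ⟨s', hr.mono ?_, he, hn'⟩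
  simp [Expr.weight]
  omega

end Edges

section Ladders

variable {O : List ℕ → ℕ} {S : Finset ℕ} {s s' : Store} {A i v T : ℕ} {P : Prog}

/-- The registers that describe the graph being built. -/
abbrev builderRegs : List ℕ := [Reg.word, Reg.own, Reg.wordLength, Reg.vertices]

/-- The store represents the builder `B`, with its legs restricted to `S`. -/
structure HoldsBuilder (S : Finset ℕ) (B : Builder) (s : Store) : Prop where
  edges : HoldsEdges B.es s
  vertices : s Reg.vertices 0 = B.nv
  own : ∀ x ∈ S, s Reg.own x = B.own x

theorem HoldsBuilder.congr {B : Builder} (h : HoldsBuilder S B s)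
    (hs : ∀ A ∈ builderRegs, s' A = s A) : HoldsBuilder S B s' where
  edges := h.edges.congr (hs _ (by decide)) (hs _ (by decide))
  vertices := by rw [hs _ (by decide), h.vertices]
  own := by
    rw [hs _ (by decide)]
    exact h.own

theorem HoldsBuilder.set {B : Builder} (h : HoldsBuilder S B s) (hA : A ∉ builderRegs) :
    HoldsBuilder S B (s.set A i v) :=
  h.congr fun _ hB => Store.set_of_ne _ (ne_of_mem_of_not_mem hB hA) _ _

/-- The store represents the ladder `L` under construction, with its legs restricted to `S`. -/
structure HoldsLadder (S : Finset ℕ) (L : LadderState) (s : Store) : Prop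
    extends HoldsBuilder S L.toBuilder s where
  y₁ : s Reg.y₁ 0 = L.y₁
  y₂ : s Reg.y₂ 0 = L.y₂

/-- Connect the last vertex of the next block of a ladder: to the preceding block, or, in the first
block, as the new leg `leg`. -/
def cornerProg : Prog :=
  .ite (var Reg.block) (edgeProg (var Reg.y₁) (var Reg.vertices +ₑ var Reg.chainLength))
    (.assign Reg.own (var Reg.leg) (var Reg.vertices +ₑ var Reg.chainLength))

theorem runs_cornerProg {es : List (ℕ × ℕ)} {own : ℕ → ℕ} {n j p y : ℕ} (he : HoldsEdges es s)
    (hown : ∀ x ∈ S, s Reg.own x = own x) (hn : s Reg.vertices 0 = n)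
    (hj : s Reg.chainLength 0 = j) (hp : s Reg.leg 0 = p) (hi : s Reg.block 0 = i)
    (hy : s Reg.y₁ 0 = y) :
    ∃ s', Runs O cornerProg s s' 105 ∧
      HoldsEdges (es ++ if i = 0 then [] else [(y, n + j)]) s' ∧
      ∀ x ∈ S, s' Reg.own x = (if i = 0 then Function.update own p (n + j) else own) x := by
  by_cases hi₀ : i = 0
  · have hr := runs_setArr (O := O) (s := s) Reg.own (i := var Reg.leg)
      (e := var Reg.vertices +ₑ var Reg.chainLength) (k := p) (v := n + j)
      (by simpa [Expr.eval] using hp) (by simp [Expr.eval, Op.eval, hn, hj])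
    refine ⟨_, (Runs.ite_false (by simp [Expr.eval, hi, hi₀]) hr).mono ?_, ?_, fun x hx => ?_⟩
    · simp [Expr.weight]
    · rw [if_pos hi₀, List.append_nil]
      exact he.congr rfl rfl
    · simp only [Store.set_same, if_pos hi₀, Function.update_apply, hown x hx]
  · obtain ⟨s', hr, he'⟩ := runs_edgeProg (O := O) (x := var Reg.y₁)
      (y := var Reg.vertices +ₑ var Reg.chainLength) (u := y) (v := n + j) he (fun s' hs' => by
        simp [Expr.eval, Op.eval, Expr.weight, hs' Reg.vertices, hs' Reg.chainLength, hs' Reg.y₁,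
          hn, hj, hy])
    refine ⟨s', (Runs.ite_true (by simp [Expr.eval, hi, hi₀]) hr).mono ?_, ?_, fun x hx => ?_⟩
    · simp [Expr.weight]
    · rwa [if_neg hi₀]
    · rw [hr.frame (by decide), hown x hx, if_neg hi₀]

/-- Append a block of a ladder. -/
def blockProg : Prog :=
  edgeProg (var Reg.y₂) (var Reg.vertices) ;; cornerProg ;; setVar Reg.y₁ (var Reg.vertices) ;;
  chainProg ;; setVar Reg.y₂ (var Reg.vertices) ;;
  setVar Reg.vertices (var Reg.vertices +ₑ .const 1)

theorem runs_blockProg {L : LadderState} {p j : ℕ} (h : HoldsLadder S L s)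
    (hj : s Reg.chainLength 0 = j) (hp : s Reg.leg 0 = p) (hi : s Reg.block 0 = i) :
    ∃ s', Runs O blockProg s s' (244 * j + 268) ∧ HoldsLadder S (L.addBlock j p i) s' := by
  obtain ⟨s₁, hr₁, he₁⟩ := runs_edgeProg (O := O) (x := var Reg.y₂) (y := var Reg.vertices)
    (u := L.y₂) (v := L.nv) h.edges (fun s' hs' => by
      simp [Expr.eval, Expr.weight, hs' Reg.vertices, hs' Reg.y₂, h.vertices, h.y₂])
  have hs₁ (A) (hA : A ∉ (edgeProg (var Reg.y₂) (var Reg.vertices)).writes) : s₁ A = s A :=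
    hr₁.frame hA
  obtain ⟨s₂, hr₂, he₂, hown₂⟩ := runs_cornerProg (O := O) he₁ (own := L.own) (S := S)
    (by rw [hs₁ _ (by decide)]; exact h.own) ((congrFun (hs₁ _ (by decide)) 0).trans h.vertices)
    ((congrFun (hs₁ _ (by decide)) 0).trans hj) ((congrFun (hs₁ _ (by decide)) 0).trans hp)
    ((congrFun (hs₁ _ (by decide)) 0).trans hi) ((congrFun (hs₁ _ (by decide)) 0).trans h.y₁)
  have hs₂ (A) (hA : A ∉ (edgeProg (var Reg.y₂) (var Reg.vertices) ;; cornerProg).writes) :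
      s₂ A = s A := (hr₁.seq hr₂).frame hA
  have hn₂ : s₂ Reg.vertices 0 = L.nv := by rw [hs₂ _ (by decide), h.vertices]
  have hr₃ := runs_setVar (O := O) (s := s₂) Reg.y₁ (e := var Reg.vertices) (v := L.nv)
    (by simpa [Expr.eval] using hn₂)
  obtain ⟨s₄, hr₄, he₄, hn₄⟩ := runs_chainProg (O := O) (s := s₂.set Reg.y₁ 0 L.nv) (n := L.nv)
    (j := j) (he₂.congr rfl rfl) (by rw [Store.set_of_ne _ (by decide), hn₂])
    (by rw [Store.set_of_ne _ (by decide), hs₂ _ (by decide), hj])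
  have hr₅ := runs_setVar (O := O) (s := s₄) Reg.y₂ (e := var Reg.vertices) (v := L.nv + j)
    (by simpa [Expr.eval] using hn₄)
  have hr₆ := runs_setVar (O := O) (s := s₄.set Reg.y₂ 0 (L.nv + j)) Reg.vertices
    (e := var Reg.vertices +ₑ .const 1) (v := L.nv + j + 1)
    (by simpa [Expr.eval, Op.eval, Store.set] using hn₄)
  refine ⟨_, (hr₁.seq (hr₂.seq (hr₃.seq (hr₄.seq (hr₅.seq hr₆))))).mono ?_,
    ⟨?_, by simp [LadderState.addBlock], fun x hx => ?_⟩, ?_, rfl⟩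
  · simp [Expr.weight]
    omega
  · refine HoldsEdges.congr (s := s₄) ?_ rfl rfl
    simpa [LadderState.addBlock] using he₄
  · exact (congrFun (hr₄.frame (by decide)) x).trans (hown₂ x hx)
  · exact congrFun (hr₄.frame (by decide)) 0

/-- Append the blocks of a ladder on the leg `leg`; their number is `width`. -/
def blocksProg : Prog :=
  setVar Reg.y₁ (.const 0) ;; setVar Reg.y₂ (.load Reg.own (var Reg.leg)) ;;
  .rep Reg.block Reg.blockBound (var Reg.width) blockProg

theorem runs_blocksProg {B : Builder} {w p j : ℕ} (h : HoldsBuilder S B s) (hpS : p ∈ S)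
    (hj : s Reg.chainLength 0 = j) (hp : s Reg.leg 0 = p) (hw : s Reg.width 0 = w) :
    ∃ s', Runs O blocksProg s s' (w * (244 * j + 296) + 46) ∧
      HoldsLadder S (B.blocks j p w) s' := by
  have hr₁ := runs_setVar (O := O) (s := s) Reg.y₁ (e := .const 0) (v := 0) rfl
  have hr₂ := runs_setVar (O := O) (s := s.set Reg.y₁ 0 0) Reg.y₂
    (e := .load Reg.own (var Reg.leg)) (v := B.own p)
    (by simp [Expr.eval, Store.set, hp, h.own p hpS])
  obtain ⟨s', hr₃, h'⟩ := runs_rep (O := O) (r := Reg.block) (n := Reg.blockBound)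
    (e := var Reg.width) (P := blockProg) (by decide) (by decide) (by decide)
    (s := (s.set Reg.y₁ 0 0).set Reg.y₂ 0 (B.own p)) (m := w) (T := 244 * j + 268)
    (by simpa [Expr.eval, Store.set] using hw) (fun i s => HoldsLadder S (B.blocks j p i) s)
    ⟨(((h.set (by decide)).set (by decide)).set (by decide)).set (by decide), rfl, rfl⟩ (by
      intro i _ s₁ h₁ hi hs₁
      obtain ⟨s', hr, h'⟩ := runs_blockProg (O := O) h₁ (p := p) (j := j) (i := i)
        ((congrFun (hs₁ _ (by decide) (by decide) (by decide)) 0).trans hj)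
        ((congrFun (hs₁ _ (by decide) (by decide) (by decide)) 0).trans hp) hi
      exact ⟨s', hr, h'.toHoldsBuilder.set (by decide), h'.y₁, h'.y₂⟩)
  refine ⟨s', (hr₁.seq (hr₂.seq hr₃)).mono ?_, h'⟩
  simp [Expr.weight]
  linarith

end Ladders

end OracleRAM
/-! ## Executing the code of a graph -/

namespace OracleRAM

section Instructions

variable {O : List ℕ → ℕ} {S : Finset ℕ} {l : List Instr} {s s' : Store} {A i v j q T : ℕ}
  {P : Prog}

/-- The registers that describe the result of executing a list of instructions. -/
abbrev codeRegs : List ℕ := Reg.norm :: Reg.boxes :: builderRegs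

/-- The store represents the graph built by the instructions `l`, with its legs restricted to `S`,
together with the constants of `l`. -/
structure HoldsCode (j : ℕ) (S : Finset ℕ) (l : List Instr) (s : Store) : Prop
    extends HoldsBuilder S (build j l) s where
  norm : s Reg.norm 0 = normConst l
  boxes : s Reg.boxes 0 = numBoxes l

theorem HoldsCode.congr (h : HoldsCode j S l s) (hs : ∀ A ∈ codeRegs, s' A = s A) :
    HoldsCode j S l s' where
  toHoldsBuilder := h.toHoldsBuilder.congr fun A hA =>
    hs A (List.mem_cons_of_mem _ (List.mem_cons_of_mem _ hA))
  norm := by rw [hs _ (by decide), h.norm]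
  boxes := by rw [hs _ (by decide), h.boxes]

theorem HoldsCode.set (h : HoldsCode j S l s) (hA : A ∉ codeRegs) :
    HoldsCode j S l (s.set A i v) :=
  h.congr fun _ hB => Store.set_of_ne _ (ne_of_mem_of_not_mem hB hA) _ _

theorem HoldsCode.frame (h : HoldsCode j S l s) (hr : Runs O P s s' T)
    (hP : ∀ A ∈ codeRegs, A ∉ P.writes) : HoldsCode j S l s' :=
  h.congr fun A hA => hr.frame (hP A hA)

/-- Connect the end of a ladder to the leg `dart`, and account for its blocks. -/
def tieProg : Prog :=
  edgeProg (var Reg.y₁) (.load Reg.own (var Reg.dart)) ;;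
  .assign Reg.own (var Reg.dart) (var Reg.y₂) ;;
  setVar Reg.boxes (var Reg.boxes +ₑ var Reg.width) ;;
  setVar Reg.norm (var Reg.norm *ₑ var Reg.width)

theorem runs_tieProg {w p : ℕ} (h : HoldsLadder S ((build j l).blocks j p w) s) (hqS : q ∈ S)
    (hnorm : s Reg.norm 0 = normConst l) (hboxes : s Reg.boxes 0 = numBoxes l)
    (hq : s Reg.dart 0 = q) (hw : s Reg.width 0 = w) :
    ∃ s', Runs O tieProg s s' (w + 152) ∧ HoldsCode j S (l ++ [.ladder w p q]) s' := by
  set L := (build j l).blocks j p w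
  have hstep : build j (l ++ [.ladder w p q]) =
      ⟨L.es ++ [(L.y₁, L.own q)], L.nv, Function.update L.own q L.y₂⟩ := build_concat j l _
  obtain ⟨s₁, hr₁, he₁⟩ := runs_edgeProg (O := O) (x := var Reg.y₁)
    (y := .load Reg.own (var Reg.dart)) (u := L.y₁) (v := L.own q) h.edges (fun s' hs' => by
      simp [Expr.eval, Expr.weight, hs' Reg.y₁, hs' Reg.own, hs' Reg.dart, h.y₁, hq, h.own q hqS])
  have hs₁ (A) (hA : A ∉ (edgeProg (var Reg.y₁) (.load Reg.own (var Reg.dart))).writes) :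
      s₁ A = s A := hr₁.frame hA
  have hw₁ : s₁ Reg.width 0 = w := by rw [hs₁ _ (by decide), hw]
  have hr₂ := runs_setArr (O := O) (s := s₁) Reg.own (i := var Reg.dart) (e := var Reg.y₂) (k := q)
    (v := L.y₂) (by simp [Expr.eval, hs₁ Reg.dart (by decide), hq])
    (by simp [Expr.eval, hs₁ Reg.y₂ (by decide), h.y₂])
  have hr₃ := runs_setVar (O := O) (s := s₁.set Reg.own q L.y₂) Reg.boxes
    (e := var Reg.boxes +ₑ var Reg.width) (v := numBoxes l + w)
    (by simp [Expr.eval, Op.eval, Store.set, hs₁ Reg.boxes (by decide), hboxes, hw₁])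
  have hr₄ := runs_setVar (O := O)
    (s := (s₁.set Reg.own q L.y₂).set Reg.boxes 0 (numBoxes l + w)) Reg.norm
    (e := var Reg.norm *ₑ var Reg.width) (v := normConst l * w)
    (by simp [Expr.eval, Op.eval, Store.set, hs₁ Reg.norm (by decide), hnorm, hw₁])
  refine ⟨_, (hr₁.seq (hr₂.seq (hr₃.seq hr₄))).mono ?_, ⟨⟨?_, ?_, fun x hx => ?_⟩, ?_, ?_⟩⟩
  · have := size_le_self w
    simp [Expr.weight, Expr.eval, Store.set, hw₁]
    omega
  · rw [hstep]
    exact he₁.congr rfl rfl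
  · rw [hstep]
    exact (congrFun (hs₁ _ (by decide)) 0).trans h.vertices
  · rw [hstep]
    simp [Store.set, Function.update_apply, hs₁ Reg.own (by decide), h.own x hx]
  · simp [Instr.norm]
  · simp [Store.set, Instr.boxes]

/-- Execute `Instr.ladder width leg dart`. -/
def ladderProg : Prog := blocksProg ;; tieProg

theorem runs_ladderProg {w p : ℕ} (h : HoldsCode j S l s) (hpS : p ∈ S) (hqS : q ∈ S)
    (hj : s Reg.chainLength 0 = j) (hp : s Reg.leg 0 = p) (hq : s Reg.dart 0 = q)
    (hw : s Reg.width 0 = w) :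
    ∃ s', Runs O ladderProg s s' (w * (244 * j + 297) + 200) ∧
      HoldsCode j S (l ++ [.ladder w p q]) s' := by
  obtain ⟨s₁, hr₁, h₁⟩ := runs_blocksProg (O := O) h.toHoldsBuilder hpS hj hp hw
  have hs₁ (A) (hA : A ∉ blocksProg.writes) : s₁ A = s A := hr₁.frame hA
  obtain ⟨s', hr₂, h'⟩ := runs_tieProg (O := O) h₁ hqS
    (by rw [hs₁ _ (by decide), h.norm]) (by rw [hs₁ _ (by decide), h.boxes])
    (by rw [hs₁ _ (by decide), hq]) (by rw [hs₁ _ (by decide), hw])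
  exact ⟨s', (hr₁.seq hr₂).mono (by linarith), h'⟩

/-- Execute `Instr.fresh last dart`. -/
def freshProg : Prog :=
  edgeProg (var Reg.vertices) (var Reg.vertices) ;;
  .assign Reg.own (var Reg.last) (var Reg.vertices) ;;
  .assign Reg.own (var Reg.dart) (var Reg.vertices) ;;
  setVar Reg.vertices (var Reg.vertices +ₑ .const 1) ;;
  setVar Reg.norm (var Reg.norm *ₑ .const 2)

theorem runs_freshProg {z : ℕ} (h : HoldsCode j S l s) (hz : s Reg.last 0 = z)
    (hq : s Reg.dart 0 = q) :
    ∃ s', Runs O freshProg s s' 157 ∧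
      HoldsCode j (insert z (insert q S)) (l ++ [.fresh z q]) s' := by
  have hstep := build_concat j l (.fresh z q)
  set B := build j l
  obtain ⟨s₁, hr₁, he₁⟩ := runs_edgeProg (O := O) (x := var Reg.vertices) (y := var Reg.vertices)
    (u := B.nv) (v := B.nv) h.edges
    (fun s' hs' => by simp [Expr.eval, Expr.weight, hs' Reg.vertices, h.vertices, B])
  have hs₁ (A) (hA : A ∉ (edgeProg (var Reg.vertices) (var Reg.vertices)).writes) :
      s₁ A = s A := hr₁.frame hA
  have hn₁ : s₁ Reg.vertices 0 = B.nv := by rw [hs₁ _ (by decide), h.vertices]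
  have hr₂ := runs_setArr (O := O) (s := s₁) Reg.own (i := var Reg.last) (e := var Reg.vertices)
    (k := z) (v := B.nv) (by simp [Expr.eval, hs₁ Reg.last (by decide), hz])
    (by simpa [Expr.eval] using hn₁)
  have hr₃ := runs_setArr (O := O) (s := s₁.set Reg.own z B.nv) Reg.own (i := var Reg.dart)
    (e := var Reg.vertices) (k := q) (v := B.nv)
    (by simp [Expr.eval, Store.set, hs₁ Reg.dart (by decide), hq])
    (by simpa [Expr.eval, Store.set] using hn₁)
  have hr₄ := runs_setVar (O := O) (s := (s₁.set Reg.own z B.nv).set Reg.own q B.nv) Reg.vertices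
    (e := var Reg.vertices +ₑ .const 1) (v := B.nv + 1)
    (by simpa [Expr.eval, Op.eval, Store.set] using hn₁)
  have hr₅ := runs_setVar (O := O)
    (s := ((s₁.set Reg.own z B.nv).set Reg.own q B.nv).set Reg.vertices 0 (B.nv + 1)) Reg.norm
    (e := var Reg.norm *ₑ .const 2) (v := normConst l * 2)
    (by simp [Expr.eval, Op.eval, Store.set, hs₁ Reg.norm (by decide), h.norm])
  refine ⟨_, (hr₁.seq (hr₂.seq (hr₃.seq (hr₄.seq hr₅)))).mono ?_,
    ⟨⟨?_, ?_, fun x hx => ?_⟩, ?_, ?_⟩⟩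
  · simp [Expr.weight, Expr.eval, size_two]
  · rw [hstep]
    exact he₁.congr rfl rfl
  · rw [hstep]
    rfl
  · have hown := h.own x
    rw [← hs₁ _ (by decide)] at hown
    simp only [Finset.mem_insert] at hx
    rw [hstep]
    simp [Store.set, Builder.step, Function.update_apply]
    grind
  · simp [Instr.norm]
  · simp [Store.set, hs₁ Reg.boxes (by decide), h.boxes, Instr.boxes]

end Instructions

section Darts

variable {O : List ℕ → ℕ} {inp : ℕ → ℕ} {S : Finset ℕ} {l : List Instr} {s : Store}
  {c i j m p q z Q : ℕ}

/-- The input word describes the map from darts to vertices. -/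
def HoldsInput (inp : ℕ → ℕ) (s : Store) : Prop := ∀ x, s Reg.input (x + 1) = inp x

/-- Nonzero if and only if the darts `leg` and `dart` have the same vertex. -/
def sameVertexExpr : Expr :=
  .const 1 -ₑ
    ((.load Reg.input (var Reg.leg +ₑ .const 1) -ₑ .load Reg.input (var Reg.dart +ₑ .const 1)) +ₑ
      (.load Reg.input (var Reg.dart +ₑ .const 1) -ₑ .load Reg.input (var Reg.leg +ₑ .const 1)))

theorem weight_sameVertexExpr (s : Store) : sameVertexExpr.weight s = 70 := by
  simp [sameVertexExpr, Expr.weight]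

theorem eval_sameVertexExpr_ne_zero (hinp : HoldsInput inp s) (hp : s Reg.leg 0 = p)
    (hq : s Reg.dart 0 = q) : sameVertexExpr.eval s ≠ 0 ↔ inp p = inp q := by
  simp only [sameVertexExpr, Expr.eval, Op.eval, hp, hq, hinp _]
  omega

/-- Count `leg` if it is at the same vertex as `dart`. -/
def countProg : Prog :=
  .ite sameVertexExpr
    (setVar Reg.count (var Reg.count +ₑ .const 1) ;; setVar Reg.last (var Reg.leg)) .skip

theorem runs_countProg (hinp : HoldsInput inp s) (hi : s Reg.leg 0 = i) (hq : s Reg.dart 0 = q)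
    (hcount : s Reg.count 0 = countBefore inp (inp q) i)
    (hlast : s Reg.last 0 = lastBefore inp (inp q) i) :
    ∃ s', Runs O countProg s s' 94 ∧ s' Reg.count 0 = countBefore inp (inp q) (i + 1) ∧
      s' Reg.last 0 = lastBefore inp (inp q) (i + 1) := by
  have hsame := eval_sameVertexExpr_ne_zero hinp hi hq
  by_cases hv : inp i = inp q
  · have hr₁ := runs_setVar (O := O) (s := s) Reg.count (e := var Reg.count +ₑ .const 1)
      (v := countBefore inp (inp q) i + 1) (by simp [Expr.eval, Op.eval, hcount])
    have hr₂ := runs_setVar (O := O) (s := s.set Reg.count 0 (countBefore inp (inp q) i + 1))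
      Reg.last (e := var Reg.leg) (v := i) (by simp [Expr.eval, Store.set, hi])
    refine ⟨_, (Runs.ite_true (hsame.2 hv) (hr₁.seq hr₂)).mono ?_, ?_, ?_⟩
    · simp [Expr.weight, weight_sameVertexExpr]
    · simp [Store.set, countBefore_succ, hv]
    · simp [lastBefore, hv]
  · refine ⟨s, (Runs.ite_false (not_not.1 (hsame.not.2 hv)) (runs_skip s)).mono ?_, ?_, ?_⟩
    · simp [weight_sameVertexExpr]
    · simp [countBefore_succ, hv, hcount]
    · simp [lastBefore, hv, hlast]

/-- Count the darts before `dart` at the same vertex, and find the last one. -/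
def scanProg : Prog :=
  setVar Reg.count (.const 0) ;; setVar Reg.last (.const 0) ;;
  .rep Reg.leg Reg.legBound (var Reg.dart) countProg

theorem runs_scanProg (hinp : HoldsInput inp s) (hq : s Reg.dart 0 = q) :
    ∃ s', Runs O scanProg s s' (122 * q + 40) ∧
      s' Reg.count 0 = countBefore inp (inp q) q ∧
      s' Reg.last 0 = lastBefore inp (inp q) q := by
  have hr₁ := runs_setVar (O := O) (s := s) Reg.count (e := .const 0) (v := 0) rfl
  have hr₂ := runs_setVar (O := O) (s := s.set Reg.count 0 0) Reg.last (e := .const 0) (v := 0) rfl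
  obtain ⟨s', hr₃, h'⟩ := runs_rep (O := O) (r := Reg.leg) (n := Reg.legBound) (e := var Reg.dart)
    (P := countProg) (by decide) (by decide) (by decide)
    (s := (s.set Reg.count 0 0).set Reg.last 0 0) (m := q) (T := 94)
    (by simp [Expr.eval, Store.set, hq])
    (fun i s => s Reg.count 0 = countBefore inp (inp q) i ∧
      s Reg.last 0 = lastBefore inp (inp q) i)
    ⟨rfl, rfl⟩ (by
      rintro i - s₁ ⟨hcount, hlast⟩ hi hs₁
      exact runs_countProg
        (fun x => (congrFun (hs₁ _ (by decide) (by decide) (by decide)) _).trans (hinp x)) hi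
        ((congrFun (hs₁ _ (by decide) (by decide) (by decide)) 0).trans hq) hcount hlast)
  refine ⟨s', (hr₁.seq (hr₂.seq hr₃)).mono ?_, h'⟩
  simp [Expr.weight]
  omega

/-- Append the ladder between `leg` and `dart` if they are at the same vertex. -/
def ladderStepProg : Prog :=
  .ite sameVertexExpr (ladderProg ;; setVar Reg.width (var Reg.width -ₑ .const 1)) .skip

theorem runs_ladderStepProg (h : HoldsCode j S (l ++ ladders inp (inp q) m q i) s)
    (hw : s Reg.width 0 = m - countBefore inp (inp q) i) (hinp : HoldsInput inp s)
    (hj : s Reg.chainLength 0 = j) (hi : s Reg.leg 0 = i) (hq : s Reg.dart 0 = q)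
    (hiS : inp i = inp q → i ∈ S) (hqS : q ∈ S) :
    ∃ s', Runs O ladderStepProg s s' (m * (244 * j + 297) + 286) ∧
      HoldsCode j S (l ++ ladders inp (inp q) m q (i + 1)) s' ∧
      s' Reg.width 0 = m - countBefore inp (inp q) (i + 1) := by
  have hsame := eval_sameVertexExpr_ne_zero hinp hi hq
  by_cases hv : inp i = inp q
  · set w := m - countBefore inp (inp q) i with hwdef
    obtain ⟨s₁, hr₁, h₁⟩ := runs_ladderProg (O := O) h (hiS hv) hqS hj hi hq hw
    have hr₂ := runs_setVar (O := O) (s := s₁) Reg.width (e := var Reg.width -ₑ .const 1)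
      (v := w - 1)
      (by simp [Expr.eval, Op.eval, hr₁.frame (show Reg.width ∉ ladderProg.writes by decide), hw])
    refine ⟨_, (Runs.ite_true (hsame.2 hv) (hr₁.seq hr₂)).mono ?_, ?_, ?_⟩
    · have : w * (244 * j + 297) ≤ m * (244 * j + 297) := Nat.mul_le_mul_right _ (Nat.sub_le _ _)
      simp [Expr.weight, weight_sameVertexExpr]
      omega
    · rw [ladders, if_pos hv, ← List.append_assoc]
      exact h₁.set (by decide)
    · rw [countBefore_succ, if_pos hv, ← Nat.sub_sub]
      simp [hwdef]
  · refine ⟨s, (Runs.ite_false (not_not.1 (hsame.not.2 hv)) (runs_skip s)).mono ?_, ?_, ?_⟩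
    · simp [weight_sameVertexExpr]
    · rwa [ladders, if_neg hv]
    · simpa [countBefore_succ, hv] using hw

/-- Append the ladders between `dart` and the darts before `last` at the same vertex. -/
def laddersProg : Prog :=
  setVar Reg.width (var Reg.count -ₑ .const 1) ;;
  .rep Reg.leg Reg.legBound (var Reg.last) ladderStepProg

theorem runs_laddersProg (h : HoldsCode j S l s) (hinp : HoldsInput inp s)
    (hj : s Reg.chainLength 0 = j) (hq : s Reg.dart 0 = q) (hc : s Reg.count 0 = c)
    (hz : s Reg.last 0 = z) (hS : ∀ i < z, inp i = inp q → i ∈ S) (hqS : q ∈ S) :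
    ∃ s', Runs O laddersProg s s' (z * ((c - 1) * (244 * j + 297) + 314) + 45) ∧
      HoldsCode j S (l ++ ladders inp (inp q) (c - 1) q z) s' := by
  have hr₁ := runs_setVar (O := O) (s := s) Reg.width (e := var Reg.count -ₑ .const 1)
    (v := c - 1) (by simp [Expr.eval, Op.eval, hc])
  obtain ⟨s', hr₂, h', -⟩ := runs_rep (O := O) (r := Reg.leg) (n := Reg.legBound)
    (e := var Reg.last) (P := ladderStepProg) (by decide) (by decide) (by decide)
    (s := s.set Reg.width 0 (c - 1)) (m := z) (T := (c - 1) * (244 * j + 297) + 286)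
    (by simp [Expr.eval, Store.set, hz])
    (fun i s => HoldsCode j S (l ++ ladders inp (inp q) (c - 1) q i) s ∧
      s Reg.width 0 = c - 1 - countBefore inp (inp q) i)
    ⟨by
      rw [ladders, List.append_nil]
      exact ((h.set (by decide)).set (by decide)).set (by decide), rfl⟩ (by
      rintro i hi s₁ ⟨h₁, hw⟩ hleg hs₁
      obtain ⟨s', hr, h', hw'⟩ := runs_ladderStepProg (O := O) h₁ hw
        (fun x => (congrFun (hs₁ _ (by decide) (by decide) (by decide)) _).trans (hinp x))
        ((congrFun (hs₁ _ (by decide) (by decide) (by decide)) 0).trans hj) hleg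
        ((congrFun (hs₁ _ (by decide) (by decide) (by decide)) 0).trans hq) (hS i hi) hqS
      exact ⟨s', hr, h'.set (by decide), hw'⟩)
  refine ⟨s', (hr₁.seq hr₂).mono ?_, h'⟩
  simp only [Expr.weight, Nat.size_zero, Nat.size_one]
  linarith

/-- Execute the code of the dart `dart`. -/
def dartProg : Prog :=
  scanProg ;; .ite (var Reg.count %ₑ .const 2) (freshProg ;; laddersProg) .skip

theorem runs_dartProg (h : HoldsCode j (attached inp q) (code inp q) s) (hinp : HoldsInput inp s)
    (hq : s Reg.dart 0 = q) (hj : s Reg.chainLength 0 = j) :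
    ∃ s', Runs O dartProg s s' (q * (q * (244 * j + 297) + 436) + 260) ∧
      HoldsCode j (attached inp (q + 1)) (code inp (q + 1)) s' := by
  obtain ⟨s₁, hr₁, hcount, hlast⟩ := runs_scanProg (O := O) hinp hq
  have h₁ := h.frame hr₁ (by decide)
  by_cases hodd : countBefore inp (inp q) q % 2 = 1
  · set c := countBefore inp (inp q) q
    set z := lastBefore inp (inp q) q
    obtain ⟨s₂, hr₂, h₂⟩ := runs_freshProg (O := O) h₁ hlast (by rw [hr₁.frame (by decide), hq])
    have hs₂ (A) (hA : A ∉ (scanProg ;; freshProg).writes) : s₂ A = s A := (hr₁.seq hr₂).frame hA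
    obtain ⟨s₃, hr₃, h₃⟩ := runs_laddersProg (O := O) h₂
      (fun x => (congrFun (hs₂ _ (by decide)) _).trans (hinp x)) (by rw [hs₂ _ (by decide), hj])
      (by rw [hs₂ _ (by decide), hq]) (by rw [hr₂.frame (by decide), hcount])
      (by rw [hr₂.frame (by decide), hlast]) (fun i hi hv => Finset.mem_insert_of_mem
        (Finset.mem_insert_of_mem (mem_attached_of_lt_lastBefore (hv ▸ hi)))) (by simp)
    refine ⟨s₃, (hr₁.seq (Runs.ite_true ?_ (hr₂.seq hr₃))).mono ?_, ?_⟩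
    · simp [Expr.eval, Op.eval, hcount, c, hodd]
    · have hc : c - 1 ≤ q := (Nat.sub_le _ _).trans (countBefore_le _ _)
      have hz : z * ((c - 1) * (244 * j + 297) + 314) ≤ q * (q * (244 * j + 297) + 314) := by
        gcongr
        exact lastBefore_le _ _
      simp only [Expr.weight, size_two, Nat.size_zero]
      linarith
    · rw [code, dartCode, if_pos hodd, attached_succ_of_odd hodd]
      simpa using h₃
  · refine ⟨s₁, (hr₁.seq (Runs.ite_false ?_ (runs_skip s₁))).mono ?_, ?_⟩
    · simp only [Expr.eval, Op.eval, hcount]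
      omega
    · simp only [Expr.weight, size_two, Nat.size_zero]
      nlinarith [Nat.zero_le (q * (q * (244 * j + 297)))]
    · rwa [code, dartCode, if_neg hodd, attached_succ_of_even hodd, List.append_nil]

end Darts

end OracleRAM
/-! ## The program that writes the 4-regular graph -/

namespace OracleRAM

section Gadgets

variable {O : List ℕ → ℕ} {inp : ℕ → ℕ} {s : Store} {j Q : ℕ}

/-- Replace the vertices of the input graph by gadgets; the legs at the darts stay open. -/
def gadgetsProg : Prog :=
  setVar Reg.wordLength (.const 1) ;; setVar Reg.vertices (.const 0) ;;
  setVar Reg.norm (.const 1) ;; setVar Reg.boxes (.const 0) ;;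
  .rep Reg.dart Reg.dartBound (var Reg.inputLength -ₑ .const 1) dartProg

theorem runs_gadgetsProg (hinp : HoldsInput inp s) (hlength : s Reg.inputLength 0 = Q + 1)
    (hj : s Reg.chainLength 0 = j) :
    ∃ s', Runs O gadgetsProg s s' (Q * (Q * (Q * (244 * j + 297) + 436) + 288) + 80) ∧
      HoldsCode j (attached inp Q) (code inp Q) s' := by
  have hr₁ := runs_setVar (O := O) (s := s) Reg.wordLength (e := .const 1) (v := 1) rfl
  have hr₂ := runs_setVar (O := O) (s := s.set Reg.wordLength 0 1) Reg.vertices (e := .const 0)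
    (v := 0) rfl
  have hr₃ := runs_setVar (O := O) (s := (s.set Reg.wordLength 0 1).set Reg.vertices 0 0) Reg.norm
    (e := .const 1) (v := 1) rfl
  have hr₄ := runs_setVar (O := O)
    (s := ((s.set Reg.wordLength 0 1).set Reg.vertices 0 0).set Reg.norm 0 1) Reg.boxes
    (e := .const 0) (v := 0) rfl
  have hr := hr₁.seq (hr₂.seq (hr₃.seq hr₄))
  set s₁ := (((s.set Reg.wordLength 0 1).set Reg.vertices 0 0).set Reg.norm 0 1).set Reg.boxes 0 0
  obtain ⟨s', hr₅, h'⟩ := runs_rep (O := O) (r := Reg.dart) (n := Reg.dartBound)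
    (e := var Reg.inputLength -ₑ .const 1) (P := dartProg) (by decide) (by decide) (by decide)
    (s := s₁) (m := Q) (T := Q * (Q * (244 * j + 297) + 436) + 260)
    (by simp [Expr.eval, Op.eval, hr.frame (show Reg.inputLength ∉ _ by decide), hlength])
    (fun q s => HoldsCode j (attached inp q) (code inp q) s)
    ⟨⟨⟨rfl, rfl⟩, rfl, by simp [attached]⟩, rfl, rfl⟩ (by
      rintro q hq s₂ h₂ hdart hs₂
      have hinput : s₂ Reg.input = s Reg.input :=
        (hs₂ _ (by decide) (by decide) (by decide)).trans (hr.frame (by decide))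
      have hchain : s₂ Reg.chainLength = s Reg.chainLength :=
        (hs₂ _ (by decide) (by decide) (by decide)).trans (hr.frame (by decide))
      obtain ⟨s₃, hr₃, h₃⟩ := runs_dartProg (O := O) h₂
        (fun x => (congrFun hinput _).trans (hinp x)) hdart ((congrFun hchain 0).trans hj)
      refine ⟨s₃, hr₃.mono ?_, h₃.set (by decide)⟩
      gcongr)
  refine ⟨s', (hr₁.seq (hr₂.seq (hr₃.seq (hr₄.seq hr₅)))).mono ?_, h'⟩
  simp only [Expr.weight, Nat.size_zero, Nat.size_one]
  linarith

end Gadgets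

section Closing

variable {O : List ℕ → ℕ} {S : Finset ℕ} {B : Builder} {s : Store} {m : ℕ}

theorem closingEdges_succ (own : ℕ → ℕ) (m : ℕ) :
    closingEdges own (m + 1) = closingEdges own m ++ [(own (2 * m), own (2 * m + 1))] := by
  rw [closingEdges, List.ofFn_succ_last]
  rfl

/-- Join the legs at the two darts of each edge of the input graph, and write the number of
vertices. -/
def closeProg : Prog :=
  .rep Reg.edge Reg.edgeBound ((var Reg.inputLength -ₑ .const 1) /ₑ .const 2)
    (edgeProg (.load Reg.own (var Reg.edge +ₑ var Reg.edge))
      (.load Reg.own (var Reg.edge +ₑ var Reg.edge +ₑ .const 1))) ;;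
  .assign Reg.word (.const 0) (var Reg.vertices)

theorem runs_closeProg (h : HoldsBuilder (Finset.range (2 * m)) B s)
    (hlength : s Reg.inputLength 0 = 2 * m + 1) :
    ∃ s', Runs O closeProg s s' (128 * m + 60) ∧
      s'.word Reg.word (s' Reg.wordLength 0) = B.nv :: flatEdges (B.es ++ closingEdges B.own m) ∧
      s' Reg.wordLength 0 = 2 * (B.es.length + m) + 1 := by
  obtain ⟨s₁, hr₁, h₁, hn₁⟩ := runs_rep (O := O) (r := Reg.edge) (n := Reg.edgeBound)
    (e := (var Reg.inputLength -ₑ .const 1) /ₑ .const 2)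
    (P := edgeProg (.load Reg.own (var Reg.edge +ₑ var Reg.edge))
      (.load Reg.own (var Reg.edge +ₑ var Reg.edge +ₑ .const 1)))
    (by decide) (by decide) (by decide) (s := s) (m := m) (T := 100)
    (by simp [Expr.eval, Op.eval, hlength])
    (fun i s => HoldsEdges (B.es ++ closingEdges B.own i) s ∧ s Reg.vertices 0 = B.nv)
    ⟨by
      rw [closingEdges, List.ofFn_zero, List.append_nil]
      exact h.edges.congr rfl rfl, h.vertices⟩ (by
      rintro i hi s₁ ⟨h₁, hn⟩ hedge hs₁
      have hown (x) (hx : x < 2 * m) : s₁ Reg.own x = B.own x := by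
        rw [hs₁ _ (by decide) (by decide) (by decide), h.own x (Finset.mem_range.2 hx)]
      obtain ⟨s₂, hr₂, h₂⟩ := runs_edgeProg (O := O)
        (x := .load Reg.own (var Reg.edge +ₑ var Reg.edge))
        (y := .load Reg.own (var Reg.edge +ₑ var Reg.edge +ₑ .const 1))
        (u := B.own (2 * i)) (v := B.own (2 * i + 1)) h₁ (fun s' hs' => by
          simp [Expr.eval, Op.eval, Expr.weight, hs' Reg.edge, hs' Reg.own, hedge, ← two_mul,
            hown (2 * i) (by omega), hown (2 * i + 1) (by omega)])
      refine ⟨s₂, hr₂, ?_, ?_⟩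
      · rw [closingEdges_succ, ← List.append_assoc]
        exact h₂.congr rfl rfl
      · exact (congrFun (hr₂.frame (by decide)) 0).trans hn)
  have hr₂ := runs_setArr (O := O) (s := s₁) Reg.word (i := .const 0) (e := var Reg.vertices)
    (k := 0) (v := B.nv) rfl (by simpa [Expr.eval] using hn₁)
  have h₂ : HoldsEdges (B.es ++ closingEdges B.own m) (s₁.set Reg.word 0 B.nv) :=
    ⟨h₁.1, by simpa [-List.map_append] using h₁.2⟩
  refine ⟨_, (hr₁.seq hr₂).mono ?_, by rw [h₂.word_eq]; simp, by simpa [closingEdges] using h₂.1⟩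
  simp only [Expr.weight, size_two, Nat.size_zero, Nat.size_one]
  linarith

end Closing

/-- Write the `4`-regular graph of the input graph with `chainLength + 1` vertices in each block. -/
def buildProg : Prog := gadgetsProg ;; closeProg

theorem runs_buildProg {O : List ℕ → ℕ} {G : Multigraph} (hG : ∀ v, Even (G.degree v)) {S j : ℕ}
    (hS : 2 * G.numEdges + 1 ≤ S) (hjS : j ≤ S ^ 3) {s : Store} (hinp : HoldsInput G.dartVertex s)
    (hlength : s Reg.inputLength 0 = 2 * G.numEdges + 1) (hj : s Reg.chainLength 0 = j) :
    ∃ s', Runs O buildProg s s' (1543 * S ^ 6) ∧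
      s'.word Reg.word (s' Reg.wordLength 0) = (G.fourRegular hG j).encode ∧
      s' Reg.wordLength 0 = 2 * (G.fourRegular hG j).numEdges + 1 ∧
      s' Reg.norm 0 = normConst G.instrs ∧ s' Reg.boxes 0 = numBoxes G.instrs := by
  obtain ⟨s₁, hr₁, h₁⟩ := runs_gadgetsProg (O := O) hinp hlength hj
  rw [G.attached_eq_range hG] at h₁
  obtain ⟨s', hr₂, hword, hlength'⟩ := runs_closeProg (O := O) h₁.toHoldsBuilder
    (by rw [hr₁.frame (by decide), hlength])
  refine ⟨s', (hr₁.seq hr₂).mono ?_, ?_, hlength', ?_, ?_⟩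
  · have hS' : 1 ≤ S := by omega
    set Q := 2 * G.numEdges
    calc Q * (Q * (Q * (244 * j + 297) + 436) + 288) + 80 + (128 * G.numEdges + 60) + 1
      _ ≤ S * (S * (S * (244 * S ^ 3 + 297) + 436) + 288) + 80 + (128 * S + 60) + 1 := by
        gcongr <;> omega
      _ = 244 * S ^ 6 + 297 * S ^ 3 + 436 * S ^ 2 + 416 * S ^ 1 + 141 * S ^ 0 := by ring
      _ ≤ 244 * S ^ 6 + 297 * S ^ 6 + 436 * S ^ 6 + 416 * S ^ 6 + 141 * S ^ 6 := by
        gcongr <;> first | exact hS' | decide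
      _ ≤ 1543 * S ^ 6 := by omega
  · rw [hword, Multigraph.fourRegular, Builder.encode_close]
    rfl
  · exact (congrFun (hr₂.frame (by decide)) 0).trans h₁.norm
  · exact (congrFun (hr₂.frame (by decide)) 0).trans h₁.boxes

end OracleRAM
/-! ## Size bounds -/

theorem ValidCode.normConst_pos {l : List Instr} {A : Finset ℕ} (h : ValidCode l A) :
    0 < normConst l := by
  induction h with
  | nil => simp
  | fresh _ _ _ _ ih => simpa [normConst, Instr.norm] using ih
  | ladder _ hw _ _ _ ih => simpa [normConst, Instr.norm, hw] using ih

section Code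

variable (inp : ℕ → ℕ) {q Q : ℕ}

theorem length_ladders_le (v m q i : ℕ) : (ladders inp v m q i).length ≤ i := by
  induction i with
  | zero => simp [ladders]
  | succ i ih =>
    rw [ladders]
    split_ifs
    · simpa using ih
    · omega

theorem numBoxes_ladders_le (v m q i : ℕ) : numBoxes (ladders inp v m q i) ≤ i * m := by
  induction i with
  | zero => simp [ladders]
  | succ i ih =>
    rw [ladders, add_mul, one_mul]
    split_ifs
    · rw [numBoxes_append, numBoxes_singleton]
      exact Nat.add_le_add ih (Nat.sub_le _ _)
    · omega

theorem length_dartCode_le (q : ℕ) : (dartCode inp q).length ≤ q + 1 := by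
  rw [dartCode]
  split_ifs
  · exact Nat.succ_le_succ ((length_ladders_le inp _ _ _ _).trans (lastBefore_le _ _))
  · simp

theorem numBoxes_dartCode_le (q : ℕ) : numBoxes (dartCode inp q) ≤ q * q := by
  rw [dartCode]
  split_ifs
  · rw [← List.singleton_append, numBoxes_append, numBoxes_singleton, Instr.boxes, zero_add]
    exact (numBoxes_ladders_le inp _ _ _ _).trans
      (Nat.mul_le_mul (lastBefore_le _ _) ((Nat.sub_le _ _).trans (countBefore_le _ _)))
  · simp

theorem length_code_le (hq : q ≤ Q) : (code inp q).length ≤ q * (Q + 1) := by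
  induction q with
  | zero => simp [code]
  | succ q ih =>
    rw [code, List.length_append, Nat.succ_mul]
    exact Nat.add_le_add (ih (by omega)) ((length_dartCode_le inp q).trans (by omega))

theorem numBoxes_code_le (hq : q ≤ Q) : numBoxes (code inp q) ≤ q * (Q * Q) := by
  induction q with
  | zero => simp [code]
  | succ q ih =>
    rw [code, numBoxes_append, Nat.succ_mul]
    have hqQ : q ≤ Q := by omega
    exact Nat.add_le_add (ih hqQ) ((numBoxes_dartCode_le inp q).trans (Nat.mul_le_mul hqQ hqQ))

end Code

theorem length_chainEdges (n j : ℕ) : (chainEdges n j).length = 2 * j := by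
  induction j with
  | zero => rfl
  | succ j ih =>
    rw [chainEdges, List.length_append, ih]
    rfl

theorem Builder.length_blocks_le (j p : ℕ) (B : Builder) (i : ℕ) :
    (B.blocks j p i).es.length ≤ B.es.length + i * (2 * j + 2) := by
  induction i with
  | zero => simp [blocks]
  | succ i ih =>
    rw [blocks, LadderState.addBlock]
    simp only [List.length_append, List.length_cons, length_chainEdges, add_mul, one_mul]
    split_ifs <;> simp <;> omega

theorem length_build_le (j : ℕ) (l : List Instr) :
    (build j l).es.length ≤ l.length + numBoxes l * (2 * j + 2) := by
  induction l using List.reverseRecOn with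
  | nil => simp
  | append_singleton l i ih =>
    rw [build_concat, numBoxes_append, numBoxes_singleton, add_mul]
    cases i with
    | fresh p q =>
      simp only [Builder.step, Instr.boxes, List.length_append, List.length_singleton]
      omega
    | ladder w p q =>
      have := Builder.length_blocks_le j p (build j l) w
      simp only [Builder.step, Instr.boxes, List.length_append, List.length_singleton]
      omega

theorem size_factorial_le (n : ℕ) : Nat.size n.factorial ≤ n * n + 1 := by
  rw [Nat.size_le]
  calc n.factorial ≤ n ^ n := Nat.factorial_le_pow n
    _ ≤ (2 ^ n) ^ n := Nat.pow_le_pow_left Nat.lt_two_pow_self.le n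
    _ = 2 ^ (n * n) := (pow_mul 2 n n).symm
    _ < 2 ^ (n * n + 1) := Nat.pow_lt_pow_right (by decide) (Nat.lt_succ_self _)

namespace Multigraph

variable {G : Multigraph} {S : ℕ}

theorem length_encode (G : Multigraph) : G.encode.length = 2 * G.numEdges + 1 := by
  rw [encode_eq_flatEdges, List.length_cons, length_flatEdges, List.length_ofFn]

theorem numBoxes_instrs_le (hS : 2 * G.numEdges + 1 ≤ S) : numBoxes G.instrs ≤ S ^ 3 := by
  refine (numBoxes_code_le _ le_rfl).trans ?_
  calc 2 * G.numEdges * (2 * G.numEdges * (2 * G.numEdges)) ≤ S * (S * S) := by gcongr <;> omega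
    _ = S ^ 3 := by ring

theorem numEdges_fourRegular_le (hG : ∀ v, Even (G.degree v)) (hS : 2 * G.numEdges + 1 ≤ S)
    {j : ℕ} (hj : j ≤ S ^ 3) : (G.fourRegular hG j).numEdges ≤ 6 * S ^ 6 := by
  have hS' : 1 ≤ S := by omega
  have hlength : G.instrs.length ≤ S * S := (length_code_le _ le_rfl).trans (by gcongr; omega)
  have hboxes := numBoxes_instrs_le hS
  calc (build j G.instrs).es.length + G.numEdges
    _ ≤ G.instrs.length + numBoxes G.instrs * (2 * j + 2) + G.numEdges := by
      gcongr
      exact length_build_le _ _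
    _ ≤ S * S + S ^ 3 * (2 * S ^ 3 + 2) + S := by
      gcongr
      omega
    _ = 2 * S ^ 6 + 2 * S ^ 3 + S ^ 2 + S ^ 1 := by ring
    _ ≤ 2 * S ^ 6 + 2 * S ^ 6 + S ^ 6 + S ^ 6 := by
      gcongr <;> first | exact hS' | decide
    _ = 6 * S ^ 6 := by ring

theorem size_numEulerianTours_le {H : Multigraph} (hS : 1 ≤ S) (hH : H.numEdges ≤ 6 * S ^ 6) :
    Nat.size H.numEulerianTours ≤ 145 * S ^ 12 := by
  calc Nat.size H.numEulerianTours
    _ ≤ H.numEdges * 2 * (H.numEdges * 2) + 1 :=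
      (Nat.size_le_size H.numEulerianTours_le_factorial).trans (size_factorial_le _)
    _ ≤ 6 * S ^ 6 * 2 * (6 * S ^ 6 * 2) + S ^ 12 := by
      gcongr
      exact Nat.one_le_pow _ _ hS
    _ = 145 * S ^ 12 := by ring

end Multigraph
/-! ## The reduction -/

namespace OracleRAM

section Terms

variable {O : List ℕ → ℕ} {s : Store} {D N c j : ℕ}

/-- The alternating sum that the program evaluates, after `i` terms. The powers of two are arranged
so that adding a term amounts to one step of Horner's scheme. -/
def partialSum (D : ℕ) (N : ℕ → ℕ) (i : ℕ) : ℤ :=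
  ∑ j ∈ Finset.range i,
    (-1) ^ j * ((D + 1).choose (j + 1) : ℤ) * (2 ^ ((i - 1 - j) * D) * (N j : ℤ))

theorem partialSum_succ (D : ℕ) (N : ℕ → ℕ) (i : ℕ) :
    partialSum D N (i + 1) =
      2 ^ D * partialSum D N i + (-1) ^ i * (((D + 1).choose (i + 1) * N i : ℕ) : ℤ) := by
  rw [partialSum, Finset.sum_range_succ, partialSum, Finset.mul_sum]
  congr 1
  · refine Finset.sum_congr rfl fun j hj => ?_
    have hij : i + 1 - 1 - j = (i - 1 - j) + 1 := by
      have := Finset.mem_range.1 hj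
      omega
    rw [hij, add_mul, one_mul, pow_add]
    ring
  · simp only [Nat.add_sub_cancel, Nat.sub_self, zero_mul, pow_zero, one_mul, Nat.cast_mul]
    ring

/-- Replace the binomial coefficient of `chainLength` by the next one. -/
def binomialProg : Prog :=
  setVar Reg.binomial
    (var Reg.binomial *ₑ (var Reg.boxes +ₑ .const 1 -ₑ var Reg.chainLength) /ₑ
      (var Reg.chainLength +ₑ .const 1))

theorem runs_binomialProg (hboxes : s Reg.boxes 0 = D) (hj : s Reg.chainLength 0 = j)
    (hbinomial : s Reg.binomial 0 = (D + 1).choose j) :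
    Runs O binomialProg s (s.set Reg.binomial 0 ((D + 1).choose (j + 1))) (D + 50) := by
  refine (runs_setVar (O := O) Reg.binomial (v := (D + 1).choose (j + 1)) ?_).mono ?_
  · simp only [Expr.eval, Op.eval, hboxes, hj, hbinomial, ← Nat.choose_succ_right_eq]
    exact Nat.mul_div_cancel _ (Nat.succ_pos j)
  · have := size_le_self (D + 1 - j)
    simp only [Expr.weight, Expr.eval, Op.eval, Nat.size_zero, Nat.size_one, hboxes, hj]
    omega

/-- Multiply the partial sum by `2 ^ boxes`. -/
def shiftProg : Prog :=
  .rep Reg.power Reg.powerBound (var Reg.boxes)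
    (setVar Reg.positive (var Reg.positive +ₑ var Reg.positive) ;;
      setVar Reg.negative (var Reg.negative +ₑ var Reg.negative))

theorem runs_shiftProg {a b : ℕ} (hboxes : s Reg.boxes 0 = D) (ha : s Reg.positive 0 = a)
    (hb : s Reg.negative 0 = b) :
    ∃ s', Runs O shiftProg s s' (61 * D + 28) ∧ s' Reg.positive 0 = 2 ^ D * a ∧
      s' Reg.negative 0 = 2 ^ D * b := by
  obtain ⟨s', hr, h⟩ := runs_rep (O := O) (r := Reg.power) (n := Reg.powerBound)
    (e := var Reg.boxes) (P := setVar Reg.positive (var Reg.positive +ₑ var Reg.positive) ;;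
      setVar Reg.negative (var Reg.negative +ₑ var Reg.negative))
    (by decide) (by decide) (by decide) (s := s) (m := D) (T := 33) (by simp [Expr.eval, hboxes])
    (fun i s => s Reg.positive 0 = 2 ^ i * a ∧ s Reg.negative 0 = 2 ^ i * b)
    (by simp [Store.set, ha, hb])
    (by
      rintro i - s₁ ⟨ha, hb⟩ - -
      have hr₁ := runs_setVar (O := O) (s := s₁) Reg.positive
        (e := var Reg.positive +ₑ var Reg.positive) (v := 2 ^ (i + 1) * a) (by
          simp only [Expr.eval, Op.eval, ha]
          ring)
      have hr₂ := runs_setVar (O := O) (s := s₁.set Reg.positive 0 (2 ^ (i + 1) * a)) Reg.negative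
        (e := var Reg.negative +ₑ var Reg.negative) (v := 2 ^ (i + 1) * b) (by
          have hneg : Reg.negative ≠ Reg.positive := by decide
          simp only [Expr.eval, Op.eval, Store.set_of_ne _ hneg, hb]
          ring)
      exact ⟨_, (hr₁.seq hr₂).mono (by simp [Expr.weight]), by simp [Store.set]⟩)
  refine ⟨s', hr.mono ?_, h⟩
  simp only [Expr.weight, Nat.size_zero]
  omega

/-- Add `binomial * answer` with the sign of `(-1) ^ chainLength`. -/
def addProg : Prog :=
  .ite (var Reg.chainLength %ₑ .const 2)
    (setVar Reg.negative (var Reg.negative +ₑ var Reg.binomial *ₑ var Reg.answer))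
    (setVar Reg.positive (var Reg.positive +ₑ var Reg.binomial *ₑ var Reg.answer))

theorem runs_addProg (hj : s Reg.chainLength 0 = j) (hc : s Reg.binomial 0 = c)
    (hN : s Reg.answer 0 = N) :
    ∃ s', Runs O addProg s s' (Nat.size N + 36) ∧
      (s' Reg.positive 0 : ℤ) - s' Reg.negative 0 =
        s Reg.positive 0 - s Reg.negative 0 + (-1) ^ j * ((c * N : ℕ) : ℤ) := by
  rcases Nat.even_or_odd j with hparity | hparity
  · have hr := runs_setVar (O := O) (s := s) Reg.positive
      (e := var Reg.positive +ₑ var Reg.binomial *ₑ var Reg.answer)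
      (v := s Reg.positive 0 + c * N) (by simp [Expr.eval, Op.eval, hc, hN])
    refine ⟨_, (Runs.ite_false ?_ hr).mono ?_, ?_⟩
    · simp [Expr.eval, Op.eval, hj, Nat.even_iff.1 hparity]
    · simp only [Expr.weight, Expr.eval, size_two, Nat.size_zero, hN]
      omega
    · rw [Store.set_same, Store.set_of_ne _ (by decide), hparity.neg_one_pow]
      push_cast [Function.update_self]
      ring
  · have hr := runs_setVar (O := O) (s := s) Reg.negative
      (e := var Reg.negative +ₑ var Reg.binomial *ₑ var Reg.answer)
      (v := s Reg.negative 0 + c * N) (by simp [Expr.eval, Op.eval, hc, hN])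
    refine ⟨_, (Runs.ite_true ?_ hr).mono ?_, ?_⟩
    · simp [Expr.eval, Op.eval, hj, Nat.odd_iff.1 hparity]
    · simp only [Expr.weight, Expr.eval, size_two, Nat.size_zero, hN]
      omega
    · rw [Store.set_same, Store.set_of_ne _ (by decide), hparity.neg_one_pow]
      push_cast [Function.update_self]
      ring

/-- Account for the answer to one query. -/
def updateProg : Prog := binomialProg ;; shiftProg ;; addProg

theorem runs_updateProg (hboxes : s Reg.boxes 0 = D) (hj : s Reg.chainLength 0 = j)
    (hbinomial : s Reg.binomial 0 = (D + 1).choose j) (hN : s Reg.answer 0 = N) :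
    ∃ s', Runs O updateProg s s' (62 * D + Nat.size N + 116) ∧
      s' Reg.binomial 0 = (D + 1).choose (j + 1) ∧
      (s' Reg.positive 0 : ℤ) - s' Reg.negative 0 =
        2 ^ D * ((s Reg.positive 0 : ℤ) - s Reg.negative 0) +
          (-1) ^ j * (((D + 1).choose (j + 1) * N : ℕ) : ℤ) := by
  have hr₁ := runs_binomialProg (O := O) hboxes hj hbinomial
  set s₁ := s.set Reg.binomial 0 ((D + 1).choose (j + 1))
  obtain ⟨s₂, hr₂, ha, hb⟩ := runs_shiftProg (O := O) (s := s₁) hboxes rfl rfl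
  have hbinomial₂ : s₂ Reg.binomial 0 = (D + 1).choose (j + 1) := by
    simp [hr₂.frame (show Reg.binomial ∉ shiftProg.writes by decide), s₁]
  obtain ⟨s₃, hr₃, hsum⟩ := runs_addProg (O := O)
    ((congrFun (hr₂.frame (by decide)) 0).trans hj) hbinomial₂
    ((congrFun (hr₂.frame (by decide)) 0).trans hN)
  refine ⟨s₃, (hr₁.seq (hr₂.seq hr₃)).mono (by omega), ?_, ?_⟩
  · rw [hr₃.frame (by decide), hbinomial₂]
  · rw [hsum, ha, hb, hr₁.frame (by decide), hr₁.frame (by decide)]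
    push_cast
    ring

end Terms

section Sum

variable {O : List ℕ → ℕ} {G : Multigraph} {S : ℕ}

/-- Query the graph with `chainLength + 1` vertices in each block, and account for the answer. -/
def termProg : Prog :=
  buildProg ;; .query Reg.word (var Reg.wordLength) Reg.answer ;; updateProg

/-- The store represents the partial sum after the queries for the chain lengths below `i`. -/
structure HoldsSum (hG : ∀ v, Even (G.degree v)) (i : ℕ) (s : Store) : Prop where
  norm : s Reg.norm 0 = normConst G.instrs
  boxes : s Reg.boxes 0 = numBoxes G.instrs
  binomial : s Reg.binomial 0 = (numBoxes G.instrs + 1).choose i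
  sum : (s Reg.positive 0 : ℤ) - s Reg.negative 0 =
    partialSum (numBoxes G.instrs) (fun k => (G.fourRegular hG k).numEulerianTours) i

theorem runs_termProg (hO : ∀ H : Multigraph, H.IsFourRegular → O H.encode = H.numEulerianTours)
    {hG : ∀ v, Even (G.degree v)} (hS : 2 * G.numEdges + 1 ≤ S) {j : ℕ}
    (hjD : j ≤ numBoxes G.instrs) {s : Store} (hinp : HoldsInput G.dartVertex s)
    (hlength : s Reg.inputLength 0 = 2 * G.numEdges + 1) (hj : s Reg.chainLength 0 = j)
    (h : HoldsSum hG j s) :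
    ∃ s', Runs O termProg s s' (2100 * S ^ 12) ∧ HoldsSum hG (j + 1) s' := by
  have hD := Multigraph.numBoxes_instrs_le hS
  have hedges := Multigraph.numEdges_fourRegular_le hG hS (hjD.trans hD)
  have hsize := Multigraph.size_numEulerianTours_le (by omega) hedges
  obtain ⟨s₁, hr₁, hword, hwordLength, hnorm, hboxes⟩ :=
    runs_buildProg (O := O) hG hS (hjD.trans hD) hinp hlength hj
  have hs₁ (A) (hA : A ∉ buildProg.writes) : s₁ A = s A := hr₁.frame hA
  have hr₂ := runs_query (O := O) s₁ Reg.word (var Reg.wordLength) Reg.answer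
  rw [show (var Reg.wordLength).eval s₁ = s₁ Reg.wordLength 0 from rfl, hword,
    hO (G.fourRegular hG j) (Builder.isFourRegular_close _)] at hr₂
  set N := (G.fourRegular hG j).numEulerianTours
  obtain ⟨s₃, hr₃, hbinomial, hsum⟩ := runs_updateProg (O := O) (N := N)
    (s := s₁.set Reg.answer 0 N) hboxes ((congrFun (hs₁ _ (by decide)) 0).trans hj)
    ((congrFun (hs₁ _ (by decide)) 0).trans h.binomial) (by simp)
  refine ⟨s₃, (hr₁.seq (hr₂.seq hr₃)).mono ?_, ?_, ?_, hbinomial, ?_⟩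
  · have hS₆ : S ^ 6 ≤ S ^ 12 := Nat.pow_le_pow_right (by omega) (by decide)
    have hS₃ : S ^ 3 ≤ S ^ 12 := Nat.pow_le_pow_right (by omega) (by decide)
    have hS₀ : 1 ≤ S ^ 12 := Nat.one_le_pow _ _ (by omega)
    simp only [Expr.weight, Nat.size_zero, hwordLength]
    omega
  · exact (congrFun (hr₃.frame (by decide)) 0).trans hnorm
  · exact (congrFun (hr₃.frame (by decide)) 0).trans hboxes
  · rw [partialSum_succ, hsum, ← h.sum, ← hs₁ Reg.positive (by decide),
      ← hs₁ Reg.negative (by decide)]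
    rfl

/-- Evaluate the alternating sum of the answers for all chain lengths up to the number of boxes. The
first run of `buildProg` only serves to compute that number. -/
def sumProg : Prog :=
  buildProg ;; setVar Reg.binomial (.const 1) ;;
  .rep Reg.chainLength Reg.termBound (var Reg.boxes +ₑ .const 1) termProg

theorem runs_sumProg (hO : ∀ H : Multigraph, H.IsFourRegular → O H.encode = H.numEulerianTours)
    (hG : ∀ v, Even (G.degree v)) (hS : 2 * G.numEdges + 1 ≤ S) :
    ∃ s, Runs O sumProg (initStore G.encode) s (5900 * S ^ 15) ∧
      HoldsSum hG (numBoxes G.instrs + 1) s := by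
  obtain ⟨s₁, hr₁, -, -, hnorm, hboxes⟩ := runs_buildProg (O := O) hG hS (Nat.zero_le _)
    (s := initStore G.encode) (fun x => rfl) G.length_encode rfl
  have hr₂ := runs_setVar (O := O) (s := s₁) Reg.binomial (e := .const 1) (v := 1) rfl
  have hr := hr₁.seq hr₂
  obtain ⟨s₃, hr₃, hsum⟩ := runs_rep (O := O) (r := Reg.chainLength) (n := Reg.termBound)
    (e := var Reg.boxes +ₑ .const 1) (P := termProg) (by decide) (by decide) (by decide)
    (s := s₁.set Reg.binomial 0 1) (m := numBoxes G.instrs + 1) (T := 2100 * S ^ 12)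
    (by simpa [Expr.eval, Op.eval, Store.set] using hboxes) (HoldsSum hG)
    ⟨hnorm, hboxes, by simp [Store.set], by
      simp [Store.set, partialSum, hr₁.frame (show Reg.positive ∉ _ by decide),
        hr₁.frame (show Reg.negative ∉ _ by decide), initStore]⟩
    (by
      intro i hi s₃ h hchain hs₃
      have hinput : s₃ Reg.input = initStore G.encode Reg.input :=
        (hs₃ _ (by decide) (by decide) (by decide)).trans (hr.frame (by decide))
      have hlength : s₃ Reg.inputLength = initStore G.encode Reg.inputLength :=
        (hs₃ _ (by decide) (by decide) (by decide)).trans (hr.frame (by decide))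
      obtain ⟨s₄, hr₄, h₄⟩ := runs_termProg (O := O) hO hS (Nat.lt_succ_iff.1 hi)
        (fun x => congrFun hinput _) ((congrFun hlength 0).trans G.length_encode) hchain h
      exact ⟨s₄, hr₄, h₄.1, h₄.2, h₄.3, h₄.4⟩)
  refine ⟨s₃, (hr₁.seq (hr₂.seq hr₃)).mono ?_, hsum⟩
  have hS' : 1 ≤ S := by omega
  have hloop : (numBoxes G.instrs + 1) * (2100 * S ^ 12 + 28) ≤ 4256 * S ^ 15 :=
    calc (numBoxes G.instrs + 1) * (2100 * S ^ 12 + 28)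
      _ ≤ (S ^ 3 + S ^ 3) * (2100 * S ^ 12 + 28 * S ^ 12) := by
        gcongr
        · exact Multigraph.numBoxes_instrs_le hS
        · exact Nat.one_le_pow _ _ hS'
        · exact Nat.le_mul_of_pos_right _ (by positivity)
      _ = 4256 * S ^ 15 := by ring
  have hS₆ : S ^ 6 ≤ S ^ 15 := Nat.pow_le_pow_right hS' (by decide)
  have hS₀ : 1 ≤ S ^ 15 := Nat.one_le_pow _ _ hS'
  simp only [Expr.weight, Nat.size_zero, Nat.size_one]
  omega

end Sum

section Quotient

variable {O : List ℕ → ℕ} {G : Multigraph} {S : ℕ}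

/-- Multiply `norm` by `2 ^ (boxes * boxes)`. -/
def normProg : Prog :=
  .rep Reg.power Reg.powerBound (var Reg.boxes *ₑ var Reg.boxes)
    (setVar Reg.norm (var Reg.norm +ₑ var Reg.norm))

theorem runs_normProg {s : Store} {D K : ℕ} (hboxes : s Reg.boxes 0 = D)
    (hnorm : s Reg.norm 0 = K) :
    ∃ s', Runs O normProg s s' (D + 44 * (D * D) + 36) ∧ s' Reg.norm 0 = 2 ^ (D * D) * K := by
  obtain ⟨s', hr, h⟩ := runs_rep (O := O) (r := Reg.power) (n := Reg.powerBound)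
    (e := var Reg.boxes *ₑ var Reg.boxes) (P := setVar Reg.norm (var Reg.norm +ₑ var Reg.norm))
    (by decide) (by decide) (by decide) (s := s) (m := D * D) (T := 16)
    (by simp [Expr.eval, Op.eval, hboxes]) (fun i s => s Reg.norm 0 = 2 ^ i * K)
    (by simp [Store.set, hnorm])
    (by
      rintro i - s₁ hnorm - -
      have hr₁ := runs_setVar (O := O) (s := s₁) Reg.norm (e := var Reg.norm +ₑ var Reg.norm)
        (v := 2 ^ (i + 1) * K) (by
          simp only [Expr.eval, Op.eval, hnorm]
          ring)
      exact ⟨_, hr₁.mono (by simp [Expr.weight]), by simp [Store.set]⟩)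
  refine ⟨s', hr.mono ?_, h⟩
  have := size_le_self D
  simp only [Expr.weight, Expr.eval, Nat.size_zero, hboxes]
  omega

theorem HoldsSum.sub_eq {hG : ∀ v, Even (G.degree v)} {s : Store}
    (h : HoldsSum hG (numBoxes G.instrs + 1) s) :
    s Reg.positive 0 - s Reg.negative 0 =
      2 ^ (numBoxes G.instrs * numBoxes G.instrs) * normConst G.instrs * G.numEulerianTours := by
  have hsum := h.sum.trans (Multigraph.sum_fourRegular hG)
  rw [sub_eq_iff_eq_add] at hsum
  rw [mul_assoc]
  exact Nat.sub_eq_of_eq_add (mod_cast hsum)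

/-- Count the Eulerian tours of the input graph. -/
def mainProg : Prog :=
  sumProg ;; normProg ;;
  setVar Reg.input ((var Reg.positive -ₑ var Reg.negative) /ₑ var Reg.norm)

theorem runs_mainProg (hO : ∀ H : Multigraph, H.IsFourRegular → O H.encode = H.numEulerianTours)
    (hG : ∀ v, Even (G.degree v)) (hS : 2 * G.numEdges + 1 ≤ S) :
    ∃ s, Runs O mainProg (initStore G.encode) s (6100 * S ^ 15) ∧
      s Reg.input 0 = G.numEulerianTours := by
  obtain ⟨s₁, hr₁, hsum⟩ := runs_sumProg hO hG hS
  obtain ⟨s₂, hr₂, hnorm⟩ := runs_normProg (O := O) hsum.boxes hsum.norm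
  have hpos := (G.validCode_instrs hG).normConst_pos
  have hr₃ := runs_setVar (O := O) (s := s₂) Reg.input
    (e := (var Reg.positive -ₑ var Reg.negative) /ₑ var Reg.norm) (v := G.numEulerianTours) (by
      simp only [Expr.eval, Op.eval]
      rw [hr₂.frame (A := Reg.positive) (by decide), hr₂.frame (A := Reg.negative) (by decide),
        hsum.sub_eq, hnorm]
      exact Nat.mul_div_cancel_left _ (by positivity))
  refine ⟨_, (hr₁.seq (hr₂.seq hr₃)).mono ?_, by simp⟩
  have hS' : 1 ≤ S := by omega
  have hD := Multigraph.numBoxes_instrs_le hS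
  have hDD : numBoxes G.instrs * numBoxes G.instrs ≤ S ^ 6 :=
    (Nat.mul_le_mul hD hD).trans_eq (by ring)
  have hS₆ : S ^ 6 ≤ S ^ 15 := Nat.pow_le_pow_right hS' (by decide)
  have hS₃ : S ^ 3 ≤ S ^ 15 := Nat.pow_le_pow_right hS' (by decide)
  have hS₀ : 1 ≤ S ^ 15 := Nat.one_le_pow _ _ hS'
  simp only [Expr.weight, Nat.size_zero]
  omega

end Quotient

theorem length_le_wordSize (w : List ℕ) : w.length ≤ wordSize w := by
  induction w with
  | nil => simp
  | cons a w ih =>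
    simp only [wordSize, List.map_cons, List.sum_cons, List.length_cons] at *
    omega

theorem size_le_wordSize {w : List ℕ} {x : ℕ} (hx : x ∈ w) : Nat.size x ≤ wordSize w :=
  (Nat.le_succ _).trans (List.single_le_sum (fun _ _ => Nat.zero_le _) _
    (List.mem_map_of_mem (f := fun x => Nat.size x + 1) hx))

theorem bounded_initStore (w : List ℕ) : (initStore w).Bounded (wordSize w) := by
  intro A i
  rw [initStore]
  split_ifs
  · by_cases hi : i < w.length
    · rw [List.getD_eq_getElem _ _ hi]
      exact size_le_wordSize (List.getElem_mem hi)
    · rw [List.getD_eq_default _ _ (by omega)]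
      simp
  · exact (size_le_self _).trans (length_le_wordSize w)
  · simp

theorem outputs_mainProg {O : List ℕ → ℕ} {G : Multigraph}
    (hO : ∀ H : Multigraph, H.IsFourRegular → O H.encode = H.numEulerianTours)
    (hG : ∀ v, Even (G.degree v)) :
    Outputs O mainProg G.encode G.numEulerianTours
      (37216100 * (wordSize G.encode + 1) ^ 30) := by
  have hlength := length_le_wordSize G.encode
  rw [G.length_encode] at hlength
  obtain ⟨s, ⟨t, ht, hcost⟩, hs⟩ := runs_mainProg hO hG (S := wordSize G.encode + 1) (by omega)
  refine ⟨s, t, ht, hs, (hcost _ (bounded_initStore _)).2.trans ?_⟩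
  set b := wordSize G.encode
  calc 6100 * (b + 1) ^ 15 * (b + 6100 * (b + 1) ^ 15)
    _ ≤ 6100 * (b + 1) ^ 15 * ((b + 1) ^ 15 + 6100 * (b + 1) ^ 15) := by
      gcongr
      exact (Nat.le_succ b).trans (Nat.le_self_pow (by decide) _)
    _ = 37216100 * (b + 1) ^ 30 := by ring

end OracleRAM

theorem mainTheorem1_general :
    (sharpET fun G => ∀ v, Even (G.degree v)).PolyTimeTuringReducible
      (sharpET Multigraph.IsFourRegular) := by
  refine ⟨OracleRAM.mainProg, 37216100 * (Polynomial.X + 1) ^ 30, fun O hO ⟨G, hG⟩ => ?_⟩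
  simpa [sharpET] using OracleRAM.outputs_mainProg (fun H hH => hO ⟨H, hH⟩) hG

theorem mainTheorem1 :
    (sharpET Multigraph.IsEulerian).PolyTimeTuringReducible
      (sharpET Multigraph.IsFourRegular) :=
  let ⟨P, T, h⟩ := mainTheorem1_general
  ⟨P, T, fun O hO G => h O hO ⟨G.1, G.2.2⟩⟩
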